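/- Let $M$ be a connected smooth 3-manifold and $F\colon M\to\mathbb R^4$ an indefinite affine hypersphere: a smooth immersion with affine (Blaschke) normal $\xi$, whose sign is chosen such that the affine metric $h$ in $D_XF_*Y=F_*(\nabla_XY)+h(X,Y)\xi$ has signature $(-,+,+)$, and with shape operator $S=H\,\mathrm{Id}$, $H$ constant ($D_X\xi=-F_*(SX)$). Let $\widehat\nabla$ be the Levi-Civita connection of $h$ and $K=\nabla-\widehat\nabla$ the difference tensor. Suppose that at every point $p\in M$ the group of all $L\in SO(T_pM,h)$ with $K(LX,LY)=L\,K(X,Y)$ for all $X,Y\in T_pM$ is isomorphic to $\mathbb Z_3$ or to $SO(2)$. Locally there are smooth $h$-orthonormal frames $T,V,W$ ($T$ timelike) and functions $a_4>0$, $a_6\ge 0$ with $$K(T,T)=-2a_4T,\quad K(T,V)=a_4V,\quad K(T,W)=a_4W,$$ $$K(V,V)=-a_4T+a_6V,\quad K(V,W)=-a_6W,\quad K(W,W)=-a_4T-a_6V,$$ at least near the points of a dense open subset of $M$; put $\Gamma_{22}=h(\widehat\nabla_VT,V)$. Suppose that $\nu=\Gamma_{22}^2-a_4^2-H\neq0$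 at some point where such a frame exists. Then, up to an affine transformation of $\mathbb R^4$, $M$ is (locally parametrized as) a product $$(t,v,w)\mapsto(\gamma_1(t),\gamma_2(t)\,\phi(v,w)),$$ with $\phi$ a positive definite elliptic or hyperbolic affine sphere in $\mathbb R^3$ and $\gamma=(\gamma_1,\gamma_2)$ a plane curve. Precisely: there are an affine isomorphism $A\colon\mathbb R^4\to\mathbb R\times\mathbb R^3$, an open interval $I$, a smooth curve $\gamma=(\gamma_1,\gamma_2)\colon I\to\mathbb R^2$ and $\varepsilon\in\{1,-1\}$, all independent of the point, such that every point of $M$ has an open neighbourhood $U$ with a diffeomorphism $\psi\colon J\times N\to U$, where $J\subseteq I$ is an open interval and $N\subseteq\mathbb R^2$ is open and connected, and a positive definite affine sphere $\phi\colon N\to\mathbb R^3$ with affine normal $-\varepsilon\phi$ (elliptic with mean curvature $1$ if $\varepsilon=1$, hyperbolic with mean curvature $-1$ if $\varepsilon=-1$) such that $$A(F(\psi(t,y)))=(\gamma_1(t),\gamma_2(t)\,\phi(y))\qquad(t\in J,\ y\in N).$$ Moreover, if the symmetry group is isomorphic to $SO(2)$ at every point of $M$, then each $\phi(N)$ lies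 in an ellipsoid or in a two-sheeted hyperboloid. -/

import Mathlib

open scoped ContDiff Manifold

noncomputable section

namespace AffineSphere

/-- The Euclidean space `ℝⁿ`; its standard determinant is the volume form of affine geometry. -/
abbrev R (n : ℕ) := EuclideanSpace ℝ (Fin n)

/-! ### Hypersurfaces with a transversal field, in a parametrization

`f : ℝⁿ → ℝⁿ⁺¹` is a parametrized hypersurface and `ξ` a vector field along it. Everything below is
only used at points of an open set on which `f` and `ξ` are smooth. -/

/-- The linear map `(u, c) ↦ df(u) + c ξ` at the point `x`. -/
def frameMap {n : ℕ} (f ξ : R n → R (n + 1)) (x : R n) : R n × ℝ →L[ℝ] R (n + 1) :=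
  (fderiv ℝ f x).coprod (ContinuousLinearMap.toSpanSingleton ℝ (ξ x))

/-- Splitting of a vector of `ℝⁿ⁺¹` at `f x` into its tangential part (pulled back to `ℝⁿ`) and its
`ξ`-component; meaningful where `f` is an immersion and `ξ` is transversal. -/
def split {n : ℕ} (f ξ : R n → R (n + 1)) (x : R n) : R (n + 1) →L[ℝ] R n × ℝ :=
  (frameMap f ξ x).inverse

/-- The induced connection `∇_X Y`: tangential part of `D_X (df(Y))` in
`D_X (df(Y)) = df(∇_X Y) + h(X, Y) ξ`. -/
def inducedConnection {n : ℕ} (f ξ : R n → R (n + 1)) (X Y : R n → R n) (x : R n) : R n :=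
  (split f ξ x (fderiv ℝ (fun y => fderiv ℝ f y (Y y)) x (X x))).1

/-- The affine metric `h`: the `ξ`-component in the Gauss formula (for constant coordinate fields;
`h` is a tensor). -/
def affineMetric {n : ℕ} (f ξ : R n → R (n + 1)) (x : R n) : R n →L[ℝ] R n →L[ℝ] ℝ :=
  (ContinuousLinearMap.compL ℝ (R n) (R (n + 1)) ℝ
    ((ContinuousLinearMap.snd ℝ (R n) ℝ).comp (split f ξ x))).comp (fderiv ℝ (fderiv ℝ f) x)

/-- The shape operator `S`, from `D_u ξ = - df(S u) + (transversal part)`. -/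
def shapeOperator {n : ℕ} (f ξ : R n → R (n + 1)) (x u : R n) : R n :=
  -(split f ξ x (fderiv ℝ ξ x u)).1

/-- The one-form `w ↦ (D_u g(v, w) + D_v g(u, w) - D_w g(u, v)) / 2` of Christoffel symbols of the
first kind of a pseudo-Riemannian metric `g` on an open set of `ℝⁿ`. -/
def christoffelForm {n : ℕ} (g : R n → R n →L[ℝ] R n →L[ℝ] ℝ) (x u v : R n) : R n →L[ℝ] ℝ :=
  (1 / 2 : ℝ) • (fderiv ℝ g x u v + fderiv ℝ g x v u - ((fderiv ℝ g x).flip u).flip v)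

/-- The Levi-Civita connection `∇̂_X Y = D_X Y + Γ(X, Y)` of a (nondegenerate) pseudo-Riemannian
metric `g`, where `g(Γ(u, v), ·) = christoffelForm g x u v`. -/
def leviCivita {n : ℕ} (g : R n → R n →L[ℝ] R n →L[ℝ] ℝ) (X Y : R n → R n) (x : R n) : R n :=
  fderiv ℝ Y x (X x) + (g x).inverse (christoffelForm g x (X x) (Y x))

/-- The difference tensor `K(u, v) = ∇_u v - ∇̂_u v`, evaluated on constant coordinate fields (the
difference of two connections is a tensor). -/
def differenceTensor {n : ℕ} (f ξ : R n → R (n + 1)) (x u v : R n) : R n :=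
  inducedConnection f ξ (fun _ => u) (fun _ => v) x
    - leviCivita (affineMetric f ξ) (fun _ => u) (fun _ => v) x

/-- `det (∂₁f, …, ∂ₙf, ξ)` at `x`, i.e. the induced volume form on the coordinate frame. -/
def inducedVolume {n : ℕ} (f ξ : R n → R (n + 1)) (x : R n) : ℝ :=
  Matrix.det (Matrix.of fun i j : Fin (n + 1) =>
    (Fin.snoc (α := fun _ => R (n + 1))
      (fun k : Fin n => fderiv ℝ f x (EuclideanSpace.single k 1)) (ξ x)) j i)

/-- `det (h(∂ᵢ, ∂ⱼ))` at `x`. -/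
def metricDet {n : ℕ} (f ξ : R n → R (n + 1)) (x : R n) : ℝ :=
  Matrix.det (Matrix.of fun i j : Fin n =>
    affineMetric f ξ x (EuclideanSpace.single i 1) (EuclideanSpace.single j 1))

/-- On the open set `U`, `f` is a smooth nondegenerate immersed hypersurface and `ξ` is (one of the
two choices, `ξ` or `-ξ`, of) its affine normal: `ξ` is transversal, `Dξ` is tangential, and the
induced volume form agrees up to orientation with the volume form `|det h|^{1/2}` of the affine
metric. (Injectivity of `frameMap` contains the immersion property, and the last condition contains
nondegeneracy of `h`.) -/
structure IsBlaschkeOn {n : ℕ} (f ξ : R n → R (n + 1)) (U : Set (R n)) : Prop where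
  smooth : ContDiffOn ℝ ∞ f U
  smooth_normal : ContDiffOn ℝ ∞ ξ U
  transversal : ∀ x ∈ U, Function.Bijective (frameMap f ξ x)
  tangential : ∀ x ∈ U, ∀ u : R n, (split f ξ x (fderiv ℝ ξ x u)).2 = 0
  volume_eq : ∀ x ∈ U, |inducedVolume f ξ x| = Real.sqrt |metricDet f ξ x|

/-- `f` is on `U` an affine hypersphere with affine normal `ξ` and (constant) mean curvature `H`:
`S = H Id`. -/
structure IsAffineHypersphereOn {n : ℕ} (f ξ : R n → R (n + 1)) (H : ℝ) (U : Set (R n)) :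
    Prop where
  blaschke : IsBlaschkeOn f ξ U
  shape : ∀ x ∈ U, ∀ u : R n, shapeOperator f ξ x u = H • u

/-- `φ : N → ℝ³` is a positive definite proper affine sphere, with centre at the origin and mean
curvature `ε = ±1`, so with affine normal `-ε φ`; it is elliptic for `ε = 1` and hyperbolic for
`ε = -1`. -/
structure IsPosDefProperAffineSphereOn (φ : R 2 → R 3) (ε : ℝ) (N : Set (R 2)) : Prop where
  mean_curvature : ε = 1 ∨ ε = -1
  sphere : IsAffineHypersphereOn φ (fun y => -(ε • φ y)) ε N
  posDef : ∀ y ∈ N, ∀ u : R 2, u ≠ 0 → 0 < affineMetric φ (fun y => -(ε • φ y)) y u u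

/-! ### Pointwise symmetry -/

/-- `t, v, w` is an orthonormal basis with `t` timelike and `v, w` spacelike; its existence says that
`g` has signature `(-, +, +)`. -/
structure IsLorentzONB (g : R 3 →L[ℝ] R 3 →L[ℝ] ℝ) (t v w : R 3) : Prop where
  tt : g t t = -1
  vv : g v v = 1
  ww : g w w = 1
  tv : g t v = 0
  tw : g t w = 0
  vw : g v w = 0

/-- The group of all linear maps of determinant one which preserve the metric `g` and the
`(1,2)`-tensor `K`. -/
def symmetryGroup {n : ℕ} (g : R n →L[ℝ] R n →L[ℝ] ℝ) (K : R n → R n → R n) :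
    Subgroup (R n ≃ₗ[ℝ] R n) where
  carrier := {L | LinearEquiv.det L = 1 ∧ (∀ u v, g (L u) (L v) = g u v) ∧
    ∀ u v, K (L u) (L v) = L (K u v)}
  one_mem' := ⟨map_one _, fun _ _ => rfl, fun _ _ => rfl⟩
  mul_mem' := by
    rintro L L' ⟨h1, h2, h3⟩ ⟨h1', h2', h3'⟩
    refine ⟨by rw [map_mul, h1, h1', one_mul], fun u v => ?_, fun u v => ?_⟩
    · exact (h2 _ _).trans (h2' u v)
    · exact (h3 _ _).trans (congrArg L (h3' u v))
  inv_mem' := by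
    rintro L ⟨h1, h2, h3⟩
    have hL : ∀ u, L (L⁻¹ u) = u := fun u => L.apply_symm_apply u
    refine ⟨by rw [map_inv, h1, inv_one], fun u v => ?_, fun u v => ?_⟩
    · rw [← h2 (L⁻¹ u) (L⁻¹ v), hL, hL]
    · apply L.injective
      rw [← h3, hL, hL, hL]

/-- At the point `x`, the group of all `L ∈ SO(h)` preserving `K` is isomorphic to `G`. (For an
affine hypersphere the shape operator `H Id` is preserved by every linear map.) -/
def HasSymmetryAt {n : ℕ} (G : Type) [Group G] (f ξ : R n → R (n + 1)) (x : R n) : Prop :=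
  Nonempty (symmetryGroup (affineMetric f ξ x) (differenceTensor f ξ x) ≃* G)

/-- The cyclic group of order three. -/
abbrev Z3 : Type := Multiplicative (ZMod 3)

/-- The rotation group of the plane. -/
abbrev SO2 : Type := Matrix.specialOrthogonalGroup (Fin 2) ℝ

/-- `T, V, W` is on `U` a smooth orthonormal frame, `T` timelike, in which the difference tensor has
the normal form
`K(T,T) = -2 a₄ T`, `K(T,V) = a₄ V`, `K(T,W) = a₄ W`, `K(V,V) = -a₄ T + a₆ V`, `K(V,W) = -a₆ W`,
`K(W,W) = -a₄ T - a₆ V`, with `a₄ > 0` and `a₆ ≥ 0`. -/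
structure IsAdaptedFrameOn (f ξ : R 3 → R 4) (U : Set (R 3)) (T V W : R 3 → R 3)
    (a₄ a₆ : R 3 → ℝ) : Prop where
  smooth_T : ContDiffOn ℝ ∞ T U
  smooth_V : ContDiffOn ℝ ∞ V U
  smooth_W : ContDiffOn ℝ ∞ W U
  orthonormal : ∀ x ∈ U, IsLorentzONB (affineMetric f ξ x) (T x) (V x) (W x)
  a₄_pos : ∀ x ∈ U, 0 < a₄ x
  a₆_nonneg : ∀ x ∈ U, 0 ≤ a₆ x
  K_TT : ∀ x ∈ U, differenceTensor f ξ x (T x) (T x) = -(2 * a₄ x) • T x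
  K_TV : ∀ x ∈ U, differenceTensor f ξ x (T x) (V x) = a₄ x • V x
  K_TW : ∀ x ∈ U, differenceTensor f ξ x (T x) (W x) = a₄ x • W x
  K_VV : ∀ x ∈ U, differenceTensor f ξ x (V x) (V x) = -(a₄ x) • T x + a₆ x • V x
  K_VW : ∀ x ∈ U, differenceTensor f ξ x (V x) (W x) = -(a₆ x) • W x
  K_WW : ∀ x ∈ U, differenceTensor f ξ x (W x) (W x) = -(a₄ x) • T x - a₆ x • V x

/-- The connection coefficient `Γ₂₂ = h(∇̂_V T, V)` of the Levi-Civita connection of the affine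
metric. -/
def gamma22 (f ξ : R 3 → R 4) (T V : R 3 → R 3) (x : R 3) : ℝ :=
  affineMetric f ξ x (leviCivita (affineMetric f ξ) V T x) (V x)

/-! ### Hypersurfaces on a manifold

`F : M → ℝ⁴` is studied through its local representations `F ∘ e.symm` in the smooth charts `e`. -/

section Manifold

variable {M : Type*} [TopologicalSpace M] [ChartedSpace (R 3) M]

/-- `F : M → ℝ⁴` is a (smooth, immersed) indefinite affine hypersphere with affine normal `ξ` and mean
curvature `H`. The sign of `ξ` is chosen such that the affine metric has signature `(-, +, +)`. -/
structure IsIndefiniteAffineHypersphere (F ξ : M → R 4) (H : ℝ) : Prop where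
  hypersphere : ∀ e ∈ IsManifold.maximalAtlas (𝓡 3) ∞ M,
    IsAffineHypersphereOn (F ∘ e.symm) (ξ ∘ e.symm) H e.target
  lorentzian : ∀ e ∈ IsManifold.maximalAtlas (𝓡 3) ∞ M, ∀ y ∈ e.target,
    ∃ t v w : R 3, IsLorentzONB (affineMetric (F ∘ e.symm) (ξ ∘ e.symm) y) t v w

/-- At every point of `M`, the symmetry group is isomorphic to `ℤ₃` or to `SO(2)`. -/
def HasPointwiseZ3OrSO2Symmetry (F ξ : M → R 4) : Prop :=
  ∀ e ∈ IsManifold.maximalAtlas (𝓡 3) ∞ M, ∀ y ∈ e.target,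
    HasSymmetryAt Z3 (F ∘ e.symm) (ξ ∘ e.symm) y ∨ HasSymmetryAt SO2 (F ∘ e.symm) (ξ ∘ e.symm) y

/-- At every point of `M`, the symmetry group is isomorphic to `SO(2)`. -/
def HasPointwiseSO2Symmetry (F ξ : M → R 4) : Prop :=
  ∀ e ∈ IsManifold.maximalAtlas (𝓡 3) ∞ M, ∀ y ∈ e.target,
    HasSymmetryAt SO2 (F ∘ e.symm) (ξ ∘ e.symm) y

/-- At some point of `M`, `Γ₂₂² - a₄² ≠ H`, where `Γ₂₂` and `a₄` are computed in a local adapted frame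
(they do not depend on its choice). -/
def NuNeZeroSomewhere (F ξ : M → R 4) (H : ℝ) : Prop :=
  ∃ e ∈ IsManifold.maximalAtlas (𝓡 3) ∞ M, ∃ (T V W : R 3 → R 3) (a₄ a₆ : R 3 → ℝ),
    IsAdaptedFrameOn (F ∘ e.symm) (ξ ∘ e.symm) e.target T V W a₄ a₆ ∧
    ∃ y ∈ e.target, gamma22 (F ∘ e.symm) (ξ ∘ e.symm) T V y ^ 2 - a₄ y ^ 2 ≠ H

/-- `ψ` is a diffeomorphism from `J × N`, `J` an open interval and `N` a connected open subset of the
plane, onto an open subset of `M`. -/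
structure IsProductParametrization (ψ : OpenPartialHomeomorph (ℝ × R 2) M) (J : Set ℝ)
    (N : Set (R 2)) : Prop where
  isOpen_J : IsOpen J
  interval_J : J.OrdConnected
  isOpen_N : IsOpen N
  connected_N : IsConnected N
  source_eq : ψ.source = J ×ˢ N
  smooth : ContMDiffOn 𝓘(ℝ, ℝ × R 2) (𝓡 3) ∞ ψ ψ.source
  smooth_symm : ContMDiffOn (𝓡 3) 𝓘(ℝ, ℝ × R 2) ∞ ψ.symm ψ.target

end Manifold

/-! ### Quadrics in `ℝ³` -/

/-- `Q` is an ellipsoid: an affine image of the unit sphere. -/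
def IsEllipsoid (Q : Set (R 3)) : Prop :=
  ∃ B : R 3 ≃ᵃ[ℝ] R 3, Q = B '' {x | x 0 ^ 2 + x 1 ^ 2 + x 2 ^ 2 = 1}

/-- `Q` is a two-sheeted hyperboloid: an affine image of `x₀² + x₁² - x₂² = -1`. -/
def IsTwoSheetedHyperboloid (Q : Set (R 3)) : Prop :=
  ∃ B : R 3 ≃ᵃ[ℝ] R 3, Q = B '' {x | x 0 ^ 2 + x 1 ^ 2 - x 2 ^ 2 = -1}

end AffineSphere

end

open AffineSphere

noncomputable section

set_option maxSynthPendingDepth 3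

namespace AffineSphere

open ContinuousLinearMap Topology

section

/-! The pointwise symmetry produces a canonical timelike direction. A symmetry `L` of order three
that commutes with all symmetries fixes a unit timelike vector `T`, and invariance together with
apolarity (tr K = 0) forces K_T to be −2a on T and a on T^⊥. If a were 0, the cubic form would live
on the plane T^⊥ and would also be preserved by T ↦ −T combined with a reflection of that plane.
This map has determinant one but does not commute with `L`, so a ≠ 0, and the sign of T is fixed by
a > 0 (`exists_isAxis`). The axis T is given by a smooth formula in h and K (`axisVector`), hence is
a smooth field on all of M. Only T has to be canonical; in T^⊥ any local orthonormal frame V, W will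
do, and the remaining cubic coefficients c₁, c₂ stay general.

The Gauss and Codazzi equations in such a frame show that T is geodesic. Codazzi gives (c₁² + c₂² −
4a²)p = 0 and the same for q, where p, q are the components of the acceleration of T. If the
acceleration is nonzero at a point, then c₁² + c₂² = 4a² nearby; rotating the frame makes c₁ = 2a,
c₂ = 0, and Gauss then gives a = 0, a contradiction (`IsAxialOn.acceleration_eq_zero`). With τ =
h(T, ·) it follows that T^⊥ is umbilic, ∇̂_u T = Γ(u + τ(u)T), and that a and Γ satisfy da = 4Γa τ
and dΓ = (Γ² + 3a² − H) τ.

Everything else is integration of these equations in ℝ⁴, with T read as a vector of ℝ⁴ through F_*.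
Put ν = Γ² − a² − H. Then dν = 2Γν τ, so ν²/a is constant and ν vanishes nowhere once it is nonzero
at one point. The vector HT + (Γ + a)ξ has a derivative proportional to itself, hence a constant
direction d (`hasFDerivAt_polarVec`). The vector Z = (Γ − a)T + ξ has derivative ν df along the
leaves of ker τ, so each leaf is homothetic to the surface traced by Z, with centre F − Z/ν. A
constant covector l annihilates Z and the tangent planes of the leaves (`hasFDerivAt_leafForm`), so
leaves lie in parallel hyperplanes, and their centres lie on one line of direction d
(`hasFDerivAt_center`). After division by νy, where y = (ρ|ν|)^(−1/3) and ρ is the length of HT + (Γ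
+ a)ξ, the vector Z does not change along T and satisfies the Blaschke volume condition. It
describes the affine sphere φ, with ε = −sign ν, while t = l∘F and y are the components of the plane
curve.

Globally, y has to be a function of t although level sets of l∘F may be disconnected. The triple (Γ,
ν, ν/ρ) solves an autonomous differential equation in t, so uniqueness of solutions and
connectedness of M give this (`eq_of_locally_integralCurve`). For SO(2)-symmetry K(u, v) is a
multiple of T for u, v in T^⊥. The leaves then have parallel affine metric, hence carry a constant
quadratic form and lie in quadrics (`exists_quadric`). -/

lemma two_le_infty : (2 : WithTop ℕ∞) ≤ ∞ := by
  exact WithTop.coe_le_coe.2 le_top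

/-! ### Structure equations of a hypersurface with transversal field -/

variable {n : ℕ} {f ξ : R n → R (n + 1)} {U : Set (R n)}

/-! ### Smooth families of bilinear forms and their covariant derivatives. -/

section Bilinear

variable {X E F G : Type*} [NormedAddCommGroup X] [NormedSpace ℝ X]
  [NormedAddCommGroup E] [NormedSpace ℝ E] [NormedAddCommGroup F] [NormedSpace ℝ F]
  [NormedAddCommGroup G] [NormedSpace ℝ G]

lemma contDiffAt_compL_comp {L : X → F →L[ℝ] G} {D : X → E →L[ℝ] E →L[ℝ] F} {x : X}
    (hL : ContDiffAt ℝ ∞ L x) (hD : ContDiffAt ℝ ∞ D x) :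
    ContDiffAt ℝ ∞ (fun y => (compL ℝ E F G (L y)).comp (D y)) x :=
  ((ContinuousLinearMap.contDiff (compL ℝ E F G)).contDiffAt.comp x hL).clm_comp hD

/-- The covariant derivative of a bilinear form `g` with derivative `dg` with respect to the
connection with coefficients `Γ`. -/
def covariantDerivForm (g : E →L[ℝ] E →L[ℝ] ℝ) (dg : E →L[ℝ] E →L[ℝ] E →L[ℝ] ℝ)
    (Γ : E →L[ℝ] E →L[ℝ] E) : E →L[ℝ] E →L[ℝ] E →L[ℝ] ℝ :=
  dg - (compL ℝ E E (E →L[ℝ] ℝ) g).comp Γ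
    - ((compL ℝ E (E →L[ℝ] ℝ) (E →L[ℝ] ℝ)).flip g).comp ((compL ℝ E E ℝ).flip.comp Γ)

lemma covariantDerivForm_apply (g : E →L[ℝ] E →L[ℝ] ℝ) (dg : E →L[ℝ] E →L[ℝ] E →L[ℝ] ℝ)
    (Γ : E →L[ℝ] E →L[ℝ] E) (u v w : E) :
    covariantDerivForm g dg Γ u v w = dg u v w - g (Γ u v) w - g v (Γ u w) := by
  simp [covariantDerivForm]

/-- The bilinear map obtained by raising the last index of `-(1/2) ∇g`. -/
def raisedDeriv (g : E →L[ℝ] E →L[ℝ] ℝ) (dg : E →L[ℝ] E →L[ℝ] E →L[ℝ] ℝ)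
    (Γ : E →L[ℝ] E →L[ℝ] E) : E →L[ℝ] E →L[ℝ] E :=
  (compL ℝ E (E →L[ℝ] ℝ) E g.inverse).comp (-(1 / 2 : ℝ) • covariantDerivForm g dg Γ)

lemma raisedDeriv_apply (g : E →L[ℝ] E →L[ℝ] ℝ) (dg : E →L[ℝ] E →L[ℝ] E →L[ℝ] ℝ)
    (Γ : E →L[ℝ] E →L[ℝ] E) (u v : E) :
    raisedDeriv g dg Γ u v = g.inverse (-(1 / 2 : ℝ) • covariantDerivForm g dg Γ u v) := by
  simp [raisedDeriv]

lemma contDiffAt_raisedDeriv [CompleteSpace E] {g : X → E →L[ℝ] E →L[ℝ] ℝ}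
    {dg : X → E →L[ℝ] E →L[ℝ] E →L[ℝ] ℝ} {Γ : X → E →L[ℝ] E →L[ℝ] E} {x : X}
    (hg : ContDiffAt ℝ ∞ g x) (hdg : ContDiffAt ℝ ∞ dg x) (hΓ : ContDiffAt ℝ ∞ Γ x)
    (hi : (g x).IsInvertible) :
    ContDiffAt ℝ ∞ (fun y => raisedDeriv (g y) (dg y) (Γ y)) x := by
  have hN : ContDiffAt ℝ ∞ (fun y => covariantDerivForm (g y) (dg y) (Γ y)) x := by
    unfold covariantDerivForm
    refine (hdg.sub ?_).sub ?_
    · exact ((ContinuousLinearMap.contDiff _).contDiffAt.comp x hg).clm_comp hΓ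
    · exact ((ContinuousLinearMap.contDiff _).contDiffAt.comp x hg).clm_comp
        (contDiffAt_const.clm_comp hΓ)
  unfold raisedDeriv
  refine ((ContinuousLinearMap.contDiff _).contDiffAt.comp x ?_).clm_comp
    (hN.const_smul _)
  exact (hi.contDiffAt_map_inverse).comp x hg

end Bilinear

/-- A smooth immersion with a smooth transversal field on an open set. -/
structure IsTransversalOn (f ξ : R n → R (n + 1)) (U : Set (R n)) : Prop where
  isOpen : IsOpen U
  smooth : ContDiffOn ℝ ∞ f U
  smooth_normal : ContDiffOn ℝ ∞ ξ U
  transversal : ∀ x ∈ U, Function.Bijective (frameMap f ξ x)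

lemma frameMap_apply (f ξ : R n → R (n + 1)) (x : R n) (u : R n) (c : ℝ) :
    frameMap f ξ x (u, c) = fderiv ℝ f x u + c • ξ x := by
  simp [frameMap]

lemma isInvertible_of_bijective {E F : Type*} [NormedAddCommGroup E] [NormedSpace ℝ E]
    [CompleteSpace E] [NormedAddCommGroup F] [NormedSpace ℝ F] [CompleteSpace F] {L : E →L[ℝ] F}
    (h : Function.Bijective L) : L.IsInvertible :=
  ⟨ContinuousLinearEquiv.ofBijective L (LinearMap.ker_eq_bot.2 h.1) (LinearMap.range_eq_top.2 h.2),
    ContinuousLinearEquiv.coe_ofBijective _ _ _⟩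

/-- The coefficients `Γ(u, v)` of the induced connection in the given coordinates. -/
def christoffel (f ξ : R n → R (n + 1)) (x : R n) : R n →L[ℝ] R n →L[ℝ] R n :=
  (compL ℝ (R n) (R (n + 1)) (R n) ((fst ℝ (R n) ℝ).comp (split f ξ x))).comp
    (fderiv ℝ (fderiv ℝ f) x)

namespace IsTransversalOn

lemma mono (h : IsTransversalOn f ξ U) {O : Set (R n)} (hO : IsOpen O) (hOU : O ⊆ U) :
    IsTransversalOn f ξ O :=
  ⟨hO, h.smooth.mono hOU, h.smooth_normal.mono hOU, fun x hx => h.transversal x (hOU hx)⟩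

lemma contDiffAt (h : IsTransversalOn f ξ U) {x : R n} (hx : x ∈ U) : ContDiffAt ℝ ∞ f x :=
  h.smooth.contDiffAt (h.isOpen.mem_nhds hx)

lemma contDiffAt_normal (h : IsTransversalOn f ξ U) {x : R n} (hx : x ∈ U) :
    ContDiffAt ℝ ∞ ξ x :=
  h.smooth_normal.contDiffAt (h.isOpen.mem_nhds hx)

lemma contDiffAt_fderiv (h : IsTransversalOn f ξ U) {x : R n} (hx : x ∈ U) :
    ContDiffAt ℝ ∞ (fderiv ℝ f) x :=
  (h.contDiffAt hx).fderiv_right (m := ∞) (by simp)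

lemma contDiffAt_fderiv_fderiv (h : IsTransversalOn f ξ U) {x : R n} (hx : x ∈ U) :
    ContDiffAt ℝ ∞ (fderiv ℝ (fderiv ℝ f)) x :=
  (h.contDiffAt_fderiv hx).fderiv_right (m := ∞) (by simp)

lemma contDiffAt_frameMap (h : IsTransversalOn f ξ U) {x : R n} (hx : x ∈ U) :
    ContDiffAt ℝ ∞ (frameMap f ξ) x := by
  have e : frameMap f ξ = fun x => (fderiv ℝ f x).comp (fst ℝ (R n) ℝ)
      + (smulRightL ℝ (R n × ℝ) (R (n + 1)) (snd ℝ (R n) ℝ)) (ξ x) := by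
    ext x p
    · simp [frameMap]
    · simp [frameMap]
  rw [e]
  exact ((h.contDiffAt_fderiv hx).clm_comp contDiffAt_const).add
    ((ContinuousLinearMap.contDiff _).contDiffAt.comp x (h.contDiffAt_normal hx))

lemma isInvertible_frameMap (h : IsTransversalOn f ξ U) {x : R n} (hx : x ∈ U) :
    (frameMap f ξ x).IsInvertible :=
  isInvertible_of_bijective (h.transversal x hx)

lemma contDiffAt_split (h : IsTransversalOn f ξ U) {x : R n} (hx : x ∈ U) :
    ContDiffAt ℝ ∞ (split f ξ) x :=
  ((h.isInvertible_frameMap hx).contDiffAt_map_inverse).comp x (h.contDiffAt_frameMap hx)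

lemma split_frameMap (h : IsTransversalOn f ξ U) {x : R n} (hx : x ∈ U) (u : R n) (c : ℝ) :
    split f ξ x (fderiv ℝ f x u + c • ξ x) = (u, c) := by
  rw [← frameMap_apply]
  obtain ⟨e, he⟩ := h.isInvertible_frameMap hx
  rw [split, ← he]
  simp

lemma frameMap_split (h : IsTransversalOn f ξ U) {x : R n} (hx : x ∈ U) (w : R (n + 1)) :
    fderiv ℝ f x (split f ξ x w).1 + (split f ξ x w).2 • ξ x = w := by
  rw [← frameMap_apply]
  obtain ⟨e, he⟩ := h.isInvertible_frameMap hx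
  rw [split, ← he]
  simp

lemma eq_of_frame_eq (h : IsTransversalOn f ξ U) {x : R n} (hx : x ∈ U) {u v : R n} {c d : ℝ}
    (e : fderiv ℝ f x u + c • ξ x = fderiv ℝ f x v + d • ξ x) : u = v ∧ c = d := by
  have := congrArg (split f ξ x) e
  rw [h.split_frameMap hx, h.split_frameMap hx] at this
  exact Prod.mk.inj this

/-- The Gauss formula. -/
lemma gauss (h : IsTransversalOn f ξ U) {x : R n} (hx : x ∈ U) (u v : R n) :
    fderiv ℝ (fderiv ℝ f) x u v
      = fderiv ℝ f x (christoffel f ξ x u v) + affineMetric f ξ x u v • ξ x := by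
  conv_lhs => rw [← h.frameMap_split hx (fderiv ℝ (fderiv ℝ f) x u v)]
  simp [christoffel, affineMetric]

lemma fderiv_fderiv_symm (h : IsTransversalOn f ξ U) {x : R n} (hx : x ∈ U) (u v : R n) :
    fderiv ℝ (fderiv ℝ f) x u v = fderiv ℝ (fderiv ℝ f) x v u :=
  ((h.contDiffAt hx).isSymmSndFDerivAt (by simp [two_le_infty])) u v

lemma christoffel_symm (h : IsTransversalOn f ξ U) {x : R n} (hx : x ∈ U) (u v : R n) :
    christoffel f ξ x u v = christoffel f ξ x v u := by
  simp [christoffel, h.fderiv_fderiv_symm hx u v]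

lemma metric_symm (h : IsTransversalOn f ξ U) {x : R n} (hx : x ∈ U) (u v : R n) :
    affineMetric f ξ x u v = affineMetric f ξ x v u := by
  simp [affineMetric, h.fderiv_fderiv_symm hx u v]

lemma contDiffAt_christoffel (h : IsTransversalOn f ξ U) {x : R n} (hx : x ∈ U) :
    ContDiffAt ℝ ∞ (christoffel f ξ) x := by
  exact contDiffAt_compL_comp (contDiffAt_const.clm_comp (h.contDiffAt_split hx))
    (h.contDiffAt_fderiv_fderiv hx)

lemma contDiffAt_metric (h : IsTransversalOn f ξ U) {x : R n} (hx : x ∈ U) :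
    ContDiffAt ℝ ∞ (affineMetric f ξ) x := by
  exact contDiffAt_compL_comp (contDiffAt_const.clm_comp (h.contDiffAt_split hx))
    (h.contDiffAt_fderiv_fderiv hx)

lemma inducedConnection_const (h : IsTransversalOn f ξ U) {x : R n} (hx : x ∈ U) (u v : R n) :
    inducedConnection f ξ (fun _ => u) (fun _ => v) x = christoffel f ξ x u v := by
  have hd : DifferentiableAt ℝ (fderiv ℝ f) x :=
    (h.contDiffAt_fderiv hx).differentiableAt (by simp)
  have : fderiv ℝ (fun y => fderiv ℝ f y v) x u = fderiv ℝ (fderiv ℝ f) x u v := by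
    rw [fderiv_clm_apply hd (by fun_prop)]
    simp
  simp [inducedConnection, christoffel, this]

end IsTransversalOn

/-- The covariant derivative `(∇_u h)(v, w)` of the affine metric. -/
def nablaMetric (f ξ : R n → R (n + 1)) (x : R n) : R n →L[ℝ] R n →L[ℝ] R n →L[ℝ] ℝ :=
  covariantDerivForm (affineMetric f ξ x) (fderiv ℝ (affineMetric f ξ) x) (christoffel f ξ x)

lemma nablaMetric_apply (f ξ : R n → R (n + 1)) (x u v w : R n) :
    nablaMetric f ξ x u v w = fderiv ℝ (affineMetric f ξ) x u v w
      - affineMetric f ξ x (christoffel f ξ x u v) w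
      - affineMetric f ξ x v (christoffel f ξ x u w) :=
  covariantDerivForm_apply _ _ _ _ _ _

/-- The difference tensor as a smooth field of bilinear maps. -/
def differenceMap (f ξ : R n → R (n + 1)) (x : R n) : R n →L[ℝ] R n →L[ℝ] R n :=
  raisedDeriv (affineMetric f ξ x) (fderiv ℝ (affineMetric f ξ) x) (christoffel f ξ x)

/-- A transversal immersion with tangential `Dξ`, shape operator `H Id` and nondegenerate affine
metric. -/
structure IsSphereOn (f ξ : R n → R (n + 1)) (H : ℝ) (U : Set (R n)) : Prop
    extends IsTransversalOn f ξ U where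
  weingarten : ∀ x ∈ U, ∀ u, fderiv ℝ ξ x u = -(H • fderiv ℝ f x u)
  nondegenerate : ∀ x ∈ U, Function.Bijective (affineMetric f ξ x)

lemma IsAffineHypersphereOn.isSphereOn {H : ℝ} (h : IsAffineHypersphereOn f ξ H U) (hU : IsOpen U)
    (hG : ∀ x ∈ U, Function.Bijective (affineMetric f ξ x)) : IsSphereOn f ξ H U := by
  have ht : IsTransversalOn f ξ U :=
    ⟨hU, h.blaschke.smooth, h.blaschke.smooth_normal, h.blaschke.transversal⟩
  refine ⟨ht, fun x hx u => ?_, hG⟩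
  have h1 := h.shape x hx u
  have h2 := h.blaschke.tangential x hx u
  have h3 := ht.frameMap_split hx (fderiv ℝ ξ x u)
  rw [shapeOperator, neg_eq_iff_eq_neg] at h1
  rw [h1, h2] at h3
  simpa using h3.symm

namespace IsSphereOn

variable {H : ℝ}

lemma mono (h : IsSphereOn f ξ H U) {O : Set (R n)} (hO : IsOpen O) (hOU : O ⊆ U) :
    IsSphereOn f ξ H O :=
  ⟨h.toIsTransversalOn.mono hO hOU, fun x hx => h.weingarten x (hOU hx),
    fun x hx => h.nondegenerate x (hOU hx)⟩

/-- The Gauss and Codazzi equations, in coordinates. -/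
lemma gauss_codazzi (h : IsSphereOn f ξ H U) {x : R n} (hx : x ∈ U) (w u v : R n) :
    fderiv ℝ (christoffel f ξ) x w u v + christoffel f ξ x w (christoffel f ξ x u v)
        - (H * affineMetric f ξ x u v) • w
      = fderiv ℝ (christoffel f ξ) x u w v + christoffel f ξ x u (christoffel f ξ x w v)
        - (H * affineMetric f ξ x w v) • u ∧
    affineMetric f ξ x w (christoffel f ξ x u v) + fderiv ℝ (affineMetric f ξ) x w u v
      = affineMetric f ξ x u (christoffel f ξ x w v) + fderiv ℝ (affineMetric f ξ) x u w v := by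
  have hU : U ∈ 𝓝 x := h.isOpen.mem_nhds hx
  have hΓ : DifferentiableAt ℝ (christoffel f ξ) x :=
    (h.contDiffAt_christoffel hx).differentiableAt (by simp)
  have hG : DifferentiableAt ℝ (affineMetric f ξ) x :=
    (h.contDiffAt_metric hx).differentiableAt (by simp)
  have hf : DifferentiableAt ℝ (fderiv ℝ f) x :=
    (h.contDiffAt_fderiv hx).differentiableAt (by simp)
  have hξ : DifferentiableAt ℝ ξ x := (h.contDiffAt_normal hx).differentiableAt (by simp)
  have h2 : DifferentiableAt ℝ (fderiv ℝ (fderiv ℝ f)) x :=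
    (h.contDiffAt_fderiv_fderiv hx).differentiableAt (by simp)
  -- Differentiate the Gauss formula once more and expand again in the moving frame. Symmetry of D³f
  -- in its first two arguments then yields both equations, as the tangential and the transversal
  -- part.
  have third : ∀ w u v : R n, fderiv ℝ (fderiv ℝ (fderiv ℝ f)) x w u v
      = fderiv ℝ f x (fderiv ℝ (christoffel f ξ) x w u v
          + christoffel f ξ x w (christoffel f ξ x u v) - (H * affineMetric f ξ x u v) • w)
        + (affineMetric f ξ x w (christoffel f ξ x u v)
          + fderiv ℝ (affineMetric f ξ) x w u v) • ξ x := by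
    intro w u v
    have e1 : fderiv ℝ (fun y => fderiv ℝ (fderiv ℝ f) y u v) x w
        = fderiv ℝ (fderiv ℝ (fderiv ℝ f)) x w u v := by
      rw [fderiv_clm_apply (h2.clm_apply (by fun_prop)) (by fun_prop),
        fderiv_clm_apply h2 (by fun_prop)]
      simp
    have e2 : (fun y => fderiv ℝ (fderiv ℝ f) y u v) =ᶠ[𝓝 x]
        fun y => fderiv ℝ f y (christoffel f ξ y u v) + affineMetric f ξ y u v • ξ y := by
      filter_upwards [hU] with y hy using h.gauss hy u v
    have d1 : DifferentiableAt ℝ (fun y => christoffel f ξ y u v) x :=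
      (hΓ.clm_apply (by fun_prop)).clm_apply (by fun_prop)
    have d2 : DifferentiableAt ℝ (fun y => affineMetric f ξ y u v) x :=
      (hG.clm_apply (by fun_prop)).clm_apply (by fun_prop)
    have e3 : fderiv ℝ (fun y => christoffel f ξ y u v) x w
        = fderiv ℝ (christoffel f ξ) x w u v := by
      rw [fderiv_clm_apply (hΓ.clm_apply (by fun_prop)) (by fun_prop),
        fderiv_clm_apply hΓ (by fun_prop)]
      simp
    have e4 : fderiv ℝ (fun y => affineMetric f ξ y u v) x w
        = fderiv ℝ (affineMetric f ξ) x w u v := by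
      rw [fderiv_clm_apply (hG.clm_apply (by fun_prop)) (by fun_prop),
        fderiv_clm_apply hG (by fun_prop)]
      simp
    rw [← e1, e2.fderiv_eq, fderiv_fun_add (hf.clm_apply d1) (d2.fun_smul hξ), fderiv_clm_apply hf d1,
      fderiv_fun_smul d2 hξ]
    simp only [add_apply, coe_comp, Function.comp_apply, flip_apply, e3, smul_apply, smulRight_apply,
      e4, h.weingarten x hx, h.gauss hx, map_sub, map_add, map_smul]
    module
  have symm : fderiv ℝ (fderiv ℝ (fderiv ℝ f)) x w u v
      = fderiv ℝ (fderiv ℝ (fderiv ℝ f)) x u w v :=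
    congrArg (fun L => L v)
      (((h.contDiffAt_fderiv hx).isSymmSndFDerivAt (by simp [two_le_infty])) w u)
  rw [third, third] at symm
  exact h.eq_of_frame_eq hx symm

/-- This is the Codazzi equation for h; since ∇ is torsion-free, the two Christoffel terms in u, v
agree. Together with symmetry of h it makes ∇h totally symmetric. -/
lemma nablaMetric_symm_left (h : IsSphereOn f ξ H U) {x : R n} (hx : x ∈ U) (u v w : R n) :
    nablaMetric f ξ x u v w = nablaMetric f ξ x v u w := by
  have := (h.gauss_codazzi hx u v w).2
  rw [nablaMetric_apply, nablaMetric_apply, h.christoffel_symm hx u v]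
  linarith

lemma fderiv_metric_symm (h : IsSphereOn f ξ H U) {x : R n} (hx : x ∈ U) (u v w : R n) :
    fderiv ℝ (affineMetric f ξ) x u v w = fderiv ℝ (affineMetric f ξ) x u w v := by
  have hG : DifferentiableAt ℝ (affineMetric f ξ) x :=
    (h.contDiffAt_metric hx).differentiableAt (by simp)
  have e : ∀ v w : R n, fderiv ℝ (fun y => affineMetric f ξ y v w) x u
        = fderiv ℝ (affineMetric f ξ) x u v w := by
      intro v w
      rw [fderiv_clm_apply (hG.clm_apply (by fun_prop)) (by fun_prop),
        fderiv_clm_apply hG (by fun_prop)]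
      simp
  rw [← e, ← e]
  congr 1
  apply Filter.EventuallyEq.fderiv_eq
  filter_upwards [h.isOpen.mem_nhds hx] with y hy using h.metric_symm hy v w

lemma nablaMetric_symm_right (h : IsSphereOn f ξ H U) {x : R n} (hx : x ∈ U) (u v w : R n) :
    nablaMetric f ξ x u v w = nablaMetric f ξ x u w v := by
  rw [nablaMetric_apply, nablaMetric_apply, h.fderiv_metric_symm hx,
    h.metric_symm hx (christoffel f ξ x u v), h.metric_symm hx v]
  ring

lemma isInvertible_metric (h : IsSphereOn f ξ H U) {x : R n} (hx : x ∈ U) :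
    (affineMetric f ξ x).IsInvertible :=
  isInvertible_of_bijective (h.nondegenerate x hx)

lemma metric_inverse (h : IsSphereOn f ξ H U) {x : R n} (hx : x ∈ U) (l : R n →L[ℝ] ℝ) :
    affineMetric f ξ x ((affineMetric f ξ x).inverse l) = l := by
  obtain ⟨e, he⟩ := h.isInvertible_metric hx
  rw [← he]
  simp

lemma metric_injective (h : IsSphereOn f ξ H U) {x : R n} (hx : x ∈ U) {u v : R n}
    (e : ∀ w, affineMetric f ξ x u w = affineMetric f ξ x v w) : u = v :=
  (h.nondegenerate x hx).1 (ContinuousLinearMap.ext e)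

lemma metric_differenceMap (h : IsSphereOn f ξ H U) {x : R n} (hx : x ∈ U) (u v w : R n) :
    affineMetric f ξ x (differenceMap f ξ x u v) w = -(1 / 2 : ℝ) * nablaMetric f ξ x u v w := by
  have : differenceMap f ξ x u v
      = (affineMetric f ξ x).inverse (-(1 / 2 : ℝ) • nablaMetric f ξ x u v) :=
    raisedDeriv_apply _ _ _ _ _
  rw [this, h.metric_inverse hx]
  simp

/-- When ∇h is totally symmetric, the Koszul formula for ∇̂ collapses to h(K(u, v), w) = −½ (∇_u
h)(v, w). This identifies the tensor ∇ − ∇̂ with a visibly smooth field of bilinear maps. -/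
lemma differenceTensor_eq (h : IsSphereOn f ξ H U) {x : R n} (hx : x ∈ U) (u v : R n) :
    differenceTensor f ξ x u v = differenceMap f ξ x u v := by
  refine h.metric_injective hx fun w => ?_
  rw [h.metric_differenceMap hx, differenceTensor, h.inducedConnection_const hx, leviCivita,
    map_sub, sub_apply, map_add, h.metric_inverse hx]
  have e1 := nablaMetric_apply f ξ x u v w
  have e2 := nablaMetric_apply f ξ x v u w
  have e3 := nablaMetric_apply f ξ x w u v
  rw [h.nablaMetric_symm_left hx v u w] at e2
  rw [h.nablaMetric_symm_left hx w u v, h.nablaMetric_symm_right hx u w v] at e3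
  rw [h.christoffel_symm hx v u] at e2
  rw [h.christoffel_symm hx w u, h.christoffel_symm hx w v,
    h.metric_symm hx (christoffel f ξ x u w)] at e3
  simp [christoffelForm]
  linarith

lemma differenceMap_symm (h : IsSphereOn f ξ H U) {x : R n} (hx : x ∈ U) (u v : R n) :
    differenceMap f ξ x u v = differenceMap f ξ x v u := by
  refine h.metric_injective hx fun w => ?_
  rw [h.metric_differenceMap hx, h.metric_differenceMap hx, h.nablaMetric_symm_left hx]

lemma metric_differenceMap_symm (h : IsSphereOn f ξ H U) {x : R n} (hx : x ∈ U) (u v w : R n) :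
    affineMetric f ξ x (differenceMap f ξ x u v) w
      = affineMetric f ξ x (differenceMap f ξ x u w) v := by
  rw [h.metric_differenceMap hx, h.metric_differenceMap hx, h.nablaMetric_symm_right hx]

/-- The derivative of the affine metric in terms of the induced connection and the difference
tensor. -/
lemma fderiv_metric (h : IsSphereOn f ξ H U) {x : R n} (hx : x ∈ U) (u v w : R n) :
    fderiv ℝ (affineMetric f ξ) x u v w
      = affineMetric f ξ x (christoffel f ξ x u v) w + affineMetric f ξ x v (christoffel f ξ x u w)
        - 2 * affineMetric f ξ x (differenceMap f ξ x u v) w := by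
  rw [h.metric_differenceMap hx, nablaMetric_apply]
  ring

lemma contDiffAt_differenceMap (h : IsSphereOn f ξ H U) {x : R n} (hx : x ∈ U) :
    ContDiffAt ℝ ∞ (differenceMap f ξ) x := by
  exact contDiffAt_raisedDeriv (h.contDiffAt_metric hx)
    ((h.contDiffAt_metric hx).fderiv_right (m := ∞) (by simp)) (h.contDiffAt_christoffel hx)
    (h.isInvertible_metric hx)

end IsSphereOn

/-! ### Covariant derivatives of vector fields -/

/-- The induced covariant derivative `∇_X Y`. -/
def nabla (f ξ : R n → R (n + 1)) (X Y : R n → R n) (x : R n) : R n :=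
  fderiv ℝ Y x (X x) + christoffel f ξ x (X x) (Y x)

namespace IsSphereOn

variable {H : ℝ}

lemma contDiffAt_nabla (h : IsSphereOn f ξ H U) {x : R n} (hx : x ∈ U) {X Y : R n → R n}
    (hX : ContDiffAt ℝ ∞ X x) (hY : ContDiffAt ℝ ∞ Y x) : ContDiffAt ℝ ∞ (nabla f ξ X Y) x := by
  unfold nabla
  exact ((hY.fderiv_right (m := ∞) (by simp)).clm_apply hX).add
    (((h.contDiffAt_christoffel hx).clm_apply hX).clm_apply hY)

/-- The curvature of the induced connection is that of an affine sphere. -/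
lemma curvature (h : IsSphereOn f ξ H U) {x : R n} (hx : x ∈ U) {X Y Z : R n → R n}
    (hX : ContDiffAt ℝ ∞ X x) (hY : ContDiffAt ℝ ∞ Y x) (hZ : ContDiffAt ℝ ∞ Z x) :
    nabla f ξ X (nabla f ξ Y Z) x - nabla f ξ Y (nabla f ξ X Z) x
        - nabla f ξ (fun y => nabla f ξ X Y y - nabla f ξ Y X y) Z x
      = H • (affineMetric f ξ x (Y x) (Z x) • X x - affineMetric f ξ x (X x) (Z x) • Y x) := by
  have hΓ : DifferentiableAt ℝ (christoffel f ξ) x :=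
    (h.contDiffAt_christoffel hx).differentiableAt (by simp)
  have hZ' : DifferentiableAt ℝ (fderiv ℝ Z) x :=
    (hZ.fderiv_right (m := ∞) (by simp)).differentiableAt (by simp)
  have second : ∀ {X Y : R n → R n}, ContDiffAt ℝ ∞ X x → ContDiffAt ℝ ∞ Y x →
      nabla f ξ X (nabla f ξ Y Z) x
        = fderiv ℝ (fderiv ℝ Z) x (X x) (Y x) + fderiv ℝ Z x (fderiv ℝ Y x (X x))
          + fderiv ℝ (christoffel f ξ) x (X x) (Y x) (Z x)
          + christoffel f ξ x (fderiv ℝ Y x (X x)) (Z x)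
          + christoffel f ξ x (Y x) (fderiv ℝ Z x (X x))
          + christoffel f ξ x (X x) (fderiv ℝ Z x (Y x))
          + christoffel f ξ x (X x) (christoffel f ξ x (Y x) (Z x)) := by
    intro X Y hX hY
    have hY1 : DifferentiableAt ℝ Y x := hY.differentiableAt (by simp)
    have hZ1 : DifferentiableAt ℝ Z x := hZ.differentiableAt (by simp)
    have hΓY : DifferentiableAt ℝ (fun y => christoffel f ξ y (Y y)) x := hΓ.clm_apply hY1
    have e : fderiv ℝ (nabla f ξ Y Z) x (X x)
        = fderiv ℝ (fderiv ℝ Z) x (X x) (Y x) + fderiv ℝ Z x (fderiv ℝ Y x (X x))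
          + fderiv ℝ (christoffel f ξ) x (X x) (Y x) (Z x)
          + christoffel f ξ x (fderiv ℝ Y x (X x)) (Z x)
          + christoffel f ξ x (Y x) (fderiv ℝ Z x (X x)) := by
      unfold nabla
      rw [fderiv_fun_add (hZ'.clm_apply hY1) (hΓY.clm_apply hZ1), fderiv_clm_apply hZ' hY1,
        fderiv_clm_apply hΓY hZ1, fderiv_clm_apply hΓ hY1]
      simp
      abel
    conv_lhs => rw [nabla, e, nabla]
    rw [map_add]
    abel
  rw [second hX hY, second hY hX]
  have hs : fderiv ℝ (fderiv ℝ Z) x (X x) (Y x) = fderiv ℝ (fderiv ℝ Z) x (Y x) (X x) :=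
    (hZ.isSymmSndFDerivAt (by simp [two_le_infty])) _ _
  have hg := (h.gauss_codazzi hx (X x) (Y x) (Z x)).1
  have hg' : fderiv ℝ (christoffel f ξ) x (X x) (Y x) (Z x)
      = fderiv ℝ (christoffel f ξ) x (Y x) (X x) (Z x)
        + christoffel f ξ x (Y x) (christoffel f ξ x (X x) (Z x))
        - (H * affineMetric f ξ x (X x) (Z x)) • (Y x)
        - christoffel f ξ x (X x) (christoffel f ξ x (Y x) (Z x))
        + (H * affineMetric f ξ x (Y x) (Z x)) • (X x) := by
    rw [← hg]; abel
  rw [hs, hg']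
  simp only [nabla, h.christoffel_symm hx (Y x) (X x), map_sub, map_add,
    sub_apply, add_apply]
  module

/-- Compatibility of the affine metric with `∇ - K`. -/
lemma fderiv_metric_apply (h : IsSphereOn f ξ H U) {x : R n} (hx : x ∈ U) {X Y Z : R n → R n}
    (hY : ContDiffAt ℝ ∞ Y x) (hZ : ContDiffAt ℝ ∞ Z x) :
    fderiv ℝ (fun y => affineMetric f ξ y (Y y) (Z y)) x (X x)
      = affineMetric f ξ x (nabla f ξ X Y x) (Z x) + affineMetric f ξ x (Y x) (nabla f ξ X Z x)
        - 2 * affineMetric f ξ x (differenceMap f ξ x (X x) (Y x)) (Z x) := by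
  have hG : DifferentiableAt ℝ (affineMetric f ξ) x :=
    (h.contDiffAt_metric hx).differentiableAt (by simp)
  have hY1 : DifferentiableAt ℝ Y x := hY.differentiableAt (by simp)
  have hZ1 : DifferentiableAt ℝ Z x := hZ.differentiableAt (by simp)
  rw [fderiv_clm_apply (hG.clm_apply hY1) hZ1, fderiv_clm_apply hG hY1]
  simp [nabla, h.fderiv_metric hx]
  ring

end IsSphereOn

end

section

/-! ### Lorentzian linear algebra in dimension three -/

section Lorentz

variable {g : R 3 →L[ℝ] R 3 →L[ℝ] ℝ} {t v w : R 3}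

lemma IsLorentzONB.linearIndependent (h : IsLorentzONB g t v w) (hs : ∀ x y, g x y = g y x) :
    LinearIndependent ℝ ![t, v, w] := by
  have vt := hs v t
  have wt := hs w t
  have wv := hs w v
  have := h.tt; have := h.vv; have := h.ww; have := h.tv; have := h.tw; have := h.vw
  rw [Fintype.linearIndependent_iff]
  intro c hc
  simp only [Fin.sum_univ_three, Matrix.cons_val_zero, Matrix.cons_val_one, Matrix.cons_val_two,
    Matrix.tail_cons, Matrix.head_cons, Matrix.cons_val] at hc
  have h0 := congrArg (g t) hc
  have h1 := congrArg (g v) hc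
  have h2 := congrArg (g w) hc
  simp only [map_add, map_smul, smul_eq_mul, map_zero, h.tt, h.vv, h.ww, h.tv, h.tw, h.vw, vt, wt,
    wv] at h0 h1 h2
  intro i
  fin_cases i <;> simp <;> linarith

/-- The basis of a Lorentzian orthonormal frame. -/
def IsLorentzONB.basis (h : IsLorentzONB g t v w) (hs : ∀ x y, g x y = g y x) :
    Module.Basis (Fin 3) ℝ (R 3) :=
  basisOfLinearIndependentOfCardEqFinrank (h.linearIndependent hs) (by simp)

lemma IsLorentzONB.coe_basis (h : IsLorentzONB g t v w) (hs : ∀ x y, g x y = g y x) :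
    ⇑(h.basis hs) = ![t, v, w] := by
  simp [IsLorentzONB.basis]

lemma IsLorentzONB.decomp (h : IsLorentzONB g t v w) (hs : ∀ x y, g x y = g y x) (u : R 3) :
    u = (-(g t u)) • t + g v u • v + g w u • w := by
  have vt := hs v t
  have wt := hs w t
  have wv := hs w v
  have := h.tt; have := h.vv; have := h.ww; have := h.tv; have := h.tw; have := h.vw
  have e := (h.basis hs).sum_repr u
  rw [h.coe_basis hs] at e
  simp only [Fin.sum_univ_three, Matrix.cons_val_zero, Matrix.cons_val_one, Matrix.cons_val_two,
    Matrix.tail_cons, Matrix.head_cons, Matrix.cons_val] at e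
  generalize (h.basis hs).repr u 0 = a at e
  generalize (h.basis hs).repr u 1 = b at e
  generalize (h.basis hs).repr u 2 = c at e
  subst e
  simp [*]

lemma IsLorentzONB.exists_coord (h : IsLorentzONB g t v w) (hs : ∀ x y, g x y = g y x) (u : R 3) :
    ∃ a b c : ℝ, u = a • t + b • v + c • w :=
  ⟨_, _, _, h.decomp hs u⟩

lemma IsLorentzONB.apply (h : IsLorentzONB g t v w) (hs : ∀ x y, g x y = g y x)
    (a b c a' b' c' : ℝ) :
    g (a • t + b • v + c • w) (a' • t + b' • v + c' • w) = -(a * a') + b * b' + c * c' := by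
  have vt := hs v t
  have wt := hs w t
  have wv := hs w v
  have := h.tt; have := h.vv; have := h.ww; have := h.tv; have := h.tw; have := h.vw
  simp only [map_add, map_smul, smul_eq_mul, add_apply, smul_apply, *]
  ring

lemma IsLorentzONB.coord_eq (h : IsLorentzONB g t v w) (hs : ∀ x y, g x y = g y x)
    {a b c a' b' c' : ℝ} (e : a • t + b • v + c • w = a' • t + b' • v + c' • w) :
    a = a' ∧ b = b' ∧ c = c' := by
  have h0 := congrArg (g (1 • t + (0 : ℝ) • v + (0 : ℝ) • w)) e
  have h1 := congrArg (g ((0 : ℝ) • t + (1 : ℝ) • v + (0 : ℝ) • w)) e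
  have h2 := congrArg (g ((0 : ℝ) • t + (0 : ℝ) • v + (1 : ℝ) • w)) e
  rw [← one_smul ℝ t] at h0
  simp only [one_smul] at h0
  have k0 := h.apply hs 1 0 0
  simp only [one_smul] at k0
  rw [k0, k0] at h0
  rw [h.apply hs, h.apply hs] at h1 h2
  exact ⟨by linarith, by linarith, by linarith⟩

/-- A unit timelike vector can be completed to an orthonormal basis. -/
lemma IsLorentzONB.exists_complete (h : IsLorentzONB g t v w) (hs : ∀ x y, g x y = g y x)
    {T : R 3} (hT : g T T = -1) : ∃ V W, IsLorentzONB g T V W := by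
  have key : ∀ T : R 3, g T T = -1 → 0 < -(g t T) → ∃ V W, IsLorentzONB g T V W := by
    intro T hT hpos
    obtain ⟨a, b, c, rfl⟩ := h.exists_coord hs T
    rw [h.apply hs] at hT
    have k0 := h.apply hs 1 0 0 a b c
    simp only [one_smul, zero_smul, add_zero] at k0
    rw [k0] at hpos
    have ha : 0 < a := by linarith
    have ha' : 1 + a ≠ 0 := by positivity
    -- The images of v and w under the Lorentz boost that takes t to T = (a, b, c); it needs a > 0.
    refine ⟨b • t + (1 + b ^ 2 / (1 + a)) • v + (b * c / (1 + a)) • w,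
      c • t + (b * c / (1 + a)) • v + (1 + c ^ 2 / (1 + a)) • w, ?_⟩
    have hc : c ^ 2 = a ^ 2 - 1 - b ^ 2 := by linarith
    constructor
    · rw [h.apply hs]; linarith
    · rw [h.apply hs]; field_simp
      linear_combination b ^ 2 * hc
    · rw [h.apply hs]; field_simp
      linear_combination (c ^ 2) * hc
    · rw [h.apply hs]; field_simp
      linear_combination b * hc
    · rw [h.apply hs]; field_simp
      linear_combination c * hc
    · rw [h.apply hs]; field_simp
      linear_combination b * c * hc
  rcases lt_or_ge 0 (-(g t T)) with hp | hp
  · exact key T hT hp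
  · have hne : g t T ≠ 0 := by
      intro h0
      obtain ⟨a, b, c, rfl⟩ := h.exists_coord hs T
      rw [h.apply hs] at hT
      have k0 := h.apply hs 1 0 0 a b c
      simp only [one_smul, zero_smul, add_zero] at k0
      rw [k0] at h0
      have : a = 0 := by linarith
      subst this
      nlinarith [sq_nonneg b, sq_nonneg c]
    have hlt : 0 < -(g t (-T)) := by
      rw [map_neg, neg_neg]
      exact lt_of_le_of_ne (by linarith) (Ne.symm hne)
    obtain ⟨V, W, hV⟩ := key (-T) (by simpa using hT) hlt
    refine ⟨V, W, hT, hV.vv, hV.ww, ?_, ?_, hV.vw⟩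
    · simpa using hV.tv
    · simpa using hV.tw

lemma IsLorentzONB.trace_eq (h : IsLorentzONB g t v w) (hs : ∀ x y, g x y = g y x)
    (A : R 3 →ₗ[ℝ] R 3) :
    LinearMap.trace ℝ (R 3) A = -(g t (A t)) + g v (A v) + g w (A w) := by
  have key : ∀ (u : R 3), (h.basis hs).repr u 0 = -(g t u) ∧ (h.basis hs).repr u 1 = g v u ∧
      (h.basis hs).repr u 2 = g w u := by
    intro u
    have e := (h.basis hs).sum_repr u
    rw [h.coe_basis hs] at e
    simp only [Fin.sum_univ_three, Matrix.cons_val_zero, Matrix.cons_val_one, Matrix.cons_val_two,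
      Matrix.tail_cons, Matrix.head_cons, Matrix.cons_val] at e
    exact h.coord_eq hs (e.trans (h.decomp hs u))
  rw [LinearMap.trace_eq_matrix_trace ℝ (h.basis hs), Matrix.trace]
  simp [Fin.sum_univ_three, LinearMap.toMatrix_apply, h.coe_basis hs, key]

lemma IsLorentzONB.ext (h : IsLorentzONB g t v w) (hs : ∀ x y, g x y = g y x) {x y : R 3}
    (h0 : g t x = g t y) (h1 : g v x = g v y) (h2 : g w x = g w y) : x = y := by
  rw [h.decomp hs x, h.decomp hs y, h0, h1, h2]

lemma IsLorentzONB.nondegenerate (h : IsLorentzONB g t v w) (hs : ∀ x y, g x y = g y x) :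
    Function.Bijective g := by
  have hinj : Function.Injective g := fun x y e =>
    h.ext hs (by rw [hs, hs t, e]) (by rw [hs, hs v, e]) (by rw [hs, hs w, e])
  refine ⟨hinj, ?_⟩
  have hd : Module.finrank ℝ (R 3) = Module.finrank ℝ (R 3 →L[ℝ] ℝ) := by
    rw [← LinearEquiv.finrank_eq (LinearMap.toContinuousLinearMap (E := R 3) (F' := ℝ) (𝕜 := ℝ))]
    exact (Subspace.dual_finrank_eq (K := ℝ) (V := R 3)).symm
  exact (LinearMap.injective_iff_surjective_of_finrank_eq_finrank (f := g.toLinearMap) hd).1 hinj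

end Lorentz

/-! ### Cubic forms with pointwise symmetry -/

/-- A metric `g` and a `(1,2)`-tensor `K` with totally symmetric and traceless cubic form. -/
structure IsApolar (g : R 3 →L[ℝ] R 3 →L[ℝ] ℝ) (K : R 3 →L[ℝ] R 3 →L[ℝ] R 3) : Prop where
  symm : ∀ x y, g x y = g y x
  K_symm : ∀ x y, K x y = K y x
  cubic_symm : ∀ x y z, g (K x y) z = g (K x z) y
  trace_zero : ∀ x, LinearMap.trace ℝ (R 3) (K x).toLinearMap = 0
  lorentz : ∃ t v w, IsLorentzONB g t v w

/-- `T` is a unit timelike vector such that `K_T` is `-2a` on `T` and `a` on the orthogonal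
complement, `a > 0`. -/
structure IsAxis (g : R 3 →L[ℝ] R 3 →L[ℝ] ℝ) (K : R 3 →L[ℝ] R 3 →L[ℝ] R 3) (T : R 3) (a : ℝ) :
    Prop where
  unit : g T T = -1
  pos : 0 < a
  K_self : K T T = (-(2 * a)) • T
  K_perp : ∀ u, g T u = 0 → K T u = a • u

section Cubic

variable {g : R 3 →L[ℝ] R 3 →L[ℝ] ℝ} {K : R 3 →L[ℝ] R 3 →L[ℝ] R 3} {t v w : R 3}

/-- A symmetric cubic form in three variables has ten coefficients. Invariance arguments below
become comparisons of these coefficients. -/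
lemma IsApolar.cubic_expand (hK : IsApolar g K) (t v w : R 3)
    (x0 x1 x2 y0 y1 y2 z0 z1 z2 : ℝ) :
    g (K (x0 • t + x1 • v + x2 • w) (y0 • t + y1 • v + y2 • w)) (z0 • t + z1 • v + z2 • w)
      = g (K t t) t * (x0 * y0 * z0)
        + g (K t t) v * (x0 * y0 * z1 + x0 * y1 * z0 + x1 * y0 * z0)
        + g (K t t) w * (x0 * y0 * z2 + x0 * y2 * z0 + x2 * y0 * z0)
        + g (K t v) v * (x0 * y1 * z1 + x1 * y1 * z0 + x1 * y0 * z1)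
        + g (K t v) w * (x0 * y1 * z2 + x0 * y2 * z1 + x1 * y0 * z2 + x2 * y0 * z1
            + x1 * y2 * z0 + x2 * y1 * z0)
        + g (K t w) w * (x0 * y2 * z2 + x2 * y2 * z0 + x2 * y0 * z2)
        + g (K v v) v * (x1 * y1 * z1)
        + g (K v v) w * (x1 * y1 * z2 + x1 * y2 * z1 + x2 * y1 * z1)
        + g (K v w) w * (x1 * y2 * z2 + x2 * y1 * z2 + x2 * y2 * z1)
        + g (K w w) w * (x2 * y2 * z2) := by
  have e1 := hK.cubic_symm t v t
  have e2 := hK.cubic_symm t w t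
  have e3 := hK.cubic_symm t w v
  have e4 := hK.cubic_symm v v t
  have e5 := hK.cubic_symm v w v
  have e6 := hK.cubic_symm v w t
  have e7 := hK.cubic_symm w w t
  have e8 := hK.cubic_symm w w v
  rw [hK.K_symm v t] at e4 e6
  rw [hK.K_symm w t] at e7
  rw [hK.K_symm w v] at e8
  simp only [map_add, map_smul, smul_eq_mul, add_apply, smul_apply, hK.K_symm v t, hK.K_symm w t,
    hK.K_symm w v, e1, e2, e3, e4, e5, e6, e7, e8]
  ring

lemma IsApolar.trace_onb (hK : IsApolar g K) (h : IsLorentzONB g t v w) (x : R 3) :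
    -(g (K x t) t) + g (K x v) v + g (K x w) w = 0 := by
  have := hK.trace_zero x
  rw [h.trace_eq hK.symm] at this
  rw [hK.symm (K x t), hK.symm (K x v), hK.symm (K x w)]
  exact this

/-- The rows (c, s) and (e, d) are orthonormal, so cd − se = ±1, and the sign determines the second
row from the first. -/
lemma rotation_or_reflection {c s e d : ℝ} (n1 : c * c + s * s = 1) (n2 : e * e + d * d = 1)
    (n3 : c * e + s * d = 0) : (d = c ∧ e = -s) ∨ (d = -c ∧ e = s) := by
  have hd : (c * d - s * e) ^ 2 = 1 := by
    linear_combination (-c * e - s * d) * n3 + (d * d + e * e) * n1 + n2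
  rcases sq_eq_one_iff.1 hd with hd | hd
  · left
    have h0 : (d - c) ^ 2 + (e + s) ^ 2 = 0 := by linear_combination n1 + n2 - 2 * hd
    constructor
    · nlinarith [sq_nonneg (d - c), sq_nonneg (e + s)]
    · nlinarith [sq_nonneg (d - c), sq_nonneg (e + s)]
  · right
    have h0 : (d + c) ^ 2 + (e - s) ^ 2 = 0 := by linear_combination n1 + n2 + 2 * hd
    constructor
    · nlinarith [sq_nonneg (d + c), sq_nonneg (e - s)]
    · nlinarith [sq_nonneg (d + c), sq_nonneg (e - s)]

/-- The rotation normal form of an isometry of order three. -/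
lemma exists_rotation_frame (hs : ∀ x y, g x y = g y x) (h : IsLorentzONB g t v w)
    (L : R 3 ≃ₗ[ℝ] R 3) (hL : ∀ x y, g (L x) (L y) = g x y) (h3 : L ^ 3 = 1) (h1 : L ≠ 1) :
    ∃ (T V W : R 3) (s : ℝ), IsLorentzONB g T V W ∧ s ^ 2 = 3 / 4 ∧ L T = T ∧
      L V = (-(1 / 2) : ℝ) • V + s • W ∧ L W = (-s) • V + (-(1 / 2) : ℝ) • W := by
  have hL3 : ∀ x, L (L (L x)) = x := fun x => by
    have := congrArg (fun A : R 3 ≃ₗ[ℝ] R 3 => A x) h3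
    simpa [pow_succ] using this
  obtain ⟨T, hT, hLT⟩ : ∃ T, g T T = -1 ∧ L T = T := by
    set c := g t (L t) with hc
    have e1 : g (L t) (L t) = -1 := by rw [hL, h.tt]
    have e2 : g (L (L t)) (L (L t)) = -1 := by rw [hL, e1]
    have e3 : g (L t) (L (L t)) = c := by rw [hL]
    have e4 : g t (L (L t)) = c := by
      rw [← hL, hL3, hs]
    -- Let p, p' be the spacelike parts of Lt and L²t. Then |p|² = |p'|² = c² − 1, and h(Lt, L²t) =
    -- c gives p·p' = c² + c, so 0 ≤ |p − p'|² = −2 − 2c. This makes the invariant orbit sum t + Lt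
    -- + L²t timelike.
    have hc1 : c ≤ -1 := by
      have d1 := h.decomp hs (L t)
      have d2 := h.decomp hs (L (L t))
      rw [← hc] at d1
      rw [e4] at d2
      have e1' : g (-c • t + g v (L t) • v + g w (L t) • w)
          (-c • t + g v (L t) • v + g w (L t) • w) = -1 := by
        rw [← d1, e1]
      have e2' : g (-c • t + g v (L (L t)) • v + g w (L (L t)) • w)
          (-c • t + g v (L (L t)) • v + g w (L (L t)) • w) = -1 := by
        rw [← d2, e2]
      rw [h.apply hs] at e1' e2'
      have e3' : g (-c • t + g v (L t) • v + g w (L t) • w)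
          (-c • t + g v (L (L t)) • v + g w (L (L t)) • w) = c := by
        rw [← d1, ← d2, e3]
      rw [h.apply hs] at e3'
      clear e3
      nlinarith [sq_nonneg (g v (L t) - g v (L (L t))), sq_nonneg (g w (L t) - g w (L (L t)))]
    set s := t + L t + L (L t) with hsdef
    have hss : g s s = -3 + 6 * c := by
      simp only [hsdef, map_add, add_apply, h.tt, e1, e2, e3, e4, hs (L t) t, hs (L (L t)) t,
        hs (L (L t)) (L t), ← hc]
      ring
    have hneg : 0 < -(g s s) := by linarith
    refine ⟨(Real.sqrt (-(g s s)))⁻¹ • s, ?_, ?_⟩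
    · have hq := Real.sq_sqrt hneg.le
      have hq0 : Real.sqrt (-(g s s)) ≠ 0 := (Real.sqrt_pos.2 hneg).ne'
      simp only [map_smul, smul_apply, smul_eq_mul]
      field_simp
      linarith
    · rw [map_smul]
      congr 1
      simp only [hsdef, map_add, hL3]
      abel
  obtain ⟨V, W, hO⟩ := h.exists_complete hs hT
  have gTV : g T (L V) = 0 := by
    have := hL T V
    rwa [hLT, hO.tv] at this
  have gTW : g T (L W) = 0 := by
    have := hL T W
    rwa [hLT, hO.tw] at this
  have dV := hO.decomp hs (L V)
  have dW := hO.decomp hs (L W)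
  rw [gTV] at dV
  rw [gTW] at dW
  have n1 := hL V V
  have n2 := hL W W
  have n3 := hL V W
  have n1 : g _ _ = g _ _ := (congrArg (fun x => g x x) dV).symm.trans n1
  have n2 : g _ _ = g _ _ := (congrArg (fun x => g x x) dW).symm.trans n2
  have n3 : g _ _ = g _ _ := (congrArg₂ (fun x y => g x y) dV dW).symm.trans n3
  rw [hO.apply hs, hO.vv] at n1
  rw [hO.apply hs, hO.ww] at n2
  rw [hO.apply hs, hO.vw] at n3
  simp only [neg_zero, zero_smul, zero_add] at dV dW
  generalize g V (L V) = c at dV n1 n2 n3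
  generalize g W (L V) = s at dV n1 n2 n3
  generalize g V (L W) = e at dW n1 n2 n3
  generalize g W (L W) = d at dW n1 n2 n3
  have LV2 : L (L V) = (0 : ℝ) • T + (c * c + s * e) • V + (c * s + s * d) • W := by
    rw [congrArg L dV, map_add, map_smul, map_smul, dV, dW]
    module
  have LW2 : L (L W) = (0 : ℝ) • T + (e * c + d * e) • V + (e * s + d * d) • W := by
    rw [congrArg L dW, map_add, map_smul, map_smul, dV, dW]
    module
  have hrot : d = c ∧ e = -s := by
    rcases rotation_or_reflection (by linarith) (by linarith) (by linarith : c * e + s * d = 0)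
      with hd | ⟨f1, f2⟩
    · exact hd
    -- A reflection of the plane squares to the identity there, so L³ = 1 would give L = 1.
    · exfalso
      rw [f1, f2] at LV2 LW2
      have g1 : L V = V := by
        have := hL3 V
        rw [LV2] at this
        have q1 : c * c + s * s = 1 := by linarith
        have q2 : c * s + s * -c = 0 := by ring
        rw [q1, q2] at this
        simpa using this
      have g2 : L W = W := by
        have := hL3 W
        rw [LW2] at this
        have q1 : s * s + -c * -c = 1 := by linarith
        have q2 : s * c + -c * s = 0 := by ring
        rw [q1, q2] at this
        simpa using this
      apply h1
      ext x : 1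
      obtain ⟨a, b, c, rfl⟩ := hO.exists_coord hs x
      simp [hLT, g1, g2]
  obtain ⟨rfl, f2⟩ := hrot
  rw [f2] at dW LV2 LW2
  have LV3 := hL3 V
  rw [LV2, map_add, map_add, map_smul, map_smul, map_smul, hLT, dV, dW] at LV3
  have LV3' : (0 : ℝ) • T + ((d * d + s * -s) * d - (d * s + s * d) * s) • V
      + ((d * d + s * -s) * s + (d * s + s * d) * d) • W
      = (0 : ℝ) • T + (1 : ℝ) • V + (0 : ℝ) • W := by
    refine Eq.trans ?_ (LV3.trans ?_) <;> module
  -- These are the real and imaginary parts of (d + is)³ = 1. Since L ≠ 1 excludes s = 0, only d =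
  -- −1/2, s² = 3/4 remains.
  obtain ⟨-, p1, p2⟩ := hO.coord_eq hs LV3'
  have hs0 : s ≠ 0 := by
    intro h0
    have : d = 1 := by
      rw [h0] at p1
      have : (d - 1) * (d ^ 2 + d + 1) = 0 := by linear_combination p1
      rcases mul_eq_zero.1 this with h | h
      · linarith
      · nlinarith [sq_nonneg (d + 1), sq_nonneg d]
    apply h1
    ext x : 1
    obtain ⟨a, b, c, rfl⟩ := hO.exists_coord hs x
    simp [hLT, dV, dW, h0, this]
  have q1 : s ^ 2 = 3 * d ^ 2 := by
    have : s * (3 * d ^ 2 - s ^ 2) = 0 := by linarith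
    rcases mul_eq_zero.1 this with h | h
    · exact absurd h hs0
    · linarith
  have q2 : d = -(1 / 2) := by
    have h4 : d ^ 2 = 1 / 4 := by linarith
    have h5 : d * (d ^ 2 - 3 * s ^ 2) = 1 := by linarith
    rw [q1, h4] at h5
    linarith
  refine ⟨T, V, W, s, hO, by rw [q1, q2]; norm_num, hLT, ?_, ?_⟩
  · rw [dV, q2]
  · rw [dW, q2]

end Cubic

end

/-! ### The normal form forced by a symmetry of order three. -/

section

section Cubic

variable {g : R 3 →L[ℝ] R 3 →L[ℝ] ℝ} {K : R 3 →L[ℝ] R 3 →L[ℝ] R 3} {t v w : R 3}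

lemma mem_symmetryGroup {L : R 3 ≃ₗ[ℝ] R 3} :
    L ∈ symmetryGroup g (fun u v => K u v) ↔ LinearEquiv.det L = 1 ∧
      (∀ u v, g (L u) (L v) = g u v) ∧ ∀ u v, K (L u) (L v) = L (K u v) :=
  Iff.rfl

lemma cubic_invariant {L : R 3 ≃ₗ[ℝ] R 3} (hL : L ∈ symmetryGroup g (fun u v => K u v))
    (x y z : R 3) : g (K (L x) (L y)) (L z) = g (K x y) z := by
  rw [(mem_symmetryGroup.1 hL).2.2, (mem_symmetryGroup.1 hL).2.1]

/-- A symmetry of order three forces the normal form of the cubic form, up to the sign of `a`. -/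
lemma cubic_of_order_three (hK : IsApolar g K) {T V W : R 3} (hO : IsLorentzONB g T V W)
    {L : R 3 ≃ₗ[ℝ] R 3} (hL : L ∈ symmetryGroup g (fun u v => K u v)) {s : ℝ} (hs : s ^ 2 = 3 / 4)
    (hT : L T = T) (hV : L V = (-(1 / 2) : ℝ) • V + s • W)
    (hW : L W = (-s) • V + (-(1 / 2) : ℝ) • W) :
    g (K T T) V = 0 ∧ g (K T T) W = 0 ∧ g (K T V) W = 0 ∧ g (K T V) V = g (K T W) W ∧
      g (K T T) T = 2 * g (K T V) V ∧ g (K V W) W = -g (K V V) V ∧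
      g (K W W) W = -g (K V V) W := by
  have hV' : L V = (0 : ℝ) • T + (-(1 / 2) : ℝ) • V + s • W := by rw [hV]; module
  have hW' : L W = (0 : ℝ) • T + (-s) • V + (-(1 / 2) : ℝ) • W := by rw [hW]; module
  have hT' : L T = (1 : ℝ) • T + (0 : ℝ) • V + (0 : ℝ) • W := by rw [hT]; module
  -- Under rotations about T the cubic form splits into parts of weights 0, 1, 2 and 3, and rotation
  -- by 2π/3 fixes no nonzero vector of weight 1 or 2. Invariance removes the terms quadratic in T
  -- and the trace-free part of the terms linear in T. The three trace conditions then remove the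
  -- weight-one part of the plane cubic and relate the two coefficients of weight 0.
  have e1 := cubic_invariant hL T T V
  have e2 := cubic_invariant hL T T W
  have e3 := cubic_invariant hL T V W
  have e4 := cubic_invariant hL T V V
  rw [hT', hV', hK.cubic_expand] at e1
  rw [hT', hW', hK.cubic_expand] at e2
  rw [hT', hV', hW', hK.cubic_expand] at e3
  rw [hT', hV', hK.cubic_expand] at e4
  have t1 := hK.trace_onb hO T
  have t2 := hK.trace_onb hO V
  have t3 := hK.trace_onb hO W
  have s1 : g (K V T) T = g (K T T) V := by rw [hK.K_symm V T, hK.cubic_symm]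
  have s2 : g (K W T) T = g (K T T) W := by rw [hK.K_symm W T, hK.cubic_symm]
  have s3 : g (K W V) V = g (K V V) W := by rw [hK.K_symm W V, hK.cubic_symm]
  rw [s1] at t2
  rw [s2, s3] at t3
  have hs0 : s ≠ 0 := by rintro rfl; norm_num at hs
  have a1 : g (K T T) V = 0 := by linear_combination (-1/2) * e1 + (-s/3) * e2 + (-1/3 * g (K T T) V) * hs
  have a2 : g (K T T) W = 0 := by
    have : s * g (K T T) W = 0 := by rw [a1] at e1; linarith
    exact (mul_eq_zero.1 this).resolve_left hs0
  have a3 : g (K T V) W = 0 := by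
    linear_combination (-1/2) * e3 + (-s/3) * e4
      + (-(5/6) * g (K T V) W + s * g (K T W) W / 3) * hs
  have a4 : g (K T V) V = g (K T W) W := by
    rw [a3] at e4
    linear_combination (-4/3) * e4 + (4/3 * g (K T W) W) * hs
  refine ⟨a1, a2, a3, a4, by linarith, by linarith, by linarith⟩

lemma isAxis_of_cubic (hK : IsApolar g K) {T V W : R 3} (hO : IsLorentzONB g T V W) {a : ℝ}
    (ha : 0 < a) (h1 : g (K T T) V = 0) (h2 : g (K T T) W = 0) (h3 : g (K T V) W = 0)
    (h4 : g (K T V) V = a) (h5 : g (K T W) W = a) (h6 : g (K T T) T = 2 * a) :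
    IsAxis g K T a := by
  refine ⟨hO.tt, ha, ?_, fun u hu => ?_⟩
  · refine hO.ext hK.symm ?_ ?_ ?_
    · rw [hK.symm, h6, map_smul, hO.tt]; simp
    · rw [hK.symm, h1, map_smul, hK.symm V, hO.tv]; simp
    · rw [hK.symm, h2, map_smul, hK.symm W, hO.tw]; simp
  · obtain ⟨x, y, z, rfl⟩ := hO.exists_coord hK.symm u
    have k0 := hO.apply hK.symm 1 0 0 x y z
    simp only [one_smul, zero_smul, add_zero] at k0
    rw [k0] at hu
    obtain rfl : x = 0 := by linarith
    have e : ∀ x0 x1 x2 : ℝ, g (K T ((0 : ℝ) • T + y • V + z • W)) (x0 • T + x1 • V + x2 • W)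
        = g (a • ((0 : ℝ) • T + y • V + z • W)) (x0 • T + x1 • V + x2 • W) := by
      intro x0 x1 x2
      have e1 := hK.cubic_expand T V W 1 0 0 0 y z x0 x1 x2
      have e2 : (1 : ℝ) • T + (0 : ℝ) • V + (0 : ℝ) • W = T := by module
      rw [e2] at e1
      rw [e1, map_smul, smul_apply, hO.apply hK.symm, h1, h2, h3, h4, h5, smul_eq_mul]
      ring
    refine hO.ext hK.symm ?_ ?_ ?_
    · rw [hK.symm T, hK.symm T]
      simpa using e 1 0 0
    · rw [hK.symm V, hK.symm V]
      simpa using e 0 1 0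
    · rw [hK.symm W, hK.symm W]
      simpa using e 0 0 1

/-- The linear isometry with `T ↦ -T` which is the reflection `(V, W) ↦ (pV + qW, qV - pW)` on the
orthogonal complement. -/
lemma exists_reflection (hs : ∀ x y, g x y = g y x) {T V W : R 3} (hO : IsLorentzONB g T V W)
    {p q : ℝ} (hpq : p ^ 2 + q ^ 2 = 1) :
    ∃ A : R 3 ≃ₗ[ℝ] R 3, LinearEquiv.det A = 1 ∧ (∀ x y, g (A x) (A y) = g x y) ∧
      ∀ x y z : ℝ, A (x • T + y • V + z • W)
        = (-x) • T + (p * y + q * z) • V + (q * y - p * z) • W := by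
  let B : R 3 →ₗ[ℝ] R 3 := ((g T).toLinearMap).smulRight T
    + ((g V).toLinearMap).smulRight (p • V + q • W) + ((g W).toLinearMap).smulRight (q • V - p • W)
  have hB : ∀ x y z : ℝ, B (x • T + y • V + z • W)
        = (-x) • T + (p * y + q * z) • V + (q * y - p * z) • W := by
    intro x y z
    have k0 := hO.apply hs 1 0 0 x y z
    have k1 := hO.apply hs 0 1 0 x y z
    have k2 := hO.apply hs 0 0 1 x y z
    simp only [one_smul, zero_smul, add_zero, zero_add, one_mul, zero_mul, neg_zero] at k0 k1 k2
    have : B (x • T + y • V + z • W) = g T (x • T + y • V + z • W) • T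
        + g V (x • T + y • V + z • W) • (p • V + q • W)
        + g W (x • T + y • V + z • W) • (q • V - p • W) := rfl
    rw [this, k0, k1, k2]
    module
  have hBB : Function.Involutive B := by
    intro u
    obtain ⟨x, y, z, rfl⟩ := hO.exists_coord hs u
    rw [hB, hB]
    have h1 : p * (p * y + q * z) + q * (q * y - p * z) = y := by linear_combination y * hpq
    have h2 : q * (p * y + q * z) - p * (q * y - p * z) = z := by linear_combination z * hpq
    rw [h1, h2, neg_neg]
  refine ⟨LinearEquiv.ofInvolutive B hBB, ?_, ?_, hB⟩
  · rw [← Units.val_inj, LinearEquiv.coe_det]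
    change LinearMap.det B = 1
    have key : ∀ (u : R 3) (x y z : ℝ), u = x • T + y • V + z • W →
        (hO.basis hs).repr u 0 = x ∧ (hO.basis hs).repr u 1 = y ∧ (hO.basis hs).repr u 2 = z := by
      intro u x y z hu
      have e := (hO.basis hs).sum_repr u
      rw [hO.coe_basis hs] at e
      simp only [Fin.sum_univ_three, Matrix.cons_val_zero, Matrix.cons_val_one, Matrix.cons_val_two,
        Matrix.tail_cons, Matrix.head_cons, Matrix.cons_val] at e
      exact hO.coord_eq hs (e.trans hu)
    have bT : B T = (-1 : ℝ) • T + (0 : ℝ) • V + (0 : ℝ) • W := by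
      have := hB 1 0 0; simpa using this
    have bV : B V = (0 : ℝ) • T + p • V + q • W := by
      have := hB 0 1 0; simpa using this
    have bW : B W = (0 : ℝ) • T + q • V + (-p) • W := by
      have := hB 0 0 1; simpa using this
    rw [← LinearMap.det_toMatrix (hO.basis hs), Matrix.det_fin_three]
    simp only [LinearMap.toMatrix_apply, hO.coe_basis hs, Matrix.cons_val_zero,
      Matrix.cons_val_one, Matrix.cons_val_two, Matrix.tail_cons, Matrix.head_cons, Matrix.cons_val,
      (key _ _ _ _ bT).1, (key _ _ _ _ bT).2.1, (key _ _ _ _ bT).2.2,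
      (key _ _ _ _ bV).1, (key _ _ _ _ bV).2.1, (key _ _ _ _ bV).2.2,
      (key _ _ _ _ bW).1, (key _ _ _ _ bW).2.1, (key _ _ _ _ bW).2.2]
    linear_combination hpq
  · intro x y
    change g (B x) (B y) = g x y
    obtain ⟨x0, x1, x2, rfl⟩ := hO.exists_coord hs x
    obtain ⟨y0, y1, y2, rfl⟩ := hO.exists_coord hs y
    rw [hB, hB, hO.apply hs, hO.apply hs]
    linear_combination (x1 * y1 + x2 * y2) * hpq

/-- Cube roots on the unit circle, for the reflection axis of a binary cubic. -/
lemma exists_reflection_axis (c₁ c₂ : ℝ) : ∃ p q : ℝ, p ^ 2 + q ^ 2 = 1 ∧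
    c₁ * (p ^ 3 - 3 * p * q ^ 2) + c₂ * (3 * p ^ 2 * q - q ^ 3) = c₁ ∧
    c₁ * (3 * p ^ 2 * q - q ^ 3) - c₂ * (p ^ 3 - 3 * p * q ^ 2) = c₂ := by
  by_cases h0 : c₁ ^ 2 + c₂ ^ 2 = 0
  · have h1 : c₁ = 0 := by nlinarith [sq_nonneg c₁, sq_nonneg c₂]
    have h2 : c₂ = 0 := by nlinarith [sq_nonneg c₁, sq_nonneg c₂]
    exact ⟨1, 0, by norm_num, by rw [h1, h2]; ring, by rw [h1, h2]; ring⟩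
  -- With c = c₁ + ic₂ the two equations say that z³ times the conjugate of c equals c, so z is a
  -- cube root of c²/|c|².
  obtain ⟨z, hz⟩ := IsAlgClosed.exists_pow_nat_eq
    ((⟨c₁ ^ 2 - c₂ ^ 2, 2 * c₁ * c₂⟩ : ℂ) / ((c₁ ^ 2 + c₂ ^ 2 : ℝ) : ℂ)) (n := 3) (by norm_num)
  have hre : z.re ^ 3 - 3 * z.re * z.im ^ 2 = (c₁ ^ 2 - c₂ ^ 2) / (c₁ ^ 2 + c₂ ^ 2) := by
    have := congrArg Complex.re hz
    rw [Complex.div_ofReal_re] at this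
    rw [← this]
    simp [pow_succ]
    ring
  have him : 3 * z.re ^ 2 * z.im - z.im ^ 3 = (2 * c₁ * c₂) / (c₁ ^ 2 + c₂ ^ 2) := by
    have := congrArg Complex.im hz
    rw [Complex.div_ofReal_im] at this
    rw [← this]
    simp [pow_succ]
    ring
  refine ⟨z.re, z.im, ?_, ?_, ?_⟩
  · have h3 : (z.re ^ 2 + z.im ^ 2) ^ 3 = 1 := by
      have : (z.re ^ 2 + z.im ^ 2) ^ 3
          = (z.re ^ 3 - 3 * z.re * z.im ^ 2) ^ 2 + (3 * z.re ^ 2 * z.im - z.im ^ 3) ^ 2 := by ring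
      rw [this, hre, him]
      field_simp
      ring
    have hn : 0 ≤ z.re ^ 2 + z.im ^ 2 := by positivity
    exact (pow_eq_one_iff_of_nonneg hn (by norm_num)).1 h3
  · rw [hre, him]; field_simp; ring
  · rw [hre, him]; field_simp; ring

/-- If a symmetry of order three commutes with all symmetries, the cubic form has an axis. -/
theorem exists_isAxis (hK : IsApolar g K) {L : R 3 ≃ₗ[ℝ] R 3}
    (hL : L ∈ symmetryGroup g (fun u v => K u v)) (h3 : L ^ 3 = 1) (h1 : L ≠ 1)
    (hcomm : ∀ A ∈ symmetryGroup g (fun u v => K u v), A * L = L * A) :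
    ∃ (T V W : R 3) (a s : ℝ), IsAxis g K T a ∧ IsLorentzONB g T V W ∧ s ^ 2 = 3 / 4 ∧ L T = T ∧
      L V = (-(1 / 2) : ℝ) • V + s • W ∧ L W = (-s) • V + (-(1 / 2) : ℝ) • W := by
  obtain ⟨t, v, w, ho⟩ := hK.lorentz
  obtain ⟨T, V, W, s, hO, hs, hT, hV, hW⟩ :=
    exists_rotation_frame hK.symm ho L (mem_symmetryGroup.1 hL).2.1 h3 h1
  obtain ⟨a1, a2, a3, a4, a5, a6, a7⟩ := cubic_of_order_three hK hO hL hs hT hV hW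
  have hs0 : s ≠ 0 := by rintro rfl; norm_num at hs
  -- The common eigenvalue of K_T on T^⊥ changes sign with T, so if it is nonzero it can be made
  -- positive.
  rcases lt_trichotomy (g (K T V) V) 0 with hlt | heq | hgt
  · refine ⟨-T, V, W, -(g (K T V) V), s, ?_, ?_, hs, by rw [map_neg, hT], hV, hW⟩
    · have hO' : IsLorentzONB g (-T) V W :=
        ⟨by simp [hO.tt], hO.vv, hO.ww, by simp [hO.tv], by simp [hO.tw], hO.vw⟩
      refine isAxis_of_cubic hK hO' (by linarith) ?_ ?_ ?_ ?_ ?_ ?_ <;> simp [a1, a2, a3, a5, ← a4]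
    · exact ⟨by simp [hO.tt], hO.vv, hO.ww, by simp [hO.tv], by simp [hO.tw], hO.vw⟩
  -- In the degenerate case only a binary cubic on T^⊥ is left, and it has a reflection symmetry.
  -- Together with T ↦ −T this is a symmetry of determinant one. A reflection inverts rotations of
  -- the plane instead of commuting with them, which contradicts `hcomm`.
  · exfalso
    obtain ⟨p, q, hpq, r1, r2⟩ := exists_reflection_axis (g (K V V) V) (g (K V V) W)
    obtain ⟨A, hdet, hA, hform⟩ := exists_reflection hK.symm hO hpq
    have hmem : A ∈ symmetryGroup g (fun u v => K u v) := by
      refine mem_symmetryGroup.2 ⟨hdet, hA, fun x y => ?_⟩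
      refine (hO.nondegenerate hK.symm).1 (ContinuousLinearMap.ext fun z => ?_)
      obtain ⟨z, rfl⟩ := A.surjective z
      rw [hA]
      obtain ⟨x0, x1, x2, rfl⟩ := hO.exists_coord hK.symm x
      obtain ⟨y0, y1, y2, rfl⟩ := hO.exists_coord hK.symm y
      obtain ⟨z0, z1, z2, rfl⟩ := hO.exists_coord hK.symm z
      rw [hform, hform, hform, hK.cubic_expand, hK.cubic_expand, a1, a2, a3, a5, ← a4, heq, a6, a7]
      generalize g (K V V) V = c₁ at *
      generalize g (K V V) W = c₂ at *
      linear_combination (x1 * y1 * z1 - x1 * y2 * z2 - x2 * y1 * z2 - x2 * y2 * z1) * r1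
        + (x1 * y1 * z2 + x1 * y2 * z1 + x2 * y1 * z1 - x2 * y2 * z2) * r2
    have hc := congrArg (fun B : R 3 ≃ₗ[ℝ] R 3 => B V) (hcomm A hmem)
    simp only [LinearEquiv.mul_apply] at hc
    have AV : A V = (0 : ℝ) • T + p • V + q • W := by
      have := hform 0 1 0
      simpa using this
    have e1 : A (L V) = (0 : ℝ) • T + (p * (-(1 / 2)) + q * s) • V
        + (q * (-(1 / 2)) - p * s) • W := by
      rw [hV]
      have := hform 0 (-(1 / 2)) s
      simpa using this
    have e2 : L (A V) = (0 : ℝ) • T + (p * (-(1 / 2)) - q * s) • V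
        + (p * s + q * (-(1 / 2))) • W := by
      rw [AV, map_add, map_add, map_smul, map_smul, map_smul, hV, hW]
      module
    rw [e1, e2] at hc
    obtain ⟨-, h1, h2⟩ := hO.coord_eq hK.symm hc
    have q0 : q = 0 := by
      have : q * s = 0 := by linarith
      exact (mul_eq_zero.1 this).resolve_right hs0
    have p0 : p = 0 := by
      have : p * s = 0 := by linarith
      exact (mul_eq_zero.1 this).resolve_right hs0
    rw [p0, q0] at hpq
    norm_num at hpq
  · exact ⟨T, V, W, _, s, isAxis_of_cubic hK hO hgt a1 a2 a3 rfl a4.symm a5, hO, hs, hT, hV, hW⟩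

/-- If a symmetry of order three is a cube of a symmetry commuting with it, the cubic form is
rotationally symmetric. -/
theorem isotropic_of_cube (hK : IsApolar g K) {A : R 3 ≃ₗ[ℝ] R 3}
    (hA : A ∈ symmetryGroup g (fun u v => K u v)) {T V W : R 3} {a s : ℝ} (hax : IsAxis g K T a)
    (hO : IsLorentzONB g T V W) (hs : s ^ 2 = 3 / 4) (hT : (A ^ 3) T = T)
    (hV : (A ^ 3) V = (-(1 / 2) : ℝ) • V + s • W) (hW : (A ^ 3) W = (-s) • V + (-(1 / 2) : ℝ) • W)
    (u v : R 3) (hu : g T u = 0) (hv : g T v = 0) : K u v = (-(a * g u v)) • T := by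
  have hs0 : s ≠ 0 := by rintro rfl; norm_num at hs
  set L := A ^ 3 with hLdef
  have hL : L ∈ symmetryGroup g (fun u v => K u v) := Subgroup.pow_mem _ hA 3
  obtain ⟨a1, a2, a3, a4, a5, a6, a7⟩ := cubic_of_order_three hK hO hL hs hT hV hW
  have hLA : ∀ x, L (A x) = A (L x) := fun x => by
    have : L * A = A * L := by rw [hLdef]; exact (pow_succ A 3).symm.trans (pow_succ' A 3)
    exact congrArg (fun B : R 3 ≃ₗ[ℝ] R 3 => B x) this
  have hA3 : ∀ x, A (A (A x)) = L x := fun x => by simp [hLdef, pow_succ]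
  have hform : ∀ x y z : ℝ, L (x • T + y • V + z • W)
      = x • T + (y * (-(1 / 2)) - z * s) • V + (y * s + z * (-(1 / 2))) • W := by
    intro x y z
    rw [map_add, map_add, map_smul, map_smul, map_smul, hT, hV, hW]
    module
  -- A commutes with its cube, hence preserves the line of vectors fixed by that cube, which is
  -- spanned by T.
  obtain ⟨μ, hμ⟩ : ∃ μ : ℝ, A T = μ • T := by
    obtain ⟨x, y, z, e⟩ := hO.exists_coord hK.symm (A T)
    have h1 := hLA T
    rw [hT, e, hform] at h1
    obtain ⟨-, h1, h2⟩ := hO.coord_eq hK.symm h1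
    have hy : y = 0 := by linear_combination (-1/2) * h1 + (s/3) * h2 - (y/3) * hs
    have hz : z = 0 := by
      rw [hy] at h1
      have : z * s = 0 := by linarith
      exact (mul_eq_zero.1 this).resolve_right hs0
    exact ⟨x, by rw [e, hy, hz]; module⟩
  have hμ0 : μ ≠ 0 := by
    rintro rfl
    rw [zero_smul] at hμ
    have hT0 : T = 0 := by simpa using hμ
    have := hO.tt
    rw [hT0] at this
    simp at this
  have gA := (mem_symmetryGroup.1 hA).2.1
  have gTV : g T (A V) = 0 := by
    have := gA T V
    rw [hμ, hO.tv, map_smul, smul_apply, smul_eq_mul] at this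
    exact (mul_eq_zero.1 this).resolve_left hμ0
  have gTW : g T (A W) = 0 := by
    have := gA T W
    rw [hμ, hO.tw, map_smul, smul_apply, smul_eq_mul] at this
    exact (mul_eq_zero.1 this).resolve_left hμ0
  have dV := hO.decomp hK.symm (A V)
  have dW := hO.decomp hK.symm (A W)
  rw [gTV, neg_zero] at dV
  rw [gTW, neg_zero] at dW
  generalize g V (A V) = c at dV
  generalize g W (A V) = d at dV
  generalize g V (A W) = e at dW
  generalize g W (A W) = f at dW
  -- Commuting with a nontrivial rotation of the plane forces A to be complex linear on it.
  have hc : e = -d ∧ f = c := by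
    have h1 := hLA V
    rw [dV, hform, hV, map_add, map_smul, map_smul, dV, dW] at h1
    have h2 : (0 : ℝ) • T + (c * (-(1 / 2)) - d * s) • V + (c * s + d * (-(1 / 2))) • W
        = (0 : ℝ) • T + (-(1 / 2) * c + s * e) • V + (-(1 / 2) * d + s * f) • W :=
      h1.trans (by module)
    obtain ⟨-, h1, h2⟩ := hO.coord_eq hK.symm h2
    constructor
    · have : s * (e + d) = 0 := by linarith
      rcases mul_eq_zero.1 this with h | h
      · exact absurd h hs0
      · linarith
    · have : s * (f - c) = 0 := by linarith
      rcases mul_eq_zero.1 this with h | h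
      · exact absurd h hs0
      · linarith
  obtain ⟨rfl, rfl⟩ := hc
  have AA : ∀ y z : ℝ, A ((0 : ℝ) • T + y • V + z • W)
      = (0 : ℝ) • T + (y * f - z * d) • V + (y * d + z * f) • W := by
    intro y z
    rw [map_add, map_add, map_smul, map_smul, map_smul, hμ, dV, dW]
    module
  have h3 := hA3 V
  rw [dV, AA, AA, hV] at h3
  have h3' := h3.trans (by module : _ = (0 : ℝ) • T + (-(1 / 2) : ℝ) • V + s • W)
  obtain ⟨-, p1, p2⟩ := hO.coord_eq hK.symm h3'
  have i1 := cubic_invariant hA V V V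
  have i2 := cubic_invariant hA V V W
  rw [dV, hK.cubic_expand, a6, a7] at i1
  rw [dV, dW, hK.cubic_expand, a6, a7] at i2
  generalize hc₁ : g (K V V) V = c₁ at a6 i1 i2
  generalize hc₂ : g (K V V) W = c₂ at a7 i1 i2
  -- The pair (c₁, c₂) has weight three, so A acts on it through A³, the rotation of order three.
  -- Such a rotation fixes only zero.
  have j1 : -(1 / 2) * c₁ + s * c₂ = c₁ := by linear_combination i1 - c₁ * p1 - c₂ * p2
  have j2 : -s * c₁ - 1 / 2 * c₂ = c₂ := by linear_combination i2 + c₁ * p2 - c₂ * p1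
  have k1 : c₁ = 0 := by linear_combination (-1/2) * j1 + (-s/3) * j2 - (c₁/3) * hs
  have k2 : c₂ = 0 := by linear_combination (-2/3) * j2 - (2 / 3 * s) * k1
  rw [k1, neg_zero] at a6
  rw [k2, neg_zero] at a7
  obtain ⟨x, y, z, rfl⟩ := hO.exists_coord hK.symm u
  obtain ⟨x', y', z', rfl⟩ := hO.exists_coord hK.symm v
  have m1 := hO.apply hK.symm 1 0 0 x y z
  have m2 := hO.apply hK.symm 1 0 0 x' y' z'
  simp only [one_smul, zero_smul, add_zero] at m1 m2
  rw [m1] at hu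
  rw [m2] at hv
  obtain rfl : x = 0 := by linarith
  obtain rfl : x' = 0 := by linarith
  have hTV : g (K T V) V = a := by
    rw [hax.K_perp V hO.tv]; simp [hO.vv]
  refine (hO.nondegenerate hK.symm).1 (ContinuousLinearMap.ext fun z => ?_)
  obtain ⟨z0, z1, z2, rfl⟩ := hO.exists_coord hK.symm z
  have m3 := hO.apply hK.symm 1 0 0 z0 z1 z2
  simp only [one_smul, zero_smul, add_zero] at m3
  rw [hK.cubic_expand, hO.apply hK.symm, map_smul, smul_apply, m3, a1, a2, a3, a5, ← a4, hTV, a6, a7, hc₁, hc₂, k1, k2,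
    smul_eq_mul]
  ring

end Cubic

end

section

/-! ### Symmetry groups isomorphic to `ℤ₃` or `SO(2)` -/

/-- The rotation by the angle `θ`. -/
def rotation (θ : ℝ) : SO2 :=
  ⟨!![Real.cos θ, -Real.sin θ; Real.sin θ, Real.cos θ], by
    rw [Matrix.mem_specialOrthogonalGroup_iff, Matrix.mem_orthogonalGroup_iff]
    have h := Real.cos_sq_add_sin_sq θ
    constructor
    · ext i j
      fin_cases i <;> fin_cases j <;> simp [Matrix.mul_apply, Fin.sum_univ_two, Matrix.star_apply] <;>
        nlinarith
    · rw [Matrix.det_fin_two_of]; nlinarith⟩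

lemma rotation_mul (θ φ : ℝ) : rotation θ * rotation φ = rotation (θ + φ) := by
  apply Subtype.ext
  change _ * _ = _
  ext i j
  fin_cases i <;> fin_cases j <;>
    simp [rotation, Matrix.mul_apply, Fin.sum_univ_two, Real.cos_add, Real.sin_add] <;> ring

lemma rotation_pow (θ : ℝ) (k : ℕ) : rotation θ ^ k = rotation (k * θ) := by
  induction k with
  | zero =>
    apply Subtype.ext
    ext i j
    fin_cases i <;> fin_cases j <;> simp [rotation]
  | succ k ih =>
    rw [pow_succ, ih, rotation_mul]
    congr 1
    push_cast
    ring

lemma SO2_mul_comm (A B : SO2) : A * B = B * A := by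
  have key : ∀ A : SO2, A.1 1 1 = A.1 0 0 ∧ A.1 1 0 = -A.1 0 1 := by
    intro A
    obtain ⟨A, hA⟩ := A
    rw [Matrix.mem_specialOrthogonalGroup_iff, Matrix.mem_orthogonalGroup_iff] at hA
    obtain ⟨h1, h2⟩ := hA
    have e00 := congrFun (congrFun h1 0) 0
    have e01 := congrFun (congrFun h1 0) 1
    have e11 := congrFun (congrFun h1 1) 1
    simp [Matrix.mul_apply, Fin.sum_univ_two, Matrix.star_apply] at e00 e01 e11
    rw [Matrix.det_fin_two] at h2
    constructor
    · change A 1 1 = A 0 0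
      linear_combination (-A 1 1) * e00 + (A 0 1) * e01 + A 0 0 * h2
    · change A 1 0 = -A 0 1
      linear_combination (-A 1 0) * e00 + (A 0 0) * e01 - A 0 1 * h2
  have hA := key A
  have hB := key B
  apply Subtype.ext
  change A.1 * B.1 = B.1 * A.1
  ext i j
  fin_cases i <;> fin_cases j <;> simp [Matrix.mul_apply, Fin.sum_univ_two, hA, hB] <;> ring

section Symmetry

variable {g : R 3 →L[ℝ] R 3 →L[ℝ] ℝ} {K : R 3 →L[ℝ] R 3 →L[ℝ] R 3}

/-- Only algebra passes through an abstract isomorphism. What is used of ℤ₃ and SO(2) is that they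
are abelian and contain an element of order three. -/
lemma exists_symmetry_of_mulEquiv {Γ : Type} [Group Γ] (hc : ∀ a b : Γ, a * b = b * a)
    (e : symmetryGroup g (fun u v => K u v) ≃* Γ) {x : Γ} (h3 : x ^ 3 = 1) (h1 : x ≠ 1) :
    ∃ L ∈ symmetryGroup g (fun u v => K u v), L ^ 3 = 1 ∧ L ≠ 1 ∧ (e.symm x).1 = L ∧
      ∀ A ∈ symmetryGroup g (fun u v => K u v), A * L = L * A := by
  refine ⟨(e.symm x).1, (e.symm x).2, ?_, ?_, rfl, fun A hA => ?_⟩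
  · have := congrArg e.symm h3
    rw [map_pow, map_one] at this
    exact congrArg Subtype.val this
  · intro h
    apply h1
    apply e.symm.injective
    rw [map_one]
    exact Subtype.ext h
  · have : e.symm (e ⟨A, hA⟩ * x) = e.symm (x * e ⟨A, hA⟩) := by rw [hc]
    rw [map_mul, map_mul, e.symm_apply_apply] at this
    exact congrArg Subtype.val this

theorem exists_isAxis_of_Z3 (hK : IsApolar g K)
    (h : Nonempty (symmetryGroup g (fun u v => K u v) ≃* Z3)) : ∃ T a, IsAxis g K T a := by
  obtain ⟨e⟩ := h
  obtain ⟨L, hL, h3, h1, -, hc⟩ := exists_symmetry_of_mulEquiv (fun a b => mul_comm a b) e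
    (x := Multiplicative.ofAdd 1) (by decide) (by decide)
  obtain ⟨T, V, W, a, s, hax, -⟩ := exists_isAxis hK hL h3 h1 hc
  exact ⟨T, a, hax⟩

/-- SO(2) differs from ℤ₃ by divisibility: its rotation by 2π/3 is the cube of the rotation by 2π/9.
This cube root is what kills c₁ and c₂, so no continuity of the isomorphism is needed. -/
theorem exists_isAxis_of_SO2 (hK : IsApolar g K)
    (h : Nonempty (symmetryGroup g (fun u v => K u v) ≃* SO2)) : ∃ T a, IsAxis g K T a ∧
      ∀ u v, g T u = 0 → g T v = 0 → K u v = (-(a * g u v)) • T := by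
  obtain ⟨e⟩ := h
  have r3 : rotation (2 * Real.pi / 9) ^ 3 = rotation (2 * Real.pi / 3) := by
    rw [rotation_pow]; congr 1; push_cast; ring
  obtain ⟨L, hL, h3, h1, hLe, hc⟩ := exists_symmetry_of_mulEquiv SO2_mul_comm e
    (x := rotation (2 * Real.pi / 9) ^ 3) (by
      rw [r3, rotation_pow]
      apply Subtype.ext
      ext i j
      have : ((3 : ℕ) : ℝ) * (2 * Real.pi / 3) = 2 * Real.pi := by push_cast; ring
      rw [this]
      fin_cases i <;> fin_cases j <;> simp [rotation]) (by
      rw [r3]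
      intro h
      have h0 : Real.cos (2 * Real.pi / 3) = 1 :=
        congrArg (fun A : SO2 => A.1 0 0) h
      have : Real.cos (2 * Real.pi / 3) = - (1 / 2) := by
        rw [show 2 * Real.pi / 3 = Real.pi - Real.pi / 3 by ring, Real.cos_pi_sub,
          Real.cos_pi_div_three]
      rw [this] at h0
      norm_num at h0)
  obtain ⟨T, V, W, a, s, hax, hO, hs, hT, hV, hW⟩ := exists_isAxis hK hL h3 h1 hc
  have hcube : (e.symm (rotation (2 * Real.pi / 9))).1 ^ 3 = L := by
    rw [← hLe, map_pow]
    rfl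
  refine ⟨T, a, hax, fun u v hu hv => ?_⟩
  exact isotropic_of_cube hK (e.symm (rotation (2 * Real.pi / 9))).2 hax hO hs (by rw [hcube, hT])
    (by rw [hcube, hV]) (by rw [hcube, hW]) u v hu hv

end Symmetry

/-! ### The axis as a smooth function of the metric and the cubic form -/

section AxisVector

variable {E : Type*} [NormedAddCommGroup E] [NormedSpace ℝ E] [FiniteDimensional ℝ E]

/-- The trace as a continuous linear functional. -/
def traceCLM (E : Type*) [NormedAddCommGroup E] [NormedSpace ℝ E] [FiniteDimensional ℝ E] :
    (E →L[ℝ] E) →L[ℝ] ℝ :=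
  LinearMap.toContinuousLinearMap ((LinearMap.trace ℝ E).comp (coeLM ℝ))

lemma traceCLM_apply (A : E →L[ℝ] E) : traceCLM E A = LinearMap.trace ℝ E A.toLinearMap := rfl

/-- The bilinear form `(u, v) ↦ tr (K_u K_v)`. -/
def killingForm (K : E →L[ℝ] E →L[ℝ] E) : E →L[ℝ] E →L[ℝ] ℝ :=
  ((compL ℝ E (E →L[ℝ] E) ℝ).flip K).comp
    ((compL ℝ (E →L[ℝ] E) (E →L[ℝ] E) ℝ (traceCLM E)).comp ((compL ℝ E E E).comp K))

lemma killingForm_apply (K : E →L[ℝ] E →L[ℝ] E) (u v : E) :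
    killingForm K u v = traceCLM E ((K u).comp (K v)) := by
  simp [killingForm]

/-- The vector which is `g`-dual to `u ↦ tr (K_u Q)`, `Q` being the Killing form of `K`. -/
def axisVector (g : E →L[ℝ] E →L[ℝ] ℝ) (K : E →L[ℝ] E →L[ℝ] E) : E :=
  g.inverse ((traceCLM E).comp
    (((compL ℝ E E E).flip (g.inverse.comp (killingForm K))).comp K))

lemma contDiffAt_axisVector {X : Type*} [NormedAddCommGroup X] [NormedSpace ℝ X]
    {g : X → E →L[ℝ] E →L[ℝ] ℝ} {K : X → E →L[ℝ] E →L[ℝ] E} {x : X}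
    (hg : ContDiffAt ℝ ∞ g x) (hK : ContDiffAt ℝ ∞ K x) (hi : (g x).IsInvertible) :
    ContDiffAt ℝ ∞ (fun y => axisVector (g y) (K y)) x := by
  have : CompleteSpace E := FiniteDimensional.complete ℝ E
  have hinv : ContDiffAt ℝ ∞ (fun y => (g y).inverse) x := (hi.contDiffAt_map_inverse).comp x hg
  have hQ : ContDiffAt ℝ ∞ (fun y => killingForm (K y)) x := by
    unfold killingForm
    exact ((ContinuousLinearMap.contDiff _).contDiffAt.comp x hK).clm_comp
      (contDiffAt_const.clm_comp (contDiffAt_const.clm_comp hK))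
  unfold axisVector
  exact hinv.clm_apply (contDiffAt_const.clm_comp
    (((ContinuousLinearMap.contDiff _).contDiffAt.comp x (hinv.clm_comp hQ)).clm_comp hK))

/-- The unit vector in the direction opposite to the axis vector. -/
def axis (g : E →L[ℝ] E →L[ℝ] ℝ) (K : E →L[ℝ] E →L[ℝ] E) : E :=
  (-(Real.sqrt (-(g (axisVector g K) (axisVector g K))))⁻¹) • axisVector g K

/-- The function `a` in the normal form of the cubic form. -/
def axisValue (g : E →L[ℝ] E →L[ℝ] ℝ) (K : E →L[ℝ] E →L[ℝ] E) : ℝ :=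
  g (K (axis g K) (axis g K)) (axis g K) / 2

end AxisVector

/-! ### Uniqueness of the axis and its formula in terms of h and K. -/

section Axis

variable {g : R 3 →L[ℝ] R 3 →L[ℝ] ℝ} {K : R 3 →L[ℝ] R 3 →L[ℝ] R 3} {T V W : R 3} {a : ℝ}

/-- The table of `K` in an orthonormal frame containing the axis. -/
structure HasNormalForm (K : R 3 →L[ℝ] R 3 →L[ℝ] R 3) (T V W : R 3) (a c₁ c₂ : ℝ) : Prop where
  TT : K T T = (-(2 * a)) • T
  TV : K T V = a • V
  TW : K T W = a • W
  VV : K V V = (-a) • T + c₁ • V + c₂ • W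
  VW : K V W = c₂ • V + (-c₁) • W
  WW : K W W = (-a) • T + (-c₁) • V + (-c₂) • W

lemma IsAxis.hasNormalForm (h : IsAxis g K T a) (hK : IsApolar g K) (hO : IsLorentzONB g T V W) :
    HasNormalForm K T V W a (g (K V V) V) (g (K V V) W) := by
  have t2 := hK.trace_onb hO V
  have t3 := hK.trace_onb hO W
  have TV := h.K_perp V hO.tv
  have TW := h.K_perp W hO.tw
  have VT : K V T = a • V := by rw [hK.K_symm, TV]
  have WT : K W T = a • W := by rw [hK.K_symm, TW]
  have sVT : g V T = 0 := by rw [hK.symm, hO.tv]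
  have sWT : g W T = 0 := by rw [hK.symm, hO.tw]
  have sWV : g W V = 0 := by rw [hK.symm, hO.vw]
  have s3 : g (K W V) V = g (K V V) W := by rw [hK.K_symm W V, hK.cubic_symm]
  rw [VT, map_smul, smul_apply, sVT, smul_zero, neg_zero, zero_add] at t2
  rw [WT, map_smul, smul_apply, sWT, smul_zero, neg_zero, zero_add, s3] at t3
  have q1 : g (K V V) T = a := by
    rw [hK.cubic_symm, VT]; simp [hO.vv]
  have q2 : g (K V W) T = 0 := by
    rw [hK.cubic_symm, VT]; simp [hO.vw]
  have q3 : g (K W W) T = a := by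
    rw [hK.cubic_symm, WT]; simp [hO.ww]
  have q4 : g (K V W) V = g (K V V) W := hK.cubic_symm _ _ _
  have q5 : g (K W W) V = g (K V W) W := by rw [hK.cubic_symm, hK.K_symm]
  refine ⟨h.K_self, TV, TW, ?_, ?_, ?_⟩
  · rw [hO.decomp hK.symm (K V V), hK.symm T, hK.symm V, hK.symm W, q1]
    simp only [map_add, map_smul, add_apply, smul_apply, hO.tv, hO.vv, sWV, hO.tw, hO.vw, hO.ww,
      smul_eq_mul]
    module
  · rw [hO.decomp hK.symm (K V W), hK.symm T, hK.symm V, hK.symm W, q2, q4,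
      show g (K V W) W = -g (K V V) V by linarith]
    module
  · rw [hO.decomp hK.symm (K W W), hK.symm T, hK.symm V, hK.symm W, q3, q5,
      show g (K V W) W = -g (K V V) V by linarith, show g (K W W) W = -g (K V V) W by linarith]

/-- Evaluated in the normal form, contracting K with its Killing form leaves only a T-component, and
its factor −2a(4a² + 2(c₁² + c₂²)) never vanishes. Hence T is unique and depends smoothly on h and
K, with no smooth choice of V and W. -/
lemma IsAxis.axisVector_eq (h : IsAxis g K T a) (hK : IsApolar g K) :
    ∃ m : ℝ, 0 < m ∧ axisVector g K = (-m) • T := by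
  obtain ⟨t, v, w, ho⟩ := hK.lorentz
  obtain ⟨V, W, hO⟩ := ho.exists_complete hK.symm h.unit
  have hN := h.hasNormalForm hK hO
  generalize g (K V V) V = c₁ at hN
  generalize g (K V V) W = c₂ at hN
  have VT : K V T = a • V := by rw [hK.K_symm, hN.TV]
  have WT : K W T = a • W := by rw [hK.K_symm, hN.TW]
  have WV : K W V = c₂ • V + (-c₁) • W := by rw [hK.K_symm, hN.VW]
  have sVT : g V T = 0 := by rw [hK.symm, hO.tv]
  have sWT : g W T = 0 := by rw [hK.symm, hO.tw]
  have sWV : g W V = 0 := by rw [hK.symm, hO.vw]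
  have hinv : ∀ l, g (g.inverse l) = l := by
    intro l
    obtain ⟨e, he⟩ := isInvertible_of_bijective (hO.nondegenerate hK.symm)
    rw [← he]; simp
  have Q : ∀ u v, killingForm K u v
      = -(g T (K u (K v T))) + g V (K u (K v V)) + g W (K u (K v W)) := by
    intro u v
    rw [killingForm_apply, traceCLM_apply, hO.trace_eq hK.symm]
    rfl
  set P := g.inverse.comp (killingForm K) with hP
  have gP : ∀ u v, g (P u) v = killingForm K u v := by
    intro u v
    rw [hP, comp_apply, hinv]
  have key : ∀ u, P u = (6 * a ^ 2 * g T u) • T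
      + ((2 * (c₁ ^ 2 + c₂ ^ 2) - 2 * a ^ 2) * g V u) • V
      + ((2 * (c₁ ^ 2 + c₂ ^ 2) - 2 * a ^ 2) * g W u) • W := by
    intro u
    obtain ⟨x, y, z, rfl⟩ := hO.exists_coord hK.symm u
    refine hO.ext hK.symm ?_ ?_ ?_
    all_goals
      rw [hK.symm _ (P _), gP, Q]
      simp only [map_add, map_smul, add_apply, smul_apply, smul_eq_mul, hN.TT, hN.TV, hN.TW, hN.VV,
        hN.VW, hN.WW, VT, WT, WV, hO.tt, hO.vv, hO.ww, hO.tv, hO.tw, hO.vw, sVT, sWT, sWV]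
      ring
  have hZ : ∀ u, g (axisVector g K) u
      = -(g T (K u (P T))) + g V (K u (P V)) + g W (K u (P W)) := by
    intro u
    rw [axisVector, hinv, ← hP, comp_apply, comp_apply, traceCLM_apply, hO.trace_eq hK.symm]
    rfl
  refine ⟨2 * a * (4 * a ^ 2 + 2 * (c₁ ^ 2 + c₂ ^ 2)), ?_, ?_⟩
  · have := h.pos
    positivity
  · refine hO.ext hK.symm ?_ ?_ ?_
    all_goals
      rw [hK.symm _ (axisVector g K), hZ, key, key, key]
      simp only [map_add, map_smul, add_apply, smul_apply, smul_eq_mul, hN.TT, hN.TV, hN.TW, hN.VV,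
        hN.VW, hN.WW, VT, WT, WV, hO.tt, hO.vv, hO.ww, hO.tv, hO.tw, hO.vw, sVT, sWT, sWV]
      ring

lemma IsAxis.eq_axis (h : IsAxis g K T a) (hK : IsApolar g K) : T = axis g K := by
  obtain ⟨m, hm, e⟩ := h.axisVector_eq hK
  have : -(g ((-m) • T) ((-m) • T)) = m ^ 2 := by
    simp only [map_smul, smul_apply, h.unit, smul_eq_mul]
    ring
  rw [axis, e, this, Real.sqrt_sq hm.le, smul_smul]
  have : -m⁻¹ * -m = 1 := by field_simp
  rw [this, one_smul]

lemma IsAxis.eq_axisValue (h : IsAxis g K T a) (hK : IsApolar g K) : a = axisValue g K := by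
  rw [axisValue, ← h.eq_axis hK, h.K_self, map_smul, smul_apply, h.unit]
  simp

end Axis

end

section

/-! ### Apolarity -/

lemma _root_.AlternatingMap.map_update_sum_smul_self {ι M : Type*} [Fintype ι] [DecidableEq ι]
    [AddCommGroup M] [Module ℝ M] (Ω : M [⋀^ι]→ₗ[ℝ] ℝ) (F : ι → M) (i : ι) (c : ι → ℝ) :
    Ω (Function.update F i (∑ j, c j • F j)) = c i * Ω F := by
  rw [AlternatingMap.map_update_sum, Finset.sum_eq_single i]
  · rw [AlternatingMap.map_update_smul, Function.update_eq_self, smul_eq_mul]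
  · intro j _ hj
    rw [AlternatingMap.map_update_smul, AlternatingMap.map_update_self _ _ hj.symm, smul_zero]
  · simp

/-- The standard volume form of `ℝᵐ`. -/
def volForm (m : ℕ) : R m [⋀^Fin m]→ₗ[ℝ] ℝ := (EuclideanSpace.basisFun (Fin m) ℝ).toBasis.det

lemma volForm_apply {m : ℕ} (F : Fin m → R m) :
    volForm m F = Matrix.det (Matrix.of fun i j => F j i) := by
  rw [volForm, Module.Basis.det_apply]
  congr 1

lemma continuous_volForm (m : ℕ) : Continuous (volForm m) := by
  have : (volForm m : (Fin m → R m) → ℝ) = fun F => Matrix.det (Matrix.of fun i j => F j i) :=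
    funext volForm_apply
  rw [this]
  apply Continuous.matrix_det
  apply continuous_matrix
  intro i j
  simp only [Matrix.of_apply]
  fun_prop

/-- The volume form as a continuous multilinear map. -/
def volFormCMM (m : ℕ) : ContinuousMultilinearMap ℝ (fun _ : Fin m => R m) ℝ :=
  ⟨(volForm m).toMultilinearMap, continuous_volForm m⟩

/-! ### The induced volume form and its derivative. -/

section Volume

variable {n : ℕ} {f ξ : R n → R (n + 1)} {U : Set (R n)}

/-- The induced frame `(df b₁, …, df bₙ, ξ)`. -/
def inducedFrame (f ξ : R n → R (n + 1)) (b : Fin n → R n) (x : R n) : Fin (n + 1) → R (n + 1) :=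
  Fin.snoc (α := fun _ => R (n + 1)) (fun k => fderiv ℝ f x (b k)) (ξ x)

lemma inducedVolume_eq (f ξ : R n → R (n + 1)) (x : R n) :
    inducedVolume f ξ x
      = volForm (n + 1) (inducedFrame f ξ (fun k => EuclideanSpace.single k 1) x) := by
  rw [volForm_apply]
  rfl

/-- The volume `det (df b₁, …, df bₙ, ξ)` as an alternating map of `b`. -/
def inducedVolumeForm (f ξ : R n → R (n + 1)) (x : R n) : R n [⋀^Fin n]→ₗ[ℝ] ℝ where
  toFun b := volForm (n + 1) (inducedFrame f ξ b x)
  map_update_add' := by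
    intro inst b i u v
    obtain rfl : inst = instDecidableEqFin n := Subsingleton.elim _ _
    have key : ∀ u, inducedFrame f ξ (Function.update b i u) x
        = Function.update (inducedFrame f ξ b x) i.castSucc (fderiv ℝ f x u) := by
      intro u
      have e : (fun k => fderiv ℝ f x (Function.update b i u k))
          = Function.update (fun k => fderiv ℝ f x (b k)) i (fderiv ℝ f x u) := by
        ext k : 1
        by_cases h : k = i
        · subst h; simp
        · simp [h]
      rw [inducedFrame, inducedFrame, e, Fin.snoc_update]
    rw [key, key, key, map_add, AlternatingMap.map_update_add]
  map_update_smul' := by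
    intro inst b i c u
    obtain rfl : inst = instDecidableEqFin n := Subsingleton.elim _ _
    have key : ∀ u, inducedFrame f ξ (Function.update b i u) x
        = Function.update (inducedFrame f ξ b x) i.castSucc (fderiv ℝ f x u) := by
      intro u
      have e : (fun k => fderiv ℝ f x (Function.update b i u k))
          = Function.update (fun k => fderiv ℝ f x (b k)) i (fderiv ℝ f x u) := by
        ext k : 1
        by_cases h : k = i
        · subst h; simp
        · simp [h]
      rw [inducedFrame, inducedFrame, e, Fin.snoc_update]
    rw [key, key, map_smul, AlternatingMap.map_update_smul]
  map_eq_zero_of_eq' := by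
    intro b i j hb hij
    refine (volForm (n + 1)).map_eq_zero_of_eq _ (i := i.castSucc) (j := j.castSucc) ?_ ?_
    · simp [inducedFrame, hb]
    · simpa using hij

lemma inducedVolumeForm_apply (f ξ : R n → R (n + 1)) (x : R n) (b : Fin n → R n) :
    inducedVolumeForm f ξ x b = volForm (n + 1) (inducedFrame f ξ b x) := rfl

/-- The volume condition in an arbitrary frame. -/
lemma IsBlaschkeOn.volume_frame (h : IsBlaschkeOn f ξ U) {x : R n} (hx : x ∈ U)
    (b : Fin n → R n) :
    |volForm (n + 1) (inducedFrame f ξ b x)|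
      = Real.sqrt |Matrix.det (Matrix.of fun i j => affineMetric f ξ x (b i) (b j))| := by
  have e1 := AlternatingMap.eq_smul_basis_det
    (EuclideanSpace.basisFun (Fin n) ℝ).toBasis (inducedVolumeForm f ξ x)
  have e2 := congrArg (fun Ω : R n [⋀^Fin n]→ₗ[ℝ] ℝ => Ω b) e1
  simp only [AlternatingMap.smul_apply, smul_eq_mul, inducedVolumeForm_apply] at e2
  have e3 : volForm (n + 1) (inducedFrame f ξ
      (⇑(EuclideanSpace.basisFun (Fin n) ℝ).toBasis) x) = inducedVolume f ξ x := by
    rw [inducedVolume_eq]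
    congr 2
    ext k : 1
    simp
  have e4 : (EuclideanSpace.basisFun (Fin n) ℝ).toBasis.det b
      = Matrix.det (Matrix.of fun i j => b j i) := volForm_apply b
  rw [e2, e3, e4, abs_mul, h.volume_eq x hx]
  have e5 : (Matrix.of fun i j => affineMetric f ξ x (b i) (b j))
      = (Matrix.of fun i j => b j i).transpose * (Matrix.of fun i j : Fin n =>
        affineMetric f ξ x (EuclideanSpace.single i 1) (EuclideanSpace.single j 1))
        * (Matrix.of fun i j => b j i) := by
    ext i j
    have hb : ∀ i, b i = ∑ k, b i k • (EuclideanSpace.single k 1 : R n) := by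
      intro i
      have := (EuclideanSpace.basisFun (Fin n) ℝ).toBasis.sum_repr (b i)
      simpa using this.symm
    have hrhs : ((Matrix.of fun i j => b j i).transpose * (Matrix.of fun i j : Fin n =>
        affineMetric f ξ x (EuclideanSpace.single i 1) (EuclideanSpace.single j 1))
        * (Matrix.of fun i j => b j i)) i j = ∑ l, (∑ k, b i k *
          affineMetric f ξ x (EuclideanSpace.single k 1) (EuclideanSpace.single l 1)) * b j l := by
      simp [Matrix.mul_apply]
    rw [hrhs, Matrix.of_apply]
    conv_lhs => rw [hb i, hb j]
    simp only [map_sum, map_smul, sum_apply, smul_apply, smul_eq_mul]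
    refine Finset.sum_congr rfl fun l _ => ?_
    rw [Finset.sum_mul, Finset.mul_sum]
    exact Finset.sum_congr rfl fun k _ => by ring
  rw [e5, Matrix.det_mul, Matrix.det_mul, Matrix.det_transpose]
  set D := Matrix.det (Matrix.of fun i j => b j i)
  change _ = Real.sqrt |D * metricDet f ξ x * D|
  rw [show D * metricDet f ξ x * D = metricDet f ξ x * D ^ 2 by ring, abs_mul, abs_sq,
    Real.sqrt_mul (abs_nonneg _), Real.sqrt_sq_eq_abs]

lemma IsSphereOn.hasFDerivAt_inducedFrame {H : ℝ} (h : IsSphereOn f ξ H U) {x : R n} (hx : x ∈ U)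
    (b : Fin n → R n) : ∃ L : R n →L[ℝ] (Fin (n + 1) → R (n + 1)),
      HasFDerivAt (inducedFrame f ξ b) L x ∧ ∀ u, L u = Fin.snoc (α := fun _ => R (n + 1))
        (fun k => fderiv ℝ f x (christoffel f ξ x u (b k)) + affineMetric f ξ x u (b k) • ξ x)
        (-(H • fderiv ℝ f x u)) := by
  have hf : DifferentiableAt ℝ (fderiv ℝ f) x :=
    (h.contDiffAt_fderiv hx).differentiableAt (by simp)
  have hξ : DifferentiableAt ℝ ξ x := (h.contDiffAt_normal hx).differentiableAt (by simp)
  refine ⟨ContinuousLinearMap.pi (Fin.snoc (α := fun _ => R n →L[ℝ] R (n + 1))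
    (fun k => (fderiv ℝ (fderiv ℝ f) x).flip (b k)) (fderiv ℝ ξ x)), ?_, ?_⟩
  · rw [hasFDerivAt_pi]
    intro i
    refine Fin.lastCases ?_ (fun k => ?_) i
    · simp only [inducedFrame, Fin.snoc_last]
      exact hξ.hasFDerivAt
    · simp only [inducedFrame, Fin.snoc_castSucc]
      have := hf.hasFDerivAt.clm_apply (hasFDerivAt_const (b k) x)
      convert this using 1
      ext u; simp
  · intro u
    ext i : 1
    refine Fin.lastCases ?_ (fun k => ?_) i
    · simp [h.weingarten x hx]
    · simp [h.gauss hx]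

/-- The derivative of the induced volume. -/
lemma IsSphereOn.hasFDerivAt_volume {H : ℝ} (h : IsSphereOn f ξ H U) {x : R n} (hx : x ∈ U)
    (b : Module.Basis (Fin n) ℝ (R n)) : ∃ L : R n →L[ℝ] ℝ,
      HasFDerivAt (fun y => volForm (n + 1) (inducedFrame f ξ b y)) L x ∧
      ∀ u, L u = LinearMap.trace ℝ (R n) (christoffel f ξ x u).toLinearMap
        * volForm (n + 1) (inducedFrame f ξ b x) := by
  obtain ⟨L, hL, hL'⟩ := h.hasFDerivAt_inducedFrame hx b
  refine ⟨_, ((volFormCMM (n + 1)).hasFDerivAt (inducedFrame f ξ b x)).comp x hL, fun u => ?_⟩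
  -- Differentiate one slot at a time. A tangential slot contributes its diagonal coefficient, and
  -- these add up to the trace of Γ_u; the slot of ξ contributes nothing because Dξ is tangential.
  rw [comp_apply, ContinuousMultilinearMap.linearDeriv_apply, hL', Fin.sum_univ_castSucc]
  have hdf : ∀ v, fderiv ℝ f x v = ∑ k, b.repr v k • fderiv ℝ f x (b k) := by
    intro v
    conv_lhs => rw [← b.sum_repr v]
    rw [map_sum]
    simp only [map_smul]
  have last : volFormCMM (n + 1) (Function.update (inducedFrame f ξ b x) (Fin.last n)
      (-(H • fderiv ℝ f x u))) = 0 := by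
    have : -(H • fderiv ℝ f x u) = ∑ j, (Fin.snoc (α := fun _ => ℝ)
        (fun k => -(H * b.repr u k)) 0 : Fin (n + 1) → ℝ) j • inducedFrame f ξ b x j := by
      rw [Fin.sum_univ_castSucc]
      simp [inducedFrame, hdf u, Finset.smul_sum, smul_smul]
    rw [this]
    refine (AlternatingMap.map_update_sum_smul_self (volForm (n + 1)) _ _ _).trans ?_
    simp
  have main : ∀ k : Fin n, volFormCMM (n + 1) (Function.update (inducedFrame f ξ b x) k.castSucc
      (fderiv ℝ f x (christoffel f ξ x u (b k)) + affineMetric f ξ x u (b k) • ξ x))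
      = b.repr (christoffel f ξ x u (b k)) k * volForm (n + 1) (inducedFrame f ξ b x) := by
    intro k
    have : fderiv ℝ f x (christoffel f ξ x u (b k)) + affineMetric f ξ x u (b k) • ξ x
        = ∑ j, (Fin.snoc (α := fun _ => ℝ) (fun l => b.repr (christoffel f ξ x u (b k)) l)
          (affineMetric f ξ x u (b k)) : Fin (n + 1) → ℝ) j • inducedFrame f ξ b x j := by
      rw [Fin.sum_univ_castSucc]
      simp [inducedFrame, hdf (christoffel f ξ x u (b k))]
    rw [this]
    refine (AlternatingMap.map_update_sum_smul_self (volForm (n + 1)) _ _ _).trans ?_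
    simp
  simp only [Fin.snoc_castSucc, Fin.snoc_last, last, main, add_zero]
  rw [← Finset.sum_mul, LinearMap.trace_eq_matrix_trace ℝ b, Matrix.trace]
  simp [LinearMap.toMatrix_apply]

end Volume

/-! ### Vanishing of the trace of K for a Blaschke normal. -/

section Apolar

variable {f ξ : R 3 → R 4} {U : Set (R 3)} {H : ℝ}

/-- Apolarity: the difference tensor of a Blaschke immersion is traceless. -/
theorem IsSphereOn.trace_differenceMap (h : IsSphereOn f ξ H U) (hB : IsBlaschkeOn f ξ U)
    {x : R 3} (hx : x ∈ U) (hl : ∃ t v w, IsLorentzONB (affineMetric f ξ x) t v w) (u : R 3) :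
    LinearMap.trace ℝ (R 3) (differenceMap f ξ x u).toLinearMap = 0 := by
  obtain ⟨t, v, w, hO⟩ := hl
  have hs := h.metric_symm hx
  obtain ⟨L, hL, hL'⟩ := h.hasFDerivAt_volume hx (hO.basis hs)
  rw [hO.coe_basis hs] at hL hL'
  set vol : R 3 → ℝ := fun y => volForm 4 (inducedFrame f ξ ![t, v, w] y) with hvol
  have hG : DifferentiableAt ℝ (affineMetric f ξ) x :=
    (h.contDiffAt_metric hx).differentiableAt (by simp)
  have dG : ∀ a b : R 3, HasFDerivAt (fun y => affineMetric f ξ y a b)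
      (((fderiv ℝ (affineMetric f ξ) x).flip a).flip b) x := by
    intro a b
    have := (hG.hasFDerivAt.clm_apply (hasFDerivAt_const a x)).clm_apply (hasFDerivAt_const b x)
    refine this.congr_fderiv ?_
    ext u; simp
  set md : R 3 → ℝ := fun y => Matrix.det (Matrix.of fun i j : Fin 3 =>
    affineMetric f ξ y (![t, v, w] i) (![t, v, w] j)) with hmd
  have hvt : affineMetric f ξ x v t = 0 := by rw [hs, hO.tv]
  have hwt : affineMetric f ξ x w t = 0 := by rw [hs, hO.tw]
  have hwv : affineMetric f ξ x w v = 0 := by rw [hs, hO.vw]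
  obtain ⟨L₂, hL₂, hL₂'⟩ : ∃ L₂ : R 3 →L[ℝ] ℝ, HasFDerivAt md L₂ x ∧ ∀ u, L₂ u
      = fderiv ℝ (affineMetric f ξ) x u t t - fderiv ℝ (affineMetric f ξ) x u v v
        - fderiv ℝ (affineMetric f ξ) x u w w := by
    have e : md = fun y => affineMetric f ξ y t t * affineMetric f ξ y v v * affineMetric f ξ y w w
        - affineMetric f ξ y t t * affineMetric f ξ y v w * affineMetric f ξ y w v
        - affineMetric f ξ y t v * affineMetric f ξ y v t * affineMetric f ξ y w w
        + affineMetric f ξ y t v * affineMetric f ξ y v w * affineMetric f ξ y w t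
        + affineMetric f ξ y t w * affineMetric f ξ y v t * affineMetric f ξ y w v
        - affineMetric f ξ y t w * affineMetric f ξ y v v * affineMetric f ξ y w t := by
      ext y
      simp [hmd, Matrix.det_fin_three]
    rw [e]
    refine ⟨_, (((((((dG t t).mul (dG v v)).mul (dG w w)).sub
      (((dG t t).mul (dG v w)).mul (dG w v))).sub (((dG t v).mul (dG v t)).mul (dG w w))).add
      (((dG t v).mul (dG v w)).mul (dG w t))).add (((dG t w).mul (dG v t)).mul (dG w v))).sub
      (((dG t w).mul (dG v v)).mul (dG w t)), fun u => ?_⟩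
    simp [hO.tt, hO.vv, hO.ww, hO.tv, hO.tw, hO.vw, hvt, hwt, hwv]
    ring
  have hmdx : md x = -1 := by
    simp [hmd, Matrix.det_fin_three, hO.tt, hO.vv, hO.ww, hO.tv, hO.tw, hO.vw, hvt, hwt, hwv]
  have hneg : ∀ᶠ y in 𝓝 x, md y < 0 :=
    hL₂.continuousAt.eventually_lt continuousAt_const (by rw [hmdx]; norm_num)
  -- In Lorentzian signature det h < 0, so the volume condition reads vol² = −det h. Differentiating
  -- at x in a constant frame orthonormal there gives 2 tr Γ_u = 2 tr Γ_u − 2 tr K_u.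
  have heq : (fun y => vol y ^ 2) =ᶠ[𝓝 x] fun y => -md y := by
    filter_upwards [hneg, h.isOpen.mem_nhds hx] with y hy hyU
    have e := hB.volume_frame hyU ![t, v, w]
    change |vol y| = Real.sqrt |md y| at e
    rw [← sq_abs, e, Real.sq_sqrt (abs_nonneg _), abs_of_neg hy]
  have hd : HasFDerivAt (fun y => vol y ^ 2) (-L₂) x := (hL₂.neg).congr_of_eventuallyEq heq
  have hu := congrArg (fun A : R 3 →L[ℝ] ℝ => A u) ((hL.pow 2).unique hd)
  have hv2 : vol x ^ 2 = 1 := by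
    have : vol x ^ 2 = -md x := heq.eq_of_nhds
    rw [this, hmdx]; norm_num
  simp only [smul_apply, neg_apply, hL', hL₂', h.fderiv_metric hx, smul_eq_mul] at hu
  rw [hO.trace_eq hs] at hu ⊢
  change _ * (_ * vol x) = _ at hu
  simp only [coe_coe] at hu ⊢
  rw [hs t, hs v, hs w] at hu ⊢
  simp only [nsmul_eq_mul, Nat.cast_ofNat, Nat.add_one_sub_one, pow_one] at hu
  linear_combination (1 / 2) * hu - (-affineMetric f ξ x (christoffel f ξ x u t) t
    + affineMetric f ξ x (christoffel f ξ x u v) v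
    + affineMetric f ξ x (christoffel f ξ x u w) w) * hv2

end Apolar

end

section

/-! ### Affine spheres whose cubic form has an axis -/

variable {f ξ : R 3 → R 4} {U : Set (R 3)} {H : ℝ}

/-- An affine sphere with an apolar cubic form which has an axis at every point. -/
structure IsAxialOn (f ξ : R 3 → R 4) (H : ℝ) (U : Set (R 3)) : Prop
    extends IsSphereOn f ξ H U where
  blaschke : IsBlaschkeOn f ξ U
  apolar : ∀ x ∈ U, IsApolar (affineMetric f ξ x) (differenceMap f ξ x)
  exists_axis : ∀ x ∈ U, ∃ T a, IsAxis (affineMetric f ξ x) (differenceMap f ξ x) T a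

lemma IsAffineHypersphereOn.isSphereOn_of_lorentz (h : IsAffineHypersphereOn f ξ H U)
    (hU : IsOpen U) (hl : ∀ x ∈ U, ∃ t v w, IsLorentzONB (affineMetric f ξ x) t v w) :
    IsSphereOn f ξ H U := by
  have ht : IsTransversalOn f ξ U :=
    ⟨hU, h.blaschke.smooth, h.blaschke.smooth_normal, h.blaschke.transversal⟩
  refine h.isSphereOn hU fun x hx => ?_
  obtain ⟨t, v, w, hO⟩ := hl x hx
  exact hO.nondegenerate (ht.metric_symm hx)

lemma IsSphereOn.isApolar (h : IsSphereOn f ξ H U) (hB : IsBlaschkeOn f ξ U) {x : R 3} (hx : x ∈ U)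
    (hl : ∃ t v w, IsLorentzONB (affineMetric f ξ x) t v w) :
    IsApolar (affineMetric f ξ x) (differenceMap f ξ x) :=
  ⟨h.metric_symm hx, h.differenceMap_symm hx, h.metric_differenceMap_symm hx,
    h.trace_differenceMap hB hx hl, hl⟩

lemma IsSphereOn.hasSymmetryAt_iff (h : IsSphereOn f ξ H U) {x : R 3} (hx : x ∈ U) (Γ : Type)
    [Group Γ] : HasSymmetryAt Γ f ξ x ↔
      Nonempty (symmetryGroup (affineMetric f ξ x) (fun u v => differenceMap f ξ x u v) ≃* Γ) := by
  have : differenceTensor f ξ x = fun u v => differenceMap f ξ x u v := by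
    ext u v : 2
    exact h.differenceTensor_eq hx u v
  rw [HasSymmetryAt, this]

theorem IsAffineHypersphereOn.isAxialOn (h : IsAffineHypersphereOn f ξ H U) (hU : IsOpen U)
    (hl : ∀ x ∈ U, ∃ t v w, IsLorentzONB (affineMetric f ξ x) t v w)
    (hsym : ∀ x ∈ U, HasSymmetryAt Z3 f ξ x ∨ HasSymmetryAt SO2 f ξ x) : IsAxialOn f ξ H U := by
  have hS := h.isSphereOn_of_lorentz hU hl
  refine ⟨hS, h.blaschke, fun x hx => hS.isApolar h.blaschke hx (hl x hx), fun x hx => ?_⟩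
  have hK := hS.isApolar h.blaschke hx (hl x hx)
  rcases hsym x hx with h3 | h2
  · exact exists_isAxis_of_Z3 hK ((hS.hasSymmetryAt_iff hx _).1 h3)
  · obtain ⟨T, a, hax, -⟩ := exists_isAxis_of_SO2 hK ((hS.hasSymmetryAt_iff hx _).1 h2)
    exact ⟨T, a, hax⟩

/-- The unit timelike axis field. -/
def axisField (f ξ : R 3 → R 4) (x : R 3) : R 3 := axis (affineMetric f ξ x) (differenceMap f ξ x)

/-- The function `a` of the normal form. -/
def axisFun (f ξ : R 3 → R 4) (x : R 3) : ℝ :=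
  axisValue (affineMetric f ξ x) (differenceMap f ξ x)

namespace IsAxialOn

lemma mono (h : IsAxialOn f ξ H U) {O : Set (R 3)} (hO : IsOpen O) (hOU : O ⊆ U) :
    IsAxialOn f ξ H O where
  toIsSphereOn := h.toIsSphereOn.mono hO hOU
  blaschke := ⟨h.blaschke.smooth.mono hOU, h.blaschke.smooth_normal.mono hOU,
    fun x hx => h.blaschke.transversal x (hOU hx), fun x hx => h.blaschke.tangential x (hOU hx),
    fun x hx => h.blaschke.volume_eq x (hOU hx)⟩
  apolar x hx := h.apolar x (hOU hx)
  exists_axis x hx := h.exists_axis x (hOU hx)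

lemma isAxis (h : IsAxialOn f ξ H U) {x : R 3} (hx : x ∈ U) :
    IsAxis (affineMetric f ξ x) (differenceMap f ξ x) (axisField f ξ x) (axisFun f ξ x) := by
  obtain ⟨T, a, hax⟩ := h.exists_axis x hx
  have h1 := hax.eq_axis (h.apolar x hx)
  have h2 := hax.eq_axisValue (h.apolar x hx)
  rw [h1, h2] at hax
  exact hax

lemma contDiffAt_axisField (h : IsAxialOn f ξ H U) {x : R 3} (hx : x ∈ U) :
    ContDiffAt ℝ ∞ (axisField f ξ) x := by
  have hZ := contDiffAt_axisVector (h.contDiffAt_metric hx) (h.contDiffAt_differenceMap hx)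
    (h.isInvertible_metric hx)
  have hg := (((h.contDiffAt_metric hx).clm_apply hZ).clm_apply hZ).neg
  obtain ⟨m, hm, e⟩ := (h.isAxis hx).axisVector_eq (h.apolar x hx)
  have hne : -(affineMetric f ξ x (axisVector (affineMetric f ξ x) (differenceMap f ξ x))
      (axisVector (affineMetric f ξ x) (differenceMap f ξ x))) ≠ 0 := by
    rw [e]
    simp only [map_smul, smul_apply, (h.isAxis hx).unit, smul_eq_mul]
    have : 0 < m * m := mul_pos hm hm
    intro h0
    nlinarith
  unfold axisField axis
  exact (((hg.sqrt hne).inv (Real.sqrt_ne_zero'.2 (by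
    rw [e]
    simp only [map_smul, smul_apply, (h.isAxis hx).unit, smul_eq_mul]
    nlinarith [mul_pos hm hm]))).neg).smul hZ

lemma contDiffAt_axisFun (h : IsAxialOn f ξ H U) {x : R 3} (hx : x ∈ U) :
    ContDiffAt ℝ ∞ (axisFun f ξ) x := by
  have hT := h.contDiffAt_axisField hx
  have hK := ((h.contDiffAt_differenceMap hx).clm_apply hT).clm_apply hT
  have := ((h.contDiffAt_metric hx).clm_apply hK).clm_apply hT
  exact this.div_const 2

/-- Local orthonormal frames containing the axis field. -/
lemma exists_frame (h : IsAxialOn f ξ H U) {x₀ : R 3} (hx₀ : x₀ ∈ U) :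
    ∃ (O : Set (R 3)) (V W : R 3 → R 3), IsOpen O ∧ x₀ ∈ O ∧ O ⊆ U ∧
      (∀ x ∈ O, ContDiffAt ℝ ∞ V x) ∧ (∀ x ∈ O, ContDiffAt ℝ ∞ W x) ∧
      ∀ x ∈ O, IsLorentzONB (affineMetric f ξ x) (axisField f ξ x) (V x) (W x) := by
  set G := affineMetric f ξ with hG
  set T := axisField f ξ with hTdef
  obtain ⟨t, v, w, ho⟩ := (h.apolar x₀ hx₀).lorentz
  obtain ⟨v₀, w₀, hO₀⟩ := ho.exists_complete (h.metric_symm hx₀) (h.isAxis hx₀).unit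
  -- Gram–Schmidt applied to a constant frame. The projection along T carries a plus sign because
  -- h(T, T) = −1.
  let V' : R 3 → R 3 := fun x => v₀ + G x (T x) v₀ • T x
  let n₁ : R 3 → ℝ := fun x => G x (V' x) (V' x)
  let V : R 3 → R 3 := fun x => (Real.sqrt (n₁ x))⁻¹ • V' x
  let W' : R 3 → R 3 := fun x => w₀ + G x (T x) w₀ • T x - G x (V x) w₀ • V x
  let n₂ : R 3 → ℝ := fun x => G x (W' x) (W' x)
  let W : R 3 → R 3 := fun x => (Real.sqrt (n₂ x))⁻¹ • W' x
  have cG : ∀ x ∈ U, ContDiffAt ℝ ∞ G x := fun x hx => h.contDiffAt_metric hx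
  have cT : ∀ x ∈ U, ContDiffAt ℝ ∞ T x := fun x hx => h.contDiffAt_axisField hx
  have cV' : ∀ x ∈ U, ContDiffAt ℝ ∞ V' x := fun x hx =>
    contDiffAt_const.add ((((cG x hx).clm_apply (cT x hx)).clm_apply contDiffAt_const).smul (cT x hx))
  have cn₁ : ∀ x ∈ U, ContDiffAt ℝ ∞ n₁ x := fun x hx =>
    ((cG x hx).clm_apply (cV' x hx)).clm_apply (cV' x hx)
  have cV : ∀ x ∈ U, 0 < n₁ x → ContDiffAt ℝ ∞ V x := fun x hx hn =>
    (((cn₁ x hx).sqrt hn.ne').inv (Real.sqrt_ne_zero'.2 hn)).smul (cV' x hx)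
  have cW' : ∀ x ∈ U, 0 < n₁ x → ContDiffAt ℝ ∞ W' x := fun x hx hn =>
    (contDiffAt_const.add ((((cG x hx).clm_apply (cT x hx)).clm_apply
      contDiffAt_const).smul (cT x hx))).sub
      ((((cG x hx).clm_apply (cV x hx hn)).clm_apply contDiffAt_const).smul (cV x hx hn))
  have cn₂ : ∀ x ∈ U, 0 < n₁ x → ContDiffAt ℝ ∞ n₂ x := fun x hx hn =>
    ((cG x hx).clm_apply (cW' x hx hn)).clm_apply (cW' x hx hn)
  have cW : ∀ x ∈ U, 0 < n₁ x → 0 < n₂ x → ContDiffAt ℝ ∞ W x := fun x hx hn hn' =>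
    (((cn₂ x hx hn).sqrt hn'.ne').inv (Real.sqrt_ne_zero'.2 hn')).smul (cW' x hx hn)
  have eV' : V' x₀ = v₀ := by
    change v₀ + G x₀ (T x₀) v₀ • T x₀ = v₀
    rw [hO₀.tv]; simp
  have en₁ : n₁ x₀ = 1 := by
    change G x₀ (V' x₀) (V' x₀) = 1
    rw [eV', hO₀.vv]
  have eV : V x₀ = v₀ := by
    change (Real.sqrt (n₁ x₀))⁻¹ • V' x₀ = v₀
    rw [en₁, eV']; simp
  have eW' : W' x₀ = w₀ := by
    change w₀ + G x₀ (T x₀) w₀ • T x₀ - G x₀ (V x₀) w₀ • V x₀ = w₀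
    rw [hO₀.tw, eV, hO₀.vw]; simp
  have en₂ : n₂ x₀ = 1 := by
    change G x₀ (W' x₀) (W' x₀) = 1
    rw [eW', hO₀.ww]
  have hev : ∀ᶠ x in 𝓝 x₀, x ∈ U ∧ 0 < n₁ x ∧ 0 < n₂ x := by
    have h1 : ∀ᶠ x in 𝓝 x₀, 0 < n₁ x :=
      continuousAt_const.eventually_lt (cn₁ x₀ hx₀).continuousAt (by rw [en₁]; norm_num)
    have h2 : ∀ᶠ x in 𝓝 x₀, 0 < n₂ x :=
      continuousAt_const.eventually_lt
        (cn₂ x₀ hx₀ (by rw [en₁]; norm_num)).continuousAt (by rw [en₂]; norm_num)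
    filter_upwards [h.isOpen.mem_nhds hx₀, h1, h2] with x a b c using ⟨a, b, c⟩
  obtain ⟨O, hOsub, hOopen, hxO⟩ := mem_nhds_iff.1 hev
  refine ⟨O, V, W, hOopen, hxO, fun x hx => (hOsub hx).1,
    fun x hx => cV x (hOsub hx).1 (hOsub hx).2.1,
    fun x hx => cW x (hOsub hx).1 (hOsub hx).2.1 (hOsub hx).2.2, fun x hx => ?_⟩
  obtain ⟨hxU, hn₁, hn₂⟩ := hOsub hx
  have hs : ∀ u v, G x u v = G x v u := h.metric_symm hxU
  have hTT : G x (T x) (T x) = -1 := (h.isAxis hxU).unit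
  have hq₁ := Real.sq_sqrt hn₁.le
  have hq₂ := Real.sq_sqrt hn₂.le
  have hp₁ := (Real.sqrt_pos.2 hn₁).ne'
  have hp₂ := (Real.sqrt_pos.2 hn₂).ne'
  have tV' : G x (T x) (V' x) = 0 := by
    change G x (T x) (v₀ + G x (T x) v₀ • T x) = 0
    rw [map_add, map_smul, hTT, smul_eq_mul]; ring
  have tV : G x (T x) (V x) = 0 := by
    change G x (T x) ((Real.sqrt (n₁ x))⁻¹ • V' x) = 0
    rw [map_smul, tV', smul_zero]
  have vV : G x (V x) (V x) = 1 := by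
    change G x ((Real.sqrt (n₁ x))⁻¹ • V' x) ((Real.sqrt (n₁ x))⁻¹ • V' x) = 1
    simp only [map_smul, smul_apply, smul_eq_mul]
    change (Real.sqrt (n₁ x))⁻¹ * ((Real.sqrt (n₁ x))⁻¹ * n₁ x) = 1
    field_simp
    exact hq₁.symm
  have tW' : G x (T x) (W' x) = 0 := by
    change G x (T x) (w₀ + G x (T x) w₀ • T x - G x (V x) w₀ • V x) = 0
    rw [map_sub, map_add, map_smul, map_smul, hTT, tV, smul_eq_mul]; simp
  have vW' : G x (V x) (W' x) = 0 := by
    have gen : ∀ y, G x y y = 1 → G x (T x) y = 0 →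
        G x y (w₀ + G x (T x) w₀ • T x - G x y w₀ • y) = 0 := by
      intro y h1 h2
      rw [map_sub, map_add, map_smul, map_smul, h1, hs y (T x), h2, smul_eq_mul, smul_eq_mul]
      ring
    exact gen (V x) vV tV
  refine ⟨hTT, vV, ?_, tV, ?_, ?_⟩
  · change G x ((Real.sqrt (n₂ x))⁻¹ • W' x) ((Real.sqrt (n₂ x))⁻¹ • W' x) = 1
    simp only [map_smul, smul_apply, smul_eq_mul]
    change (Real.sqrt (n₂ x))⁻¹ * ((Real.sqrt (n₂ x))⁻¹ * n₂ x) = 1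
    field_simp
    exact hq₂.symm
  · change G x (T x) ((Real.sqrt (n₂ x))⁻¹ • W' x) = 0
    rw [map_smul, tW', smul_zero]
  · change G x (V x) ((Real.sqrt (n₂ x))⁻¹ • W' x) = 0
    rw [map_smul, vW', smul_zero]

end IsAxialOn

/-! ### Connection coefficients in an adapted frame -/

/-- The table of the connection coefficients `∇_{e_i} e_j = Σ c_{ijk} e_k` of the induced connection
in an orthonormal frame `T, V, W` adapted to the cubic form. -/
def connectionTable {A : Type*} [AddCommGroup A] (a c₁ c₂ p q αV βV αW βW ωT ωV ωW : A) :
    Fin 3 → Fin 3 → Fin 3 → A :=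
  ![![![-(a + a), p, q], ![p, a, ωT], ![q, -ωT, a]],
    ![![0, αV + a, βV], ![αV - a, c₁, ωV + c₂], ![βV, -ωV + c₂, -c₁]],
    ![![0, αW, βW + a], ![αW, c₂, ωW - c₁], ![βW - a, -ωW - c₁, -c₂]]]

/-- An orthonormal frame adapted to the axis, with its connection coefficients. -/
structure AxialFrame (f ξ : R 3 → R 4) (O : Set (R 3)) where
  V : R 3 → R 3
  W : R 3 → R 3
  c₁ : R 3 → ℝ
  c₂ : R 3 → ℝ
  p : R 3 → ℝ
  q : R 3 → ℝ
  αV : R 3 → ℝ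
  βV : R 3 → ℝ
  αW : R 3 → ℝ
  βW : R 3 → ℝ
  ωT : R 3 → ℝ
  ωV : R 3 → ℝ
  ωW : R 3 → ℝ
  isOpen : IsOpen O
  onb : ∀ x ∈ O, IsLorentzONB (affineMetric f ξ x) (axisField f ξ x) (V x) (W x)
  normalForm : ∀ x ∈ O, HasNormalForm (differenceMap f ξ x) (axisField f ξ x) (V x) (W x)
    (axisFun f ξ x) (c₁ x) (c₂ x)
  smooth_V : ∀ x ∈ O, ContDiffAt ℝ ∞ V x
  smooth_W : ∀ x ∈ O, ContDiffAt ℝ ∞ W x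
  smooth_c₁ : ∀ x ∈ O, ContDiffAt ℝ ∞ c₁ x
  smooth_c₂ : ∀ x ∈ O, ContDiffAt ℝ ∞ c₂ x
  smooth_p : ∀ x ∈ O, ContDiffAt ℝ ∞ p x
  smooth_q : ∀ x ∈ O, ContDiffAt ℝ ∞ q x
  smooth_αV : ∀ x ∈ O, ContDiffAt ℝ ∞ αV x
  smooth_βV : ∀ x ∈ O, ContDiffAt ℝ ∞ βV x
  smooth_αW : ∀ x ∈ O, ContDiffAt ℝ ∞ αW x
  smooth_βW : ∀ x ∈ O, ContDiffAt ℝ ∞ βW x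
  smooth_ωT : ∀ x ∈ O, ContDiffAt ℝ ∞ ωT x
  smooth_ωV : ∀ x ∈ O, ContDiffAt ℝ ∞ ωV x
  smooth_ωW : ∀ x ∈ O, ContDiffAt ℝ ∞ ωW x
  nabla_eq : ∀ x ∈ O, ∀ i j : Fin 3,
    nabla f ξ (![axisField f ξ, V, W] i) (![axisField f ξ, V, W] j) x
      = ∑ k, connectionTable (axisFun f ξ x) (c₁ x) (c₂ x) (p x) (q x) (αV x) (βV x) (αW x) (βW x)
          (ωT x) (ωV x) (ωW x) i j k • (![axisField f ξ, V, W] k) x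

/-- The connection ∇ − K preserves h and its coefficients are skew in an orthonormal frame, so α, β,
σ are all that remains unknown. They are the Levi-Civita coefficients; the symmetric part of ∇ is
given by the cubic form C. -/
lemma IsSphereOn.nabla_frame (h : IsSphereOn f ξ H U) {x : R 3} {O : Set (R 3)} (hO : IsOpen O)
    (hOU : O ⊆ U) (hx : x ∈ O) {T V W X : R 3 → R 3} (hT : ContDiffAt ℝ ∞ T x)
    (hV : ContDiffAt ℝ ∞ V x) (hW : ContDiffAt ℝ ∞ W x)
    (ho : ∀ x ∈ O, IsLorentzONB (affineMetric f ξ x) (T x) (V x) (W x)) {C : R 3 → R 3 → ℝ}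
    (hC : ∀ y z, C y z = affineMetric f ξ x (differenceMap f ξ x (X x) y) z) {α β σ : ℝ}
    (hα : α = affineMetric f ξ x (nabla f ξ X T x) (V x) - C (T x) (V x))
    (hβ : β = affineMetric f ξ x (nabla f ξ X T x) (W x) - C (T x) (W x))
    (hσ : σ = affineMetric f ξ x (nabla f ξ X V x) (W x) - C (V x) (W x)) :
    nabla f ξ X T x = (-C (T x) (T x)) • T x + (α + C (T x) (V x)) • V x
        + (β + C (T x) (W x)) • W x ∧
    nabla f ξ X V x = (α - C (T x) (V x)) • T x + (C (V x) (V x)) • V x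
        + (σ + C (V x) (W x)) • W x ∧
    nabla f ξ X W x = (β - C (T x) (W x)) • T x + (-σ + C (V x) (W x)) • V x
        + (C (W x) (W x)) • W x := by
  have hxU := hOU hx
  have hs := h.metric_symm hxU
  have hox := ho x hx
  have key : ∀ {Y Z : R 3 → R 3} {c : ℝ}, ContDiffAt ℝ ∞ Y x → ContDiffAt ℝ ∞ Z x →
      (∀ y ∈ O, affineMetric f ξ y (Y y) (Z y) = c) →
      affineMetric f ξ x (nabla f ξ X Y x) (Z x) + affineMetric f ξ x (nabla f ξ X Z x) (Y x)
        = 2 * C (Y x) (Z x) := by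
    intro Y Z c hY hZ hc
    have e := h.fderiv_metric_apply hxU (X := X) hY hZ
    have : (fun y => affineMetric f ξ y (Y y) (Z y)) =ᶠ[𝓝 x] fun _ => c := by
      filter_upwards [hO.mem_nhds hx] with y hy using hc y hy
    rw [this.fderiv_eq, fderiv_const_apply, zero_apply, ← hC, hs (Y x)] at e
    linarith
  have kTT := key hT hT fun y hy => (ho y hy).tt
  have kTV := key hT hV fun y hy => (ho y hy).tv
  have kTW := key hT hW fun y hy => (ho y hy).tw
  have kVV := key hV hV fun y hy => (ho y hy).vv
  have kVW := key hV hW fun y hy => (ho y hy).vw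
  have kWW := key hW hW fun y hy => (ho y hy).ww
  refine ⟨?_, ?_, ?_⟩
  · rw [hox.decomp hs (nabla f ξ X T x), hs (T x), hs (V x), hs (W x)]
    congr 1
    · congr 1
      · congr 1; linarith
      · congr 1; linarith
    · congr 1; linarith
  · rw [hox.decomp hs (nabla f ξ X V x), hs (T x), hs (V x), hs (W x)]
    congr 1
    · congr 1
      · congr 1; linarith
      · congr 1; linarith
    · congr 1; linarith
  · rw [hox.decomp hs (nabla f ξ X W x), hs (T x), hs (V x), hs (W x)]
    congr 1
    · congr 1
      · congr 1; linarith
      · congr 1; linarith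
    · congr 1; linarith

/-- The connection coefficients of a smooth orthonormal frame containing the axis. -/
def IsAxialOn.frame (h : IsAxialOn f ξ H U) {O : Set (R 3)} (hO : IsOpen O) (hOU : O ⊆ U)
    (V W : R 3 → R 3) (hV : ∀ x ∈ O, ContDiffAt ℝ ∞ V x) (hW : ∀ x ∈ O, ContDiffAt ℝ ∞ W x)
    (ho : ∀ x ∈ O, IsLorentzONB (affineMetric f ξ x) (axisField f ξ x) (V x) (W x)) :
    AxialFrame f ξ O where
  V := V
  W := W
  c₁ x := affineMetric f ξ x (differenceMap f ξ x (V x) (V x)) (V x)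
  c₂ x := affineMetric f ξ x (differenceMap f ξ x (V x) (V x)) (W x)
  p x := affineMetric f ξ x (nabla f ξ (axisField f ξ) (axisField f ξ) x) (V x)
  q x := affineMetric f ξ x (nabla f ξ (axisField f ξ) (axisField f ξ) x) (W x)
  αV x := affineMetric f ξ x (nabla f ξ V (axisField f ξ) x) (V x) - axisFun f ξ x
  βV x := affineMetric f ξ x (nabla f ξ V (axisField f ξ) x) (W x)
  αW x := affineMetric f ξ x (nabla f ξ W (axisField f ξ) x) (V x)
  βW x := affineMetric f ξ x (nabla f ξ W (axisField f ξ) x) (W x) - axisFun f ξ x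
  ωT x := affineMetric f ξ x (nabla f ξ (axisField f ξ) V x) (W x)
  ωV x := affineMetric f ξ x (nabla f ξ V V x) (W x)
    - affineMetric f ξ x (differenceMap f ξ x (V x) (V x)) (W x)
  ωW x := affineMetric f ξ x (nabla f ξ W V x) (W x)
    + affineMetric f ξ x (differenceMap f ξ x (V x) (V x)) (V x)
  isOpen := hO
  onb := ho
  normalForm x hx := (h.isAxis (hOU hx)).hasNormalForm (h.apolar x (hOU hx)) (ho x hx)
  smooth_V := hV
  smooth_W := hW
  smooth_c₁ x hx := ((h.contDiffAt_metric (hOU hx)).clm_apply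
    (((h.contDiffAt_differenceMap (hOU hx)).clm_apply (hV x hx)).clm_apply (hV x hx))).clm_apply
    (hV x hx)
  smooth_c₂ x hx := ((h.contDiffAt_metric (hOU hx)).clm_apply
    (((h.contDiffAt_differenceMap (hOU hx)).clm_apply (hV x hx)).clm_apply (hV x hx))).clm_apply
    (hW x hx)
  smooth_p x hx := ((h.contDiffAt_metric (hOU hx)).clm_apply (h.contDiffAt_nabla (hOU hx)
    (h.contDiffAt_axisField (hOU hx)) (h.contDiffAt_axisField (hOU hx)))).clm_apply (hV x hx)
  smooth_q x hx := ((h.contDiffAt_metric (hOU hx)).clm_apply (h.contDiffAt_nabla (hOU hx)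
    (h.contDiffAt_axisField (hOU hx)) (h.contDiffAt_axisField (hOU hx)))).clm_apply (hW x hx)
  smooth_αV x hx := (((h.contDiffAt_metric (hOU hx)).clm_apply (h.contDiffAt_nabla (hOU hx)
    (hV x hx) (h.contDiffAt_axisField (hOU hx)))).clm_apply (hV x hx)).sub
    (h.contDiffAt_axisFun (hOU hx))
  smooth_βV x hx := ((h.contDiffAt_metric (hOU hx)).clm_apply (h.contDiffAt_nabla (hOU hx)
    (hV x hx) (h.contDiffAt_axisField (hOU hx)))).clm_apply (hW x hx)
  smooth_αW x hx := ((h.contDiffAt_metric (hOU hx)).clm_apply (h.contDiffAt_nabla (hOU hx)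
    (hW x hx) (h.contDiffAt_axisField (hOU hx)))).clm_apply (hV x hx)
  smooth_βW x hx := (((h.contDiffAt_metric (hOU hx)).clm_apply (h.contDiffAt_nabla (hOU hx)
    (hW x hx) (h.contDiffAt_axisField (hOU hx)))).clm_apply (hW x hx)).sub
    (h.contDiffAt_axisFun (hOU hx))
  smooth_ωT x hx := ((h.contDiffAt_metric (hOU hx)).clm_apply (h.contDiffAt_nabla (hOU hx)
    (h.contDiffAt_axisField (hOU hx)) (hV x hx))).clm_apply (hW x hx)
  smooth_ωV x hx := (((h.contDiffAt_metric (hOU hx)).clm_apply (h.contDiffAt_nabla (hOU hx)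
    (hV x hx) (hV x hx))).clm_apply (hW x hx)).sub (((h.contDiffAt_metric (hOU hx)).clm_apply
    (((h.contDiffAt_differenceMap (hOU hx)).clm_apply (hV x hx)).clm_apply (hV x hx))).clm_apply
    (hW x hx))
  smooth_ωW x hx := (((h.contDiffAt_metric (hOU hx)).clm_apply (h.contDiffAt_nabla (hOU hx)
    (hW x hx) (hV x hx))).clm_apply (hW x hx)).add (((h.contDiffAt_metric (hOU hx)).clm_apply
    (((h.contDiffAt_differenceMap (hOU hx)).clm_apply (hV x hx)).clm_apply (hV x hx))).clm_apply
    (hV x hx))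
  nabla_eq x hx := by
    have hK := h.apolar x (hOU hx)
    have hN := (h.isAxis (hOU hx)).hasNormalForm hK (ho x hx)
    have hox := ho x hx
    have hs := h.metric_symm (hOU hx)
    have cT := h.contDiffAt_axisField (hOU hx)
    have sVT := (hs (V x) (axisField f ξ x)).trans hox.tv
    have sWT := (hs (W x) (axisField f ξ x)).trans hox.tw
    have sWV := (hs (W x) (V x)).trans hox.vw
    generalize affineMetric f ξ x (differenceMap f ξ x (V x) (V x)) (V x) = c₁ at hN ⊢
    generalize affineMetric f ξ x (differenceMap f ξ x (V x) (V x)) (W x) = c₂ at hN ⊢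
    have VT := (hK.K_symm (V x) (axisField f ξ x)).trans hN.TV
    have WT := (hK.K_symm (W x) (axisField f ξ x)).trans hN.TW
    have WV := (hK.K_symm (W x) (V x)).trans hN.VW
    obtain ⟨TT, TV, TW⟩ := h.nabla_frame hO hOU hx (X := axisField f ξ) cT (hV x hx) (hW x hx) ho
      (fun _ _ => rfl) rfl rfl rfl
    obtain ⟨VT', VV, VW⟩ := h.nabla_frame hO hOU hx (X := V) cT (hV x hx) (hW x hx) ho
      (fun _ _ => rfl) rfl rfl rfl
    obtain ⟨WT', WV', WW⟩ := h.nabla_frame hO hOU hx (X := W) cT (hV x hx) (hW x hx) ho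
      (fun _ _ => rfl) rfl rfl rfl
    simp only [hN.TT, hN.TV, hN.TW, hN.VV, hN.VW, hN.WW, VT, WT, WV, map_add, map_smul, add_apply,
      smul_apply, smul_eq_mul, hox.tt, hox.vv, hox.ww, hox.tv, hox.tw, hox.vw, sVT, sWT, sWV]
      at TT TV TW VT' VV VW WT' WV' WW
    intro i j
    fin_cases i <;> fin_cases j <;> simp only [connectionTable, Fin.sum_univ_three, Fin.zero_eta,
      Fin.mk_one, Fin.reduceFinMk, Matrix.cons_val]
    · refine TT.trans ?_; module
    · refine TV.trans ?_; module
    · refine TW.trans ?_; module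
    · refine VT'.trans ?_; module
    · refine VV.trans ?_; module
    · refine VW.trans ?_; module
    · refine WT'.trans ?_; module
    · refine WV'.trans ?_; module
    · refine WW.trans ?_; module

end

section

/-! ### Gauss and Codazzi equations in an adapted frame -/

variable {f ξ : R 3 → R 4} {U O : Set (R 3)} {H : ℝ}

namespace AxialFrame

/-- The frame as a family of vector fields. -/
def vec (F : AxialFrame f ξ O) (i : Fin 3) : R 3 → R 3 := ![axisField f ξ, F.V, F.W] i

/-- The connection coefficients. -/
def coeff (F : AxialFrame f ξ O) (x : R 3) : Fin 3 → Fin 3 → Fin 3 → ℝ :=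
  connectionTable (axisFun f ξ x) (F.c₁ x) (F.c₂ x) (F.p x) (F.q x) (F.αV x) (F.βV x) (F.αW x)
    (F.βW x) (F.ωT x) (F.ωV x) (F.ωW x)

/-- The derivatives of the connection coefficients in the direction `u`. -/
def derivCoeff (F : AxialFrame f ξ O) (x u : R 3) : Fin 3 → Fin 3 → Fin 3 → ℝ :=
  connectionTable (fderiv ℝ (axisFun f ξ) x u) (fderiv ℝ F.c₁ x u) (fderiv ℝ F.c₂ x u)
    (fderiv ℝ F.p x u) (fderiv ℝ F.q x u) (fderiv ℝ F.αV x u) (fderiv ℝ F.βV x u)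
    (fderiv ℝ F.αW x u) (fderiv ℝ F.βW x u) (fderiv ℝ F.ωT x u) (fderiv ℝ F.ωV x u)
    (fderiv ℝ F.ωW x u)

lemma differentiableAt_coeff (F : AxialFrame f ξ O) (h : IsAxialOn f ξ H O) {x : R 3} (hx : x ∈ O)
    (i j k : Fin 3) : DifferentiableAt ℝ (fun y => F.coeff y i j k) x ∧
      ∀ u, fderiv ℝ (fun y => F.coeff y i j k) x u = F.derivCoeff x u i j k := by
  have da := (h.contDiffAt_axisFun hx).differentiableAt (by simp)
  have d1 := (F.smooth_c₁ x hx).differentiableAt (by simp)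
  have d2 := (F.smooth_c₂ x hx).differentiableAt (by simp)
  have d3 := (F.smooth_p x hx).differentiableAt (by simp)
  have d4 := (F.smooth_q x hx).differentiableAt (by simp)
  have d5 := (F.smooth_αV x hx).differentiableAt (by simp)
  have d6 := (F.smooth_βV x hx).differentiableAt (by simp)
  have d7 := (F.smooth_αW x hx).differentiableAt (by simp)
  have d8 := (F.smooth_βW x hx).differentiableAt (by simp)
  have d9 := (F.smooth_ωT x hx).differentiableAt (by simp)
  have d10 := (F.smooth_ωV x hx).differentiableAt (by simp)
  have d11 := (F.smooth_ωW x hx).differentiableAt (by simp)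
  have key : ∀ {g : R 3 → ℝ} {g' : R 3 →L[ℝ] ℝ} {d : R 3 → ℝ}, HasFDerivAt g g' x →
      (∀ u, g' u = d u) → DifferentiableAt ℝ g x ∧ ∀ u, fderiv ℝ g x u = d u := by
    intro g g' d h1 h2
    exact ⟨h1.differentiableAt, fun u => by rw [h1.fderiv, h2]⟩
  have a0 := da.hasFDerivAt
  have a1 := d1.hasFDerivAt
  have a2 := d2.hasFDerivAt
  have a3 := d3.hasFDerivAt
  have a4 := d4.hasFDerivAt
  have a5 := d5.hasFDerivAt
  have a6 := d6.hasFDerivAt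
  have a7 := d7.hasFDerivAt
  have a8 := d8.hasFDerivAt
  have a9 := d9.hasFDerivAt
  have a10 := d10.hasFDerivAt
  have a11 := d11.hasFDerivAt
  -- The table is additive in its entries, so its derivative is the same table filled with the
  -- derivatives.
  unfold coeff derivCoeff connectionTable
  fin_cases i <;> fin_cases j <;> fin_cases k
  · exact key (a0.add a0).neg fun u => rfl
  · exact key a3 fun u => rfl
  · exact key a4 fun u => rfl
  · exact key a3 fun u => rfl
  · exact key a0 fun u => rfl
  · exact key a9 fun u => rfl
  · exact key a4 fun u => rfl
  · exact key a9.neg fun u => rfl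
  · exact key a0 fun u => rfl
  · exact key (hasFDerivAt_const (0 : ℝ) x) fun u => rfl
  · exact key (a5.add a0) fun u => rfl
  · exact key a6 fun u => rfl
  · exact key (a5.sub a0) fun u => rfl
  · exact key a1 fun u => rfl
  · exact key (a10.add a2) fun u => rfl
  · exact key a6 fun u => rfl
  · exact key (a10.neg.add a2) fun u => rfl
  · exact key a1.neg fun u => rfl
  · exact key (hasFDerivAt_const (0 : ℝ) x) fun u => rfl
  · exact key a7 fun u => rfl
  · exact key (a8.add a0) fun u => rfl
  · exact key a7 fun u => rfl
  · exact key a2 fun u => rfl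
  · exact key (a11.sub a1) fun u => rfl
  · exact key (a8.sub a0) fun u => rfl
  · exact key (a11.neg.sub a1) fun u => rfl
  · exact key a2.neg fun u => rfl

lemma contDiffAt_vec (F : AxialFrame f ξ O) (h : IsAxialOn f ξ H O) {x : R 3} (hx : x ∈ O)
    (i : Fin 3) : ContDiffAt ℝ ∞ (F.vec i) x := by
  fin_cases i
  exacts [h.contDiffAt_axisField hx, F.smooth_V x hx, F.smooth_W x hx]

lemma metric_vec (F : AxialFrame f ξ O) (h : IsAxialOn f ξ H O) {x : R 3} (hx : x ∈ O)
    (i j : Fin 3) : affineMetric f ξ x (F.vec i x) (F.vec j x)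
      = ![![-1, 0, 0], ![0, 1, 0], ![0, 0, 1]] i j := by
  have ho := F.onb x hx
  have hs := h.metric_symm hx
  fin_cases i <;> fin_cases j
  exacts [ho.tt, ho.tv, ho.tw, (hs _ _).trans ho.tv, ho.vv, ho.vw, (hs _ _).trans ho.tw,
    (hs _ _).trans ho.vw, ho.ww]

/-- The structure equations of the flat ambient connection in an adapted frame. -/
theorem structure_equation (F : AxialFrame f ξ O) (h : IsAxialOn f ξ H O) {x : R 3} (hx : x ∈ O)
    (i j k l : Fin 3) :
    F.derivCoeff x (F.vec i x) j k l - F.derivCoeff x (F.vec j x) i k l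
      + ∑ m, (F.coeff x j k m * F.coeff x i m l - F.coeff x i k m * F.coeff x j m l)
      - ∑ m, (F.coeff x i j m - F.coeff x j i m) * F.coeff x m k l
    = H * ((![![-1, 0, 0], ![0, 1, 0], ![0, 0, 1]] : Fin 3 → Fin 3 → ℝ) j k * (if l = i then 1 else 0)
      - (![![-1, 0, 0], ![0, 1, 0], ![0, 0, 1]] : Fin 3 → Fin 3 → ℝ) i k
        * (if l = j then 1 else 0)) := by
  have hv : ∀ i, ContDiffAt ℝ ∞ (F.vec i) x := F.contDiffAt_vec h hx
  have hn : ∀ y ∈ O, ∀ i j, nabla f ξ (F.vec i) (F.vec j) y = ∑ m, F.coeff y i j m • F.vec m y :=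
    fun y hy i j => F.nabla_eq y hy i j
  have hn2 : ∀ i j k, nabla f ξ (F.vec i) (nabla f ξ (F.vec j) (F.vec k)) x
      = ∑ m, (F.derivCoeff x (F.vec i x) j k m + ∑ r, F.coeff x j k r * F.coeff x i r m)
          • F.vec m x := by
    intro i j k
    have e : nabla f ξ (F.vec j) (F.vec k) =ᶠ[𝓝 x] fun y => ∑ m, F.coeff y j k m • F.vec m y := by
      filter_upwards [h.isOpen.mem_nhds hx] with y hy using hn y hy j k
    have e' : fderiv ℝ (fun y => ∑ m, F.coeff y j k m • F.vec m y) x (F.vec i x)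
        = ∑ m, (F.coeff x j k m • fderiv ℝ (F.vec m) x (F.vec i x)
          + F.derivCoeff x (F.vec i x) j k m • F.vec m x) := by
      rw [fderiv_fun_sum fun m _ => (F.differentiableAt_coeff h hx j k m).1.fun_smul
        ((hv m).differentiableAt (by simp)), sum_apply]
      refine Finset.sum_congr rfl fun m _ => ?_
      rw [fderiv_fun_smul (F.differentiableAt_coeff h hx j k m).1
        ((hv m).differentiableAt (by simp))]
      simp [(F.differentiableAt_coeff h hx j k m).2]
    have e2 : nabla f ξ (F.vec i) (nabla f ξ (F.vec j) (F.vec k)) x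
        = ∑ m, (F.coeff x j k m • nabla f ξ (F.vec i) (F.vec m) x
          + F.derivCoeff x (F.vec i x) j k m • F.vec m x) := by
      rw [nabla, e.fderiv_eq, e.eq_of_nhds, e']
      simp only [nabla, map_sum, map_smul, smul_add, Finset.sum_add_distrib]
      abel
    rw [e2]
    simp only [hn x hx, Finset.smul_sum, smul_smul, Finset.sum_add_distrib, add_smul,
      Finset.sum_smul]
    rw [Finset.sum_comm, add_comm]
  have hc := h.curvature hx (hv i) (hv j) (hv k)
  have hbr : nabla f ξ (fun y => nabla f ξ (F.vec i) (F.vec j) y - nabla f ξ (F.vec j) (F.vec i) y)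
      (F.vec k) x
      = ∑ m, (∑ r, (F.coeff x i j r - F.coeff x j i r) * F.coeff x r k m) • F.vec m x := by
    have : nabla f ξ (fun y => nabla f ξ (F.vec i) (F.vec j) y - nabla f ξ (F.vec j) (F.vec i) y)
        (F.vec k) x = ∑ r, (F.coeff x i j r - F.coeff x j i r) • nabla f ξ (F.vec r) (F.vec k) x := by
      simp only [nabla.eq_def f ξ (fun y => nabla f ξ (F.vec i) (F.vec j) y
        - nabla f ξ (F.vec j) (F.vec i) y), hn x hx i j, hn x hx j i]
      rw [← Finset.sum_sub_distrib]
      simp only [← sub_smul, map_sum, map_smul, sum_apply, smul_apply, ← Finset.sum_add_distrib,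
        ← smul_add]
      rfl
    rw [this]
    simp only [hn x hx, Finset.smul_sum, smul_smul, Finset.sum_smul]
    rw [Finset.sum_comm]
  rw [hn2, hn2, hbr, F.metric_vec h hx, F.metric_vec h hx] at hc
  have hli : LinearIndependent ℝ fun m => F.vec m x := by
    convert (F.onb x hx).linearIndependent (h.metric_symm hx) using 1
    ext m : 1
    fin_cases m <;> rfl
  rw [← sub_eq_zero] at hc
  have hc' : ∑ m, ((F.derivCoeff x (F.vec i x) j k m + ∑ r, F.coeff x j k r * F.coeff x i r m)
      - (F.derivCoeff x (F.vec j x) i k m + ∑ r, F.coeff x i k r * F.coeff x j r m)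
      - (∑ r, (F.coeff x i j r - F.coeff x j i r) * F.coeff x r k m)
      - H * ((![![-1, 0, 0], ![0, 1, 0], ![0, 0, 1]] : Fin 3 → Fin 3 → ℝ) j k * (if m = i then 1 else 0)
      - (![![-1, 0, 0], ![0, 1, 0], ![0, 0, 1]] : Fin 3 → Fin 3 → ℝ) i k
        * (if m = j then 1 else 0))) • F.vec m x = 0 := by
    rw [← hc]
    simp only [sub_smul, add_smul, Finset.sum_sub_distrib, mul_sub, Finset.sum_add_distrib,
      mul_ite, mul_one, mul_zero, ite_smul, zero_smul, Finset.sum_ite_eq', Finset.mem_univ, if_true,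
      smul_sub, smul_smul]
  have := Fintype.linearIndependent_iff.1 hli _ hc' l
  rw [Finset.sum_sub_distrib]
  linarith

/-- The T-components of R(T, V)T and R(T, W)T: the derivatives of a across the axis are controlled
by the acceleration (p, q) of the axis field. -/
lemma fderiv_axisFun_vec (F : AxialFrame f ξ O) (h : IsAxialOn f ξ H O) {x : R 3} (hx : x ∈ O) :
    fderiv ℝ (axisFun f ξ) x (F.vec 1 x) = -(2 * (axisFun f ξ x * F.p x)) ∧
    fderiv ℝ (axisFun f ξ) x (F.vec 2 x) = -(2 * (axisFun f ξ x * F.q x)) := by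
  have e0100 := F.structure_equation h hx 0 1 0 0
  have e0200 := F.structure_equation h hx 0 2 0 0
  simp [coeff, derivCoeff, connectionTable, Fin.sum_univ_three] at e0100 e0200
  refine ⟨?_, ?_⟩
  · linear_combination e0100 / 2
  · linear_combination e0200 / 2

/-- Codazzi equations, isolated as the metrically symmetric part of the structure equations: there
the Levi-Civita curvature and the commutators of K drop out. They express the derivative of T along
T^⊥ by p, q, c₁, c₂ and T(a), and give a second formula for V(a) and W(a). -/
lemma shape_equations (F : AxialFrame f ξ O) (h : IsAxialOn f ξ H O) {x : R 3} (hx : x ∈ O) :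
    axisFun f ξ x * F.αW x = axisFun f ξ x * F.βV x ∧
    4 * (axisFun f ξ x * F.αV x) = F.c₁ x * F.p x + F.c₂ x * F.q x - fderiv ℝ (axisFun f ξ) x (F.vec 0 x) ∧
    4 * (axisFun f ξ x * F.βW x) = -(F.c₁ x * F.p x + F.c₂ x * F.q x) - fderiv ℝ (axisFun f ξ) x (F.vec 0 x) ∧
    4 * (axisFun f ξ x * F.βV x) = F.c₂ x * F.p x - F.c₁ x * F.q x ∧
    fderiv ℝ (axisFun f ξ) x (F.vec 1 x) = F.βW x * F.c₁ x - F.βV x * F.c₂ x - F.αV x * F.c₁ x - F.αW x * F.c₂ x ∧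
    fderiv ℝ (axisFun f ξ) x (F.vec 2 x) = F.βW x * F.c₂ x + F.βV x * F.c₁ x + F.αW x * F.c₁ x - F.αV x * F.c₂ x := by
  have e1200 := F.structure_equation h hx 1 2 0 0
  have e0101 := F.structure_equation h hx 0 1 0 1
  have e0110 := F.structure_equation h hx 0 1 1 0
  have e0202 := F.structure_equation h hx 0 2 0 2
  have e0220 := F.structure_equation h hx 0 2 2 0
  have e0102 := F.structure_equation h hx 0 1 0 2
  have e0120 := F.structure_equation h hx 0 1 2 0
  have e1220 := F.structure_equation h hx 1 2 2 0
  have e1202 := F.structure_equation h hx 1 2 0 2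
  have e1210 := F.structure_equation h hx 1 2 1 0
  have e1201 := F.structure_equation h hx 1 2 0 1
  simp [coeff, derivCoeff, connectionTable, Fin.sum_univ_three] at e1200 e0101 e0110 e0202 e0220 e0102 e0120 e1220 e1202 e1210 e1201
  refine ⟨?_, ?_, ?_, ?_, ?_, ?_⟩
  · linear_combination -e1200 / 4
  · linear_combination (e0101 - e0110) / 2
  · linear_combination (e0202 - e0220) / 2
  · linear_combination (e0102 - e0120) / 2
  · linear_combination (e1202 - e1220) / 2
  · linear_combination (e1210 - e1201) / 2

/-- The remaining Codazzi equations, which govern the derivatives of c₁ and c₂. -/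
lemma cubic_equations (F : AxialFrame f ξ O) (h : IsAxialOn f ξ H O) {x : R 3} (hx : x ∈ O) :
    fderiv ℝ F.c₁ x (F.vec 0 x) - fderiv ℝ (axisFun f ξ) x (F.vec 1 x) = 3 * (axisFun f ξ x * F.p x) - F.βV x * F.c₂ x - F.αV x * F.c₁ x + 3 * (F.c₂ x * F.ωT x) ∧
    fderiv ℝ F.c₂ x (F.vec 0 x) - fderiv ℝ (axisFun f ξ) x (F.vec 2 x) = axisFun f ξ x * F.q x - F.βW x * F.c₂ x - F.αW x * F.c₁ x - 3 * (F.c₁ x * F.ωT x) ∧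
    fderiv ℝ F.c₁ x (F.vec 2 x) - fderiv ℝ F.c₂ x (F.vec 1 x) = 3 * (axisFun f ξ x * F.βV x) - axisFun f ξ x * F.αW x + 3 * (F.ωW x * F.c₂ x) + 3 * (F.c₁ x * F.ωV x) ∧
    fderiv ℝ F.c₁ x (F.vec 1 x) + fderiv ℝ F.c₂ x (F.vec 2 x) = axisFun f ξ x * F.βW x - axisFun f ξ x * F.αV x - 3 * (F.ωW x * F.c₁ x) + 3 * (F.ωV x * F.c₂ x) := by
  have e0111 := F.structure_equation h hx 0 1 1 1
  have e0211 := F.structure_equation h hx 0 2 1 1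
  have e1222 := F.structure_equation h hx 1 2 2 2
  have e1212 := F.structure_equation h hx 1 2 1 2
  have e1221 := F.structure_equation h hx 1 2 2 1
  simp [coeff, derivCoeff, connectionTable, Fin.sum_univ_three] at e0111 e0211 e1222 e1212 e1221
  refine ⟨?_, ?_, ?_, ?_⟩
  · linear_combination e0111
  · linear_combination e0211
  · linear_combination e1222
  · linear_combination -(e1212 + e1221) / 2

/-- The metrically skew part of the structure equations: the Levi-Civita curvature expressed by H
and quadratic terms in K. -/
lemma gauss_equations (F : AxialFrame f ξ O) (h : IsAxialOn f ξ H O) {x : R 3} (hx : x ∈ O) :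
    fderiv ℝ F.αV x (F.vec 0 x) - fderiv ℝ F.p x (F.vec 1 x) = H - 3 * axisFun f ξ x ^ 2 - F.αV x ^ 2 - F.βV x * F.αW x + F.βV x * F.ωT x + F.αW x * F.ωT x - F.ωV x * F.q x + F.p x ^ 2 ∧
    fderiv ℝ F.βW x (F.vec 0 x) - fderiv ℝ F.q x (F.vec 2 x) = H - 3 * axisFun f ξ x ^ 2 - F.βW x ^ 2 - F.βV x * F.αW x - F.βV x * F.ωT x - F.αW x * F.ωT x + F.ωW x * F.p x + F.q x ^ 2 ∧
    fderiv ℝ F.ωV x (F.vec 2 x) - fderiv ℝ F.ωW x (F.vec 1 x) = H + axisFun f ξ x ^ 2 - F.βW x * F.αV x + F.βV x * F.αW x - F.βV x * F.ωT x + F.αW x * F.ωT x + 2 * F.c₁ x ^ 2 + 2 * F.c₂ x ^ 2 + F.ωV x ^ 2 + F.ωW x ^ 2 ∧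
    fderiv ℝ F.βW x (F.vec 1 x) - fderiv ℝ F.βV x (F.vec 2 x) = F.βV x * F.q x - F.βW x * F.ωW x - F.βV x * F.ωV x + F.ωW x * F.αV x - F.ωV x * F.αW x - F.αW x * F.q x ∧
    fderiv ℝ F.αV x (F.vec 2 x) - fderiv ℝ F.αW x (F.vec 1 x) = F.βV x * F.ωW x - F.βW x * F.ωV x - F.βV x * F.p x + F.ωW x * F.αW x + F.ωV x * F.αV x + F.αW x * F.p x := by
  have e0101 := F.structure_equation h hx 0 1 0 1
  have e0110 := F.structure_equation h hx 0 1 1 0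
  have e0202 := F.structure_equation h hx 0 2 0 2
  have e0220 := F.structure_equation h hx 0 2 2 0
  have e1221 := F.structure_equation h hx 1 2 2 1
  have e1212 := F.structure_equation h hx 1 2 1 2
  have e1202 := F.structure_equation h hx 1 2 0 2
  have e1220 := F.structure_equation h hx 1 2 2 0
  have e1201 := F.structure_equation h hx 1 2 0 1
  have e1210 := F.structure_equation h hx 1 2 1 0
  simp [coeff, derivCoeff, connectionTable, Fin.sum_univ_three] at e0101 e0110 e0202 e0220 e1221 e1212 e1202 e1220 e1201 e1210
  refine ⟨?_, ?_, ?_, ?_, ?_⟩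
  · linear_combination (e0101 + e0110) / 2
  · linear_combination (e0202 + e0220) / 2
  · linear_combination (e1221 - e1212) / 2
  · linear_combination (e1202 + e1220) / 2
  · linear_combination -(e1201 + e1210) / 2

/-- The acceleration of the axis field vanishes unless `c₁² + c₂² = 4 a²`. -/
lemma acceleration_eq_zero (F : AxialFrame f ξ O) (h : IsAxialOn f ξ H O) {x : R 3} (hx : x ∈ O)
    (hc : F.c₁ x ^ 2 + F.c₂ x ^ 2 ≠ 4 * axisFun f ξ x ^ 2) : F.p x = 0 ∧ F.q x = 0 := by
  obtain ⟨h1, h2⟩ := F.fderiv_axisFun_vec h hx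
  obtain ⟨s1, s2, s3, s4, s5, s6⟩ := F.shape_equations h hx
  have ha := (h.isAxis hx).pos.ne'
  have s1' := mul_left_cancel₀ ha s1
  have hc' := sub_ne_zero.2 hc
  -- Equating the two formulas for V(a), and likewise for W(a), and eliminating the shape
  -- coefficients leaves a scalar multiple of p, respectively q.
  rw [s1'] at s5 s6
  constructor
  · refine (mul_eq_zero.1 (?_ : (F.c₁ x ^ 2 + F.c₂ x ^ 2 - 4 * axisFun f ξ x ^ 2) * F.p x = 0)).resolve_left
      hc'
    linear_combination (2 * axisFun f ξ x) * (s5 - h1) - (F.c₁ x / 2) * (s2 - s3) - F.c₂ x * s4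
  · refine (mul_eq_zero.1 (?_ : (F.c₁ x ^ 2 + F.c₂ x ^ 2 - 4 * axisFun f ξ x ^ 2) * F.q x = 0)).resolve_left
      hc'
    linear_combination (2 * axisFun f ξ x) * (s6 - h2) - (F.c₂ x / 2) * (s2 - s3) + F.c₁ x * s4

/-- The exceptional cubic form `c₁ = 2 a`, `c₂ = 0` does not occur on open sets. -/
lemma exceptional_false (F : AxialFrame f ξ O) (h : IsAxialOn f ξ H O) {x : R 3} (hx : x ∈ O)
    (h₁ : ∀ y ∈ O, F.c₁ y = 2 * axisFun f ξ y) (h₂ : ∀ y ∈ O, F.c₂ y = 0) : False := by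
  have hO := fun {y : R 3} (hy : y ∈ O) => h.isOpen.mem_nhds hy
  -- With c₁ = 2a and c₂ = 0 the Codazzi equations determine every connection coefficient from p and
  -- q.
  have key : ∀ y ∈ O, F.αV y = (1 / 2) * F.p y ∧ F.βV y = -(1 / 2) * F.q y ∧
      F.αW y = -(1 / 2) * F.q y ∧ F.βW y = -(1 / 2) * F.p y ∧ F.ωT y = 0 ∧
      F.ωV y = -(1 / 2) * F.q y ∧ F.ωW y = (1 / 2) * F.p y := by
    intro y hy
    have ha := (h.isAxis hy).pos.ne'
    have d1 : fderiv ℝ F.c₁ y = (2 : ℝ) • fderiv ℝ (axisFun f ξ) y := by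
      have : F.c₁ =ᶠ[𝓝 y] fun z => (2 : ℝ) • axisFun f ξ z := by
        filter_upwards [hO hy] with z hz using h₁ z hz
      rw [this.fderiv_eq]
      exact fderiv_fun_const_smul ((h.contDiffAt_axisFun hy).differentiableAt (by simp)) _
    have d2 : fderiv ℝ F.c₂ y = 0 := by
      have : F.c₂ =ᶠ[𝓝 y] fun z => (0 : ℝ) := by
        filter_upwards [hO hy] with z hz using h₂ z hz
      rw [this.fderiv_eq, fderiv_fun_const, Pi.zero_apply]
    obtain ⟨a1, a2⟩ := F.fderiv_axisFun_vec h hy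
    obtain ⟨s1, s2, s3, s4, s5, s6⟩ := F.shape_equations h hy
    obtain ⟨k1, k2, k3, k4⟩ := F.cubic_equations h hy
    simp only [d1, d2, h₁ y hy, h₂ y hy, smul_apply, zero_apply, smul_eq_mul] at s2 s3 s4 k1 k2 k3 k4
    have s1' := mul_left_cancel₀ ha s1
    have a0 : fderiv ℝ (axisFun f ξ) y (F.vec 0 y) = 0 := by
      linear_combination (2 / 3) * k1 + (2 / 3) * a1 - s2 / 3
    have e1 : F.αV y = (1 / 2) * F.p y := mul_left_cancel₀ ha (by linear_combination s2 / 4 - a0 / 4)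
    have e2 : F.βV y = -(1 / 2) * F.q y := mul_left_cancel₀ ha (by linear_combination s4 / 4)
    have e3 : F.αW y = -(1 / 2) * F.q y := s1'.trans e2
    have e4 : F.βW y = -(1 / 2) * F.p y := mul_left_cancel₀ ha (by linear_combination s3 / 4 - a0 / 4)
    rw [e3, e2] at k3
    rw [e3] at k2
    rw [e4, e1] at k4
    refine ⟨e1, e2, e3, e4, mul_left_cancel₀ ha ?_, mul_left_cancel₀ ha ?_, mul_left_cancel₀ ha ?_⟩
    · linear_combination k2 / 6 + a2 / 6
    · linear_combination -k3 / 6 + a2 / 3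
    · linear_combination k4 / 6 - a1 / 3
  have dmul : ∀ {g k : R 3 → ℝ} {c : ℝ}, (∀ y ∈ O, g y = c * k y) → ContDiffAt ℝ ∞ k x →
      fderiv ℝ g x = c • fderiv ℝ k x := by
    intro g k c hg hk
    have : g =ᶠ[𝓝 x] fun z => c • k z := by
      filter_upwards [hO hx] with z hz using hg z hz
    rw [this.fderiv_eq]
    exact fderiv_fun_const_smul (hk.differentiableAt (by simp)) _
  have hp := F.smooth_p x hx
  have hq := F.smooth_q x hx
  obtain ⟨g1, g2, g3, -, -⟩ := F.gauss_equations h hx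
  obtain ⟨e1, e2, e3, e4, e5, e6, e7⟩ := key x hx
  rw [dmul (fun y hy => (key y hy).1) hp] at g1
  rw [dmul (fun y hy => (key y hy).2.2.2.1) hp] at g2
  rw [dmul (fun y hy => (key y hy).2.2.2.2.2.1) hq, dmul (fun y hy => (key y hy).2.2.2.2.2.2) hp] at g3
  simp only [e1, e2, e3, e4, e5, e6, e7, h₁ x hx, h₂ x hx, smul_apply, smul_eq_mul] at g1 g2 g3
  have ha := (h.isAxis hx).pos
  -- In the sum of the first two Gauss equations minus twice the third, all derivatives of p and q
  -- and all their squares cancel, as does H, leaving −24a² = 0.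
  have : axisFun f ξ x ^ 2 = 0 := by linear_combination (1 / 24) * (g1 + g2 - 2 * g3)
  exact ha.ne' (pow_eq_zero_iff two_ne_zero |>.1 this)

/-- The connection of an axial frame whose axis field is geodesic. -/
lemma umbilic (F : AxialFrame f ξ O) (h : IsAxialOn f ξ H O) {x : R 3} (hx : x ∈ O)
    (hp : F.p x = 0) (hq : F.q x = 0) :
    F.αV x = -(fderiv ℝ (axisFun f ξ) x (axisField f ξ x) / (4 * axisFun f ξ x)) ∧
    F.βW x = -(fderiv ℝ (axisFun f ξ) x (axisField f ξ x) / (4 * axisFun f ξ x)) ∧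
    F.βV x = 0 ∧ F.αW x = 0 := by
  obtain ⟨s1, s2, s3, s4, s5, s6⟩ := F.shape_equations h hx
  have ha := (h.isAxis hx).pos.ne'
  change _ = _ - fderiv ℝ (axisFun f ξ) x (axisField f ξ x) at s2 s3
  rw [hp, hq] at s2 s3 s4
  have e : F.βV x = 0 := mul_left_cancel₀ ha (by linear_combination s4 / 4)
  refine ⟨?_, ?_, e, (mul_left_cancel₀ ha s1).trans e⟩
  · field_simp; linear_combination s2
  · field_simp; linear_combination s3

end AxialFrame

end

section

/-! ### The axis field is geodesic -/

/-- Dividing by u(x₀) moves the value at x₀ to 1, where the principal logarithm is smooth. The root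
serves to rotate V, W, under which c₁ + ic₂ has weight three. -/
lemma exists_contDiffAt_cube_root {E : Type*} [NormedAddCommGroup E] [NormedSpace ℝ E] {u : E → ℂ}
    {S : Set E} (hS : IsOpen S) {x₀ : E} (hx₀ : x₀ ∈ S) (hu : ∀ x ∈ S, ContDiffAt ℝ ∞ u x)
    (h0 : u x₀ ≠ 0) : ∃ (O : Set E) (r : E → ℂ), IsOpen O ∧ x₀ ∈ O ∧ O ⊆ S ∧
      (∀ x ∈ O, ContDiffAt ℝ ∞ r x) ∧ ∀ x ∈ O, r x ^ 3 = u x := by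
  obtain ⟨r₀, hr₀⟩ := IsAlgClosed.exists_pow_nat_eq (u x₀) (n := 3) (by norm_num)
  have hev : ∀ᶠ x in 𝓝 x₀, x ∈ S ∧ u x * (u x₀)⁻¹ ∈ Complex.slitPlane := by
    refine Filter.Eventually.and (hS.mem_nhds hx₀) ?_
    refine ((hu x₀ hx₀).continuousAt.mul continuousAt_const).preimage_mem_nhds
      (Complex.isOpen_slitPlane.mem_nhds ?_)
    change u x₀ * (u x₀)⁻¹ ∈ _
    rw [mul_inv_cancel₀ h0]
    exact Complex.one_mem_slitPlane
  obtain ⟨O, hOs, hO, hxO⟩ := mem_nhds_iff.1 hev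
  refine ⟨O, fun x => r₀ * Complex.exp (Complex.log (u x * (u x₀)⁻¹) * 3⁻¹), hO, hxO,
    fun x hx => (hOs hx).1, fun x hx => ?_, fun x hx => ?_⟩
  · have h1 := (Complex.contDiffAt_log (n := ∞) (hOs hx).2).restrict_scalars ℝ
    have h2 : ContDiffAt ℝ ∞ (fun x => u x * (u x₀)⁻¹) x := (hu x (hOs hx).1).mul contDiffAt_const
    exact contDiffAt_const.mul
      (((h1.comp x h2).mul contDiffAt_const).cexp)
  · rw [mul_pow, ← Complex.exp_nat_mul, hr₀]
    have : ((3 : ℕ) : ℂ) * (Complex.log (u x * (u x₀)⁻¹) * 3⁻¹) = Complex.log (u x * (u x₀)⁻¹) := by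
      push_cast; ring
    rw [this, Complex.exp_log (Complex.slitPlane_ne_zero (hOs hx).2)]
    field_simp

variable {f ξ : R 3 → R 4} {U O : Set (R 3)} {H : ℝ}

/-- Rotating V, W by r = r₁ + ir₂ multiplies c₁ + ic₂ by the cube of the conjugate of r when |r| =
1. -/
lemma HasNormalForm.rotate {g : R 3 →L[ℝ] R 3 →L[ℝ] ℝ} {K : R 3 →L[ℝ] R 3 →L[ℝ] R 3} {T V W : R 3}
    {a c₁ c₂ : ℝ} (h : HasNormalForm K T V W a c₁ c₂) (hK : IsApolar g K)
    (ho : IsLorentzONB g T V W) {r₁ r₂ : ℝ} :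
    g (K (r₁ • V + r₂ • W) (r₁ • V + r₂ • W)) (r₁ • V + r₂ • W)
      = c₁ * (r₁ ^ 3 - 3 * r₁ * r₂ ^ 2) + c₂ * (3 * r₁ ^ 2 * r₂ - r₂ ^ 3) ∧
    g (K (r₁ • V + r₂ • W) (r₁ • V + r₂ • W)) ((-r₂) • V + r₁ • W)
      = c₂ * (r₁ ^ 3 - 3 * r₁ * r₂ ^ 2) - c₁ * (3 * r₁ ^ 2 * r₂ - r₂ ^ 3) := by
  have WV := (hK.K_symm W V).trans h.VW
  have sWV := (hK.symm W V).trans ho.vw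
  constructor <;>
  · simp only [map_add, map_smul, add_apply, smul_apply, h.VV, h.VW, h.WW, WV, ho.tv, ho.tw, ho.vv,
      ho.vw, ho.ww, sWV, smul_eq_mul]
    ring

lemma IsLorentzONB.rotate {g : R 3 →L[ℝ] R 3 →L[ℝ] ℝ} {T V W : R 3} (h : IsLorentzONB g T V W)
    (hs : ∀ x y, g x y = g y x) {r₁ r₂ : ℝ} (hr : r₁ ^ 2 + r₂ ^ 2 = 1) :
    IsLorentzONB g T (r₁ • V + r₂ • W) ((-r₂) • V + r₁ • W) := by
  have sWV := (hs W V).trans h.vw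
  refine ⟨h.tt, ?_, ?_, ?_, ?_, ?_⟩ <;>
  simp only [map_add, map_smul, add_apply, smul_apply, h.tv, h.tw, h.vv, h.vw, h.ww, sWV,
    smul_eq_mul]
  · linear_combination hr
  · linear_combination hr
  · ring
  · ring
  · ring

lemma IsLorentzONB.clm_ext {g : R 3 →L[ℝ] R 3 →L[ℝ] ℝ} {t v w : R 3} (h : IsLorentzONB g t v w)
    (hs : ∀ x y, g x y = g y x) {E : Type*} [NormedAddCommGroup E] [NormedSpace ℝ E]
    {A B : R 3 →L[ℝ] E} (ht : A t = B t) (hv : A v = B v) (hw : A w = B w) (u : R 3) :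
    A u = B u := by
  rw [h.decomp hs u]
  simp [ht, hv, hw]

namespace IsAxialOn

/-- The integral curves of the axis field are geodesics. -/
theorem acceleration_eq_zero (h : IsAxialOn f ξ H U) (F : AxialFrame f ξ O) (hOU : O ⊆ U) {x₀ : R 3}
    (hx₀ : x₀ ∈ O) : F.p x₀ = 0 ∧ F.q x₀ = 0 := by
  by_contra hne
  have hO := F.isOpen
  have hF := h.mono hO hOU
  have hev : ∀ᶠ x in 𝓝 x₀, x ∈ O ∧ F.p x ^ 2 + F.q x ^ 2 ≠ 0 := by
    refine Filter.Eventually.and (hO.mem_nhds hx₀) ?_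
    refine ContinuousAt.eventually_ne (((F.smooth_p x₀ hx₀).pow 2).add
      ((F.smooth_q x₀ hx₀).pow 2)).continuousAt fun h0 => hne ?_
    have := sq_nonneg (F.p x₀)
    have := sq_nonneg (F.q x₀)
    exact ⟨pow_eq_zero_iff two_ne_zero |>.1 (by linarith),
      pow_eq_zero_iff two_ne_zero |>.1 (by linarith)⟩
  obtain ⟨S, hSs, hS, hxS⟩ := mem_nhds_iff.1 hev
  have hSO : S ⊆ O := fun x hx => (hSs hx).1
  have ha : ∀ x ∈ S, axisFun f ξ x ≠ 0 := fun x hx => (hF.isAxis (hSO hx)).pos.ne'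
  -- A nonzero acceleration at one point forces the exceptional relation on a whole open set, where
  -- it can be differentiated.
  have hc : ∀ x ∈ S, F.c₁ x ^ 2 + F.c₂ x ^ 2 = 4 * axisFun f ξ x ^ 2 := by
    intro x hx
    by_contra h0
    obtain ⟨h1, h2⟩ := F.acceleration_eq_zero hF (hSO hx) h0
    exact (hSs hx).2 (by rw [h1, h2]; norm_num)
  let u : R 3 → ℂ := fun x => ((F.c₁ x / (2 * axisFun f ξ x) : ℝ) : ℂ)
    + ((F.c₂ x / (2 * axisFun f ξ x) : ℝ) : ℂ) * Complex.I
  have hre : ∀ x, (u x).re = F.c₁ x / (2 * axisFun f ξ x) := fun x => by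
    simp only [u, Complex.add_re, Complex.add_im, Complex.mul_re, Complex.mul_im, Complex.ofReal_re,
      Complex.ofReal_im, Complex.I_re, Complex.I_im]
    ring
  have him : ∀ x, (u x).im = F.c₂ x / (2 * axisFun f ξ x) := fun x => by
    simp only [u, Complex.add_re, Complex.add_im, Complex.mul_re, Complex.mul_im, Complex.ofReal_re,
      Complex.ofReal_im, Complex.I_re, Complex.I_im]
    ring
  have hu : ∀ x ∈ S, ContDiffAt ℝ ∞ u x := by
    intro x hx
    have d := contDiffAt_const.mul (hF.contDiffAt_axisFun (hSO hx)) (f := fun _ => (2 : ℝ))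
    have d0 : 2 * axisFun f ξ x ≠ 0 := mul_ne_zero two_ne_zero (ha x hx)
    exact (Complex.ofRealCLM.contDiff.contDiffAt.comp x ((F.smooth_c₁ x (hSO hx)).div d d0)).add
      ((Complex.ofRealCLM.contDiff.contDiffAt.comp x
        ((F.smooth_c₂ x (hSO hx)).div d d0)).mul contDiffAt_const)
  have hn : ∀ x ∈ S, (u x).re ^ 2 + (u x).im ^ 2 = 1 := by
    intro x hx
    rw [hre, him]
    have := ha x hx
    field_simp
    linear_combination hc x hx
  have hu0 : u x₀ ≠ 0 := by
    intro h0
    have := hn x₀ hxS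
    rw [h0] at this
    norm_num at this
  obtain ⟨P, r, hP, hxP, hPS, hr, hr3⟩ := exists_contDiffAt_cube_root hS hxS hu hu0
  have hrn : ∀ x ∈ P, (r x).re ^ 2 + (r x).im ^ 2 = 1 := by
    intro x hx
    have e1 : Complex.normSq (r x) ^ 3 = 1 := by
      rw [← map_pow, hr3 x hx, Complex.normSq_apply]
      linear_combination hn x (hPS hx)
    have e2 := (pow_eq_one_iff_of_nonneg (Complex.normSq_nonneg _) (by norm_num)).1 e1
    rw [Complex.normSq_apply] at e2
    linear_combination e2
  have hrre : ∀ x ∈ P, (r x).re ^ 3 - 3 * (r x).re * (r x).im ^ 2 = F.c₁ x / (2 * axisFun f ξ x) := by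
    intro x hx
    rw [← hre, ← hr3 x hx, pow_three (r x)]
    simp only [Complex.mul_re, Complex.mul_im]
    ring
  have hrim : ∀ x ∈ P, 3 * (r x).re ^ 2 * (r x).im - (r x).im ^ 3 = F.c₂ x / (2 * axisFun f ξ x) := by
    intro x hx
    rw [← him, ← hr3 x hx, pow_three (r x)]
    simp only [Complex.mul_re, Complex.mul_im]
    ring
  have hPO := hPS.trans hSO
  have hA := hF.mono hP hPO
  have cre : ∀ x ∈ P, ContDiffAt ℝ ∞ (fun x => (r x).re) x := fun x hx =>
    Complex.reCLM.contDiff.contDiffAt.comp x (hr x hx)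
  have cim : ∀ x ∈ P, ContDiffAt ℝ ∞ (fun x => (r x).im) x := fun x hx =>
    Complex.imCLM.contDiff.contDiffAt.comp x (hr x hx)
  -- Rotating by the cube root r of (c₁ + ic₂)/(2a), which has modulus one, makes the new
  -- coefficients 2a and 0.
  refine (hA.frame hP subset_rfl (fun x => (r x).re • F.V x + (r x).im • F.W x)
    (fun x => (-(r x).im) • F.V x + (r x).re • F.W x) (fun x hx => ?_) (fun x hx => ?_)
    fun x hx => ?_).exceptional_false hA hxP (fun x hx => ?_) fun x hx => ?_
  · exact ((cre x hx).smul (F.smooth_V x (hPO hx))).add ((cim x hx).smul (F.smooth_W x (hPO hx)))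
  · exact ((cim x hx).neg.smul (F.smooth_V x (hPO hx))).add
      ((cre x hx).smul (F.smooth_W x (hPO hx)))
  · exact (F.onb x (hPO hx)).rotate (hA.metric_symm hx) (hrn x hx)
  · refine ((F.normalForm x (hPO hx)).rotate (hA.apolar x hx) (F.onb x (hPO hx))).1.trans ?_
    rw [hrre x hx, hrim x hx]
    have := ha x (hPS hx)
    field_simp
    linear_combination hc x (hPS hx)
  · refine ((F.normalForm x (hPO hx)).rotate (hA.apolar x hx) (F.onb x (hPO hx))).2.trans ?_
    rw [hrre x hx, hrim x hx]
    ring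

end IsAxialOn

/-- The factor `Γ` in `∇̂_u T = Γ (u + h(T, u) T)`. -/
def expansion (f ξ : R 3 → R 4) (x : R 3) : ℝ :=
  -(fderiv ℝ (axisFun f ξ) x (axisField f ξ x) / (4 * axisFun f ξ x))

namespace IsAxialOn

lemma exists_axialFrame (h : IsAxialOn f ξ H U) {x : R 3} (hx : x ∈ U) :
    ∃ (O : Set (R 3)) (_ : AxialFrame f ξ O), x ∈ O ∧ O ⊆ U := by
  obtain ⟨O, V, W, hO, hxO, hOU, hV, hW, ho⟩ := h.exists_frame hx
  exact ⟨O, h.frame hO hOU V W hV hW ho, hxO, hOU⟩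

lemma contDiffAt_expansion (h : IsAxialOn f ξ H U) {x : R 3} (hx : x ∈ U) :
    ContDiffAt ℝ ∞ (expansion f ξ) x :=
  ((((h.contDiffAt_axisFun hx).fderiv_right (m := ∞) (by simp)).clm_apply
    (h.contDiffAt_axisField hx)).div (contDiffAt_const.mul (h.contDiffAt_axisFun hx))
      (mul_ne_zero (by norm_num) (h.isAxis hx).pos.ne')).neg

lemma fderiv_axisFun (h : IsAxialOn f ξ H U) {x : R 3} (hx : x ∈ U) (u : R 3) :
    fderiv ℝ (axisFun f ξ) x u
      = 4 * expansion f ξ x * axisFun f ξ x * affineMetric f ξ x (axisField f ξ x) u := by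
  obtain ⟨O, F, hxO, hOU⟩ := h.exists_axialFrame hx
  obtain ⟨hp, hq⟩ := h.acceleration_eq_zero F hOU hxO
  obtain ⟨h1, h2⟩ := F.fderiv_axisFun_vec (h.mono F.isOpen hOU) hxO
  have ho := F.onb x hxO
  have ha := (h.isAxis hx).pos.ne'
  refine ho.clm_ext (h.metric_symm hx) (A := fderiv ℝ (axisFun f ξ) x)
    (B := (4 * expansion f ξ x * axisFun f ξ x) • affineMetric f ξ x (axisField f ξ x)) ?_ ?_ ?_ u
  · rw [smul_apply, ho.tt, smul_eq_mul, expansion]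
    field_simp
  · rw [smul_apply, ho.tv]
    refine h1.trans ?_
    rw [hp]; simp
  · rw [smul_apply, ho.tw]
    refine h2.trans ?_
    rw [hq]; simp

/-- In direction T this is a Riccati equation, the Gauss equation for an umbilic leaf. In directions
V and W it is the classical fact that the umbilic factor is constant along the leaf. -/
lemma fderiv_expansion (h : IsAxialOn f ξ H U) {x : R 3} (hx : x ∈ U) (u : R 3) :
    fderiv ℝ (expansion f ξ) x u = affineMetric f ξ x (axisField f ξ x) u
      * (expansion f ξ x ^ 2 + 3 * axisFun f ξ x ^ 2 - H) := by
  obtain ⟨O, F, hxO, hOU⟩ := h.exists_axialFrame hx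
  have hF := h.mono F.isOpen hOU
  have hO := F.isOpen.mem_nhds hxO
  have um : ∀ y ∈ O, F.αV y = expansion f ξ y ∧ F.βW y = expansion f ξ y ∧ F.βV y = 0 ∧
      F.αW y = 0 := fun y hy =>
    F.umbilic hF hy (h.acceleration_eq_zero F hOU hy).1 (h.acceleration_eq_zero F hOU hy).2
  have d1 : fderiv ℝ F.αV x = fderiv ℝ (expansion f ξ) x :=
    Filter.EventuallyEq.fderiv_eq (Filter.eventuallyEq_of_mem hO fun y hy => (um y hy).1)
  have d2 : fderiv ℝ F.βW x = fderiv ℝ (expansion f ξ) x :=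
    Filter.EventuallyEq.fderiv_eq (Filter.eventuallyEq_of_mem hO fun y hy => (um y hy).2.1)
  have dz : ∀ {g : R 3 → ℝ}, (∀ y ∈ O, g y = 0) → fderiv ℝ g x = 0 := by
    intro g hg
    rw [Filter.EventuallyEq.fderiv_eq (f₁ := g) (f := fun _ => (0 : ℝ))
      (Filter.eventuallyEq_of_mem hO fun y hy => hg y hy), fderiv_fun_const, Pi.zero_apply]
  obtain ⟨g1, -, -, g4, g5⟩ := F.gauss_equations hF hxO
  obtain ⟨u1, u2, u3, u4⟩ := um x hxO
  rw [d1, dz fun y hy => (h.acceleration_eq_zero F hOU hy).1] at g1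
  rw [d2, dz fun y hy => (um y hy).2.2.1] at g4
  rw [d1, dz fun y hy => (um y hy).2.2.2] at g5
  simp only [u1, u2, u3, u4, (h.acceleration_eq_zero F hOU hxO).1,
    (h.acceleration_eq_zero F hOU hxO).2, zero_apply] at g1 g4 g5
  have ho := F.onb x hxO
  refine (ho.clm_ext (h.metric_symm hx) (A := fderiv ℝ (expansion f ξ) x)
    (B := (expansion f ξ x ^ 2 + 3 * axisFun f ξ x ^ 2 - H) •
      affineMetric f ξ x (axisField f ξ x)) ?_ ?_ ?_ u).trans (mul_comm _ _)
  · rw [smul_apply, ho.tt, smul_eq_mul]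
    refine Eq.trans ?_ (g1.trans ?_)
    · simp [AxialFrame.vec]
    · ring
  · rw [smul_apply, ho.tv]
    refine Eq.trans ?_ (g4.trans ?_)
    · simp [AxialFrame.vec]
    · ring
  · rw [smul_apply, ho.tw]
    refine Eq.trans ?_ (g5.trans ?_)
    · simp [AxialFrame.vec]
    · ring

/-- The sum of the Levi-Civita part Γ(u + τ(u)T) and the cubic part K(u, T) = au + 3aτ(u)T. -/
lemma fderiv_axisField (h : IsAxialOn f ξ H U) {x : R 3} (hx : x ∈ U) (u : R 3) :
    fderiv ℝ (axisField f ξ) x u + christoffel f ξ x u (axisField f ξ x)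
      = (expansion f ξ x + axisFun f ξ x) • u
        + ((expansion f ξ x + 3 * axisFun f ξ x) * affineMetric f ξ x (axisField f ξ x) u)
          • axisField f ξ x := by
  obtain ⟨O, F, hxO, hOU⟩ := h.exists_axialFrame hx
  have hF := h.mono F.isOpen hOU
  obtain ⟨hp, hq⟩ := h.acceleration_eq_zero F hOU hxO
  obtain ⟨u1, u2, u3, u4⟩ := F.umbilic hF hxO hp hq
  change _ = expansion f ξ x at u1 u2
  have ho := F.onb x hxO
  have e := fun i => F.nabla_eq x hxO i 0
  simp only [nabla, Fin.sum_univ_three, connectionTable, Matrix.cons_val, u1, u2, u3, u4, hp, hq] at e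
  refine ho.clm_ext (h.metric_symm hx)
    (A := fderiv ℝ (axisField f ξ) x + (christoffel f ξ x).flip (axisField f ξ x))
    (B := (expansion f ξ x + axisFun f ξ x) • ContinuousLinearMap.id ℝ (R 3)
      + ((expansion f ξ x + 3 * axisFun f ξ x) • affineMetric f ξ x (axisField f ξ x)).smulRight
        (axisField f ξ x)) ?_ ?_ ?_ u
  · refine (e 0).trans ?_
    simp [ho.tt]
    module
  · refine (e 1).trans ?_
    simp [ho.tv]
  · refine (e 2).trans ?_
    simp [ho.tw]

end IsAxialOn

end

section

/-! ### The moving frame in the ambient space -/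

lemma _root_.HasFDerivAt.congr_apply {E F : Type*} [NormedAddCommGroup E] [NormedSpace ℝ E]
    [NormedAddCommGroup F] [NormedSpace ℝ F] {g : E → F} {g' g'' : E →L[ℝ] F} {x : E}
    (h : HasFDerivAt g g' x) (e : ∀ u, g' u = g'' u) : HasFDerivAt g g'' x :=
  h.congr_fderiv (ContinuousLinearMap.ext e)

variable {f ξ : R 3 → R 4} {U : Set (R 3)} {H : ℝ}

/-- The one-form dual to the axis field. -/
def axisForm (f ξ : R 3 → R 4) (x : R 3) : R 3 →L[ℝ] ℝ := affineMetric f ξ x (axisField f ξ x)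

/-- The axis field as a vector field of the ambient space. -/
def axisVec (f ξ : R 3 → R 4) (x : R 3) : R 4 := fderiv ℝ f x (axisField f ξ x)

/-- The function `ν = Γ² - a² - H`. -/
def nuFun (H : ℝ) (f ξ : R 3 → R 4) (x : R 3) : ℝ := expansion f ξ x ^ 2 - axisFun f ξ x ^ 2 - H

/-- A vector field spanning the direction of the axis of the hypersurface. -/
def polarVec (H : ℝ) (f ξ : R 3 → R 4) (x : R 3) : R 4 :=
  H • axisVec f ξ x + (expansion f ξ x + axisFun f ξ x) • ξ x

/-- A vector field in the direction of the position vectors of the affine spheres which form the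
leaves. -/
def radialVec (f ξ : R 3 → R 4) (x : R 3) : R 4 :=
  (expansion f ξ x - axisFun f ξ x) • axisVec f ξ x + ξ x

namespace IsAxialOn

lemma hasFDerivAt_axisFun (h : IsAxialOn f ξ H U) {x : R 3} (hx : x ∈ U) :
    HasFDerivAt (axisFun f ξ) ((4 * expansion f ξ x * axisFun f ξ x) • axisForm f ξ x) x := by
  refine HasFDerivAt.congr_apply (((h.contDiffAt_axisFun hx).differentiableAt (by simp)).hasFDerivAt) fun u => ?_
  exact h.fderiv_axisFun hx u

lemma hasFDerivAt_expansion (h : IsAxialOn f ξ H U) {x : R 3} (hx : x ∈ U) :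
    HasFDerivAt (expansion f ξ)
      ((expansion f ξ x ^ 2 + 3 * axisFun f ξ x ^ 2 - H) • axisForm f ξ x) x := by
  refine HasFDerivAt.congr_apply (((h.contDiffAt_expansion hx).differentiableAt (by simp)).hasFDerivAt) fun u => ?_
  rw [h.fderiv_expansion hx u, mul_comm]
  rfl

lemma hasFDerivAt_immersion (h : IsAxialOn f ξ H U) {x : R 3} (hx : x ∈ U) :
    HasFDerivAt f (fderiv ℝ f x) x :=
  ((h.contDiffAt hx).differentiableAt (by simp)).hasFDerivAt

lemma hasFDerivAt_normal (h : IsAxialOn f ξ H U) {x : R 3} (hx : x ∈ U) :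
    HasFDerivAt ξ (-(H • fderiv ℝ f x)) x := by
  refine HasFDerivAt.congr_apply (((h.contDiffAt_normal hx).differentiableAt (by simp)).hasFDerivAt) fun u => ?_
  rw [h.weingarten x hx u]
  rfl

lemma hasFDerivAt_axisVec (h : IsAxialOn f ξ H U) {x : R 3} (hx : x ∈ U) :
    HasFDerivAt (axisVec f ξ) ((expansion f ξ x + axisFun f ξ x) • fderiv ℝ f x
      + (axisForm f ξ x).smulRight
        ((expansion f ξ x + 3 * axisFun f ξ x) • axisVec f ξ x + ξ x)) x := by
  have h1 : HasFDerivAt (fderiv ℝ f) (fderiv ℝ (fderiv ℝ f) x) x :=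
    ((h.contDiffAt_fderiv hx).differentiableAt (by simp)).hasFDerivAt
  have h2 := ((h.contDiffAt_axisField hx).differentiableAt (by simp)).hasFDerivAt
  refine HasFDerivAt.congr_apply (h1.clm_apply h2) fun u => ?_
  have e := congrArg (fderiv ℝ f x) (h.fderiv_axisField hx u)
  rw [map_add, map_add, map_smul, map_smul] at e
  have e' : fderiv ℝ f x (fderiv ℝ (axisField f ξ) x u)
      = (expansion f ξ x + axisFun f ξ x) • fderiv ℝ f x u
        + ((expansion f ξ x + 3 * axisFun f ξ x) * affineMetric f ξ x (axisField f ξ x) u)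
          • fderiv ℝ f x (axisField f ξ x) - fderiv ℝ f x (christoffel f ξ x u (axisField f ξ x)) := by
    rw [← e]; abel
  simp only [add_apply, smul_apply, smulRight_apply, coe_comp, Function.comp_apply, flip_apply, e',
    h.gauss hx u, axisForm, axisVec, h.metric_symm hx u]
  module

/-- The terms in a² recombine: 2Γ(Γ² + 3a² − H) − 8Γa² = 2Γν. So ν satisfies a linear equation and
vanishes identically or nowhere. -/
lemma hasFDerivAt_nuFun (h : IsAxialOn f ξ H U) {x : R 3} (hx : x ∈ U) :
    HasFDerivAt (nuFun H f ξ) ((2 * expansion f ξ x * nuFun H f ξ x) • axisForm f ξ x) x := by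
  have h1 := h.hasFDerivAt_expansion hx
  have h2 := h.hasFDerivAt_axisFun hx
  refine HasFDerivAt.congr_apply (((h1.pow 2).sub (h2.pow 2)).sub_const H) fun u => ?_
  simp only [nuFun, smul_apply, sub_apply, smul_eq_mul, nsmul_eq_mul]
  norm_num
  ring

/-- The coefficients of T and ξ are chosen so that the two multiples of df, H(Γ + a) and −(Γ + a)H,
cancel. What remains is proportional to the vector itself, so its direction is fixed. -/
lemma hasFDerivAt_polarVec (h : IsAxialOn f ξ H U) {x : R 3} (hx : x ∈ U) :
    HasFDerivAt (polarVec H f ξ) ((axisForm f ξ x).smulRight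
      ((expansion f ξ x + 3 * axisFun f ξ x) • polarVec H f ξ x)) x := by
  refine HasFDerivAt.congr_apply (((h.hasFDerivAt_axisVec hx).const_smul H).add
    (((h.hasFDerivAt_expansion hx).add (h.hasFDerivAt_axisFun hx)).smul (h.hasFDerivAt_normal hx))
   ) fun u => ?_
  simp only [polarVec, add_apply, smul_apply, smulRight_apply, neg_apply, Pi.add_apply]
  module

/-- The factor of df is (Γ − a)(Γ + a) − H = ν. On ker τ the derivative is therefore ν df, and f
minus this vector over ν is constant on each leaf. -/
lemma hasFDerivAt_radialVec (h : IsAxialOn f ξ H U) {x : R 3} (hx : x ∈ U) :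
    HasFDerivAt (radialVec f ξ)
      (nuFun H f ξ x • (fderiv ℝ f x + (axisForm f ξ x).smulRight (axisVec f ξ x))
        + (axisForm f ξ x).smulRight
          ((expansion f ξ x - axisFun f ξ x) • radialVec f ξ x)) x := by
  refine HasFDerivAt.congr_apply ((((h.hasFDerivAt_expansion hx).sub (h.hasFDerivAt_axisFun hx)).smul
    (h.hasFDerivAt_axisVec hx)).add (h.hasFDerivAt_normal hx)) fun u => ?_
  simp only [radialVec, nuFun, add_apply, sub_apply, smul_apply, smulRight_apply, neg_apply,
    Pi.sub_apply]
  module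

/-- The form `h(T, ·)` is differentiated with the Gauss formula. -/
lemma hasFDerivAt_axisForm (h : IsAxialOn f ξ H U) {x : R 3} (hx : x ∈ U) (u v : R 3) :
    fderiv ℝ (axisForm f ξ) x u v = axisForm f ξ x (christoffel f ξ x u v)
      + (expansion f ξ x - axisFun f ξ x) * affineMetric f ξ x u v
      + (expansion f ξ x - 3 * axisFun f ξ x) * (axisForm f ξ x u * axisForm f ξ x v) := by
  have h1 : DifferentiableAt ℝ (affineMetric f ξ) x :=
    (h.contDiffAt_metric hx).differentiableAt (by simp)
  have h2 := (h.contDiffAt_axisField hx).differentiableAt (by simp)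
  have hax := h.isAxis hx
  have hK : differenceMap f ξ x (axisField f ξ x) u = axisFun f ξ x • u
      + (3 * axisFun f ξ x * axisForm f ξ x u) • axisField f ξ x := by
    have hp : affineMetric f ξ x (axisField f ξ x) (u + axisForm f ξ x u • axisField f ξ x) = 0 := by
      rw [map_add, map_smul, hax.unit, axisForm, smul_eq_mul]; ring
    have := hax.K_perp _ hp
    rw [map_add, map_smul, hax.K_self] at this
    rw [eq_sub_of_add_eq this]
    module
  unfold axisForm
  rw [fderiv_clm_apply h1 h2]
  simp only [add_apply, coe_comp, Function.comp_apply, flip_apply]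
  have e := h.fderiv_axisField hx u
  rw [h.fderiv_metric hx, h.differenceMap_symm hx, hK, eq_sub_of_add_eq e]
  simp only [map_add, map_sub, map_smul, add_apply, sub_apply, smul_apply, smul_eq_mul, axisForm]
  ring

lemma frame_ne_zero (h : IsAxialOn f ξ H U) {x : R 3} (hx : x ∈ U) {c d : ℝ}
    (hcd : c ≠ 0 ∨ d ≠ 0) : c • axisVec f ξ x + d • ξ x ≠ 0 := by
  intro h0
  have := h.eq_of_frame_eq hx (u := c • axisField f ξ x) (c := d) (v := 0) (d := 0) (by
    simpa [axisVec] using h0)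
  have hT : axisField f ξ x ≠ 0 := by
    intro h1
    have := (h.isAxis hx).unit
    rw [h1] at this
    simp at this
  rcases hcd with hc | hd
  · exact (smul_ne_zero hc hT) this.1
  · exact hd this.2

/-- It could only vanish if H = 0 and Γ + a = 0, and then ν = (Γ − a)(Γ + a) − H = 0. -/
lemma polarVec_ne_zero (h : IsAxialOn f ξ H U) {x : R 3} (hx : x ∈ U) (hν : nuFun H f ξ x ≠ 0) :
    polarVec H f ξ x ≠ 0 := by
  refine h.frame_ne_zero hx ?_
  by_contra! hc
  refine hν ?_
  rw [nuFun]
  linear_combination (expansion f ξ x - axisFun f ξ x) * hc.2 - hc.1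

end IsAxialOn

end

section

/-! ### Constants of an axial sphere -/

lemma _root_.HasFDerivAt.norm_of_smulRight {E F : Type*} [NormedAddCommGroup E] [NormedSpace ℝ E]
    [NormedAddCommGroup F] [InnerProductSpace ℝ F] {v : E → F} {x : E} {l : E →L[ℝ] ℝ} {c : ℝ}
    (h : HasFDerivAt v (l.smulRight (c • v x)) x) (h0 : v x ≠ 0) :
    HasFDerivAt (fun y => ‖v y‖) ((c * ‖v x‖) • l) x := by
  have h1 := h.norm_sq.sqrt (pow_ne_zero 2 (norm_ne_zero_iff.2 h0))
  simp only [Real.sqrt_sq (norm_nonneg _)] at h1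
  refine h1.congr_apply fun u => ?_
  have := norm_ne_zero_iff.2 h0
  simp [inner_smul_right]
  field_simp

variable {f ξ : R 3 → R 4} {U : Set (R 3)} {H : ℝ}

/-- The length of the vector `polarVec`. -/
def rhoFun (H : ℝ) (f ξ : R 3 → R 4) (x : R 3) : ℝ := ‖polarVec H f ξ x‖

/-- The unit vector in the direction of the axis of the hypersurface. -/
def polarDir (H : ℝ) (f ξ : R 3 → R 4) (x : R 3) : R 4 := (rhoFun H f ξ x)⁻¹ • polarVec H f ξ x

/-- The derivative of the height function along the axis of the hypersurface. -/
def slopeFun (H : ℝ) (f ξ : R 3 → R 4) (x : R 3) : ℝ := rhoFun H f ξ x * (nuFun H f ξ x)⁻¹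

/-- The covector whose level sets contain the leaves. -/
def leafForm (H : ℝ) (f ξ : R 3 → R 4) (x : R 3) : R 4 →L[ℝ] ℝ :=
  (slopeFun H f ξ x • ((axisForm f ξ x).comp (fst ℝ (R 3) ℝ)
    + (expansion f ξ x - axisFun f ξ x) • snd ℝ (R 3) ℝ)).comp (split f ξ x)

namespace IsAxialOn

lemma hasFDerivAt_rhoFun (h : IsAxialOn f ξ H U) {x : R 3} (hx : x ∈ U) (hν : nuFun H f ξ x ≠ 0) :
    HasFDerivAt (rhoFun H f ξ)
      (((expansion f ξ x + 3 * axisFun f ξ x) * rhoFun H f ξ x) • axisForm f ξ x) x :=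
  (h.hasFDerivAt_polarVec hx).norm_of_smulRight (h.polarVec_ne_zero hx hν)

lemma rhoFun_pos (h : IsAxialOn f ξ H U) {x : R 3} (hx : x ∈ U) (hν : nuFun H f ξ x ≠ 0) :
    0 < rhoFun H f ξ x := norm_pos_iff.2 (h.polarVec_ne_zero hx hν)

lemma polarVec_eq (h : IsAxialOn f ξ H U) {x : R 3} (hx : x ∈ U) (hν : nuFun H f ξ x ≠ 0) :
    polarVec H f ξ x = rhoFun H f ξ x • polarDir H f ξ x := by
  rw [polarDir, smul_smul, mul_inv_cancel₀ (h.rhoFun_pos hx hν).ne', one_smul]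

lemma hasFDerivAt_polarDir (h : IsAxialOn f ξ H U) {x : R 3} (hx : x ∈ U)
    (hν : nuFun H f ξ x ≠ 0) : HasFDerivAt (polarDir H f ξ) (0 : R 3 →L[ℝ] R 4) x := by
  have hρ := (h.rhoFun_pos hx hν).ne'
  refine HasFDerivAt.congr_apply (((hasDerivAt_inv hρ).comp_hasFDerivAt x
    (h.hasFDerivAt_rhoFun hx hν)).smul (h.hasFDerivAt_polarVec hx)) fun u => ?_
  simp only [add_apply, smul_apply, smulRight_apply, zero_apply, smul_eq_mul, Function.comp_apply,
    smul_smul, ← add_smul]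
  refine smul_eq_zero_of_left ?_ _
  field_simp
  ring

/-- The function `ν² / a` is locally constant. -/
lemma hasFDerivAt_nuFun_sq_div (h : IsAxialOn f ξ H U) {x : R 3} (hx : x ∈ U) :
    HasFDerivAt (fun y => nuFun H f ξ y ^ 2 * (axisFun f ξ y)⁻¹) (0 : R 3 →L[ℝ] ℝ) x := by
  have ha := (h.isAxis hx).pos.ne'
  refine HasFDerivAt.congr_apply (((h.hasFDerivAt_nuFun hx).pow 2).mul
    ((hasDerivAt_inv ha).comp_hasFDerivAt x (h.hasFDerivAt_axisFun hx))) fun u => ?_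
  simp only [add_apply, smul_apply, zero_apply, smul_eq_mul, Function.comp_apply, nsmul_eq_mul,
    Nat.add_one_sub_one, pow_one, Nat.cast_ofNat]
  field_simp
  ring

lemma hasFDerivAt_slopeFun (h : IsAxialOn f ξ H U) {x : R 3} (hx : x ∈ U)
    (hν : nuFun H f ξ x ≠ 0) : HasFDerivAt (slopeFun H f ξ)
      (((3 * axisFun f ξ x - expansion f ξ x) * slopeFun H f ξ x) • axisForm f ξ x) x := by
  refine HasFDerivAt.congr_apply ((h.hasFDerivAt_rhoFun hx hν).mul
    ((hasDerivAt_inv hν).comp_hasFDerivAt x (h.hasFDerivAt_nuFun hx))) fun u => ?_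
  simp only [slopeFun, add_apply, smul_apply, smul_eq_mul, Function.comp_apply]
  field_simp
  ring

lemma leafForm_apply (h : IsAxialOn f ξ H U) {x : R 3} (hx : x ∈ U) (u : R 3) (c : ℝ) :
    leafForm H f ξ x (fderiv ℝ f x u + c • ξ x)
      = slopeFun H f ξ x * (axisForm f ξ x u + (expansion f ξ x - axisFun f ξ x) * c) := by
  simp [leafForm, h.split_frameMap hx]
  ring

lemma leafForm_tangent (h : IsAxialOn f ξ H U) {x : R 3} (hx : x ∈ U) (u : R 3) :
    leafForm H f ξ x (fderiv ℝ f x u) = slopeFun H f ξ x * axisForm f ξ x u := by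
  simpa using h.leafForm_apply hx u 0

lemma leafForm_normal (h : IsAxialOn f ξ H U) {x : R 3} (hx : x ∈ U) :
    leafForm H f ξ x (ξ x) = slopeFun H f ξ x * (expansion f ξ x - axisFun f ξ x) := by
  simpa using h.leafForm_apply hx 0 1

lemma axisForm_self (h : IsAxialOn f ξ H U) {x : R 3} (hx : x ∈ U) :
    axisForm f ξ x (axisField f ξ x) = -1 := (h.isAxis hx).unit

lemma leafForm_radialVec (h : IsAxialOn f ξ H U) {x : R 3} (hx : x ∈ U) :
    leafForm H f ξ x (radialVec f ξ x) = 0 := by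
  rw [radialVec, axisVec, ← map_smul, ← one_smul ℝ (ξ x), h.leafForm_apply hx, map_smul,
    h.axisForm_self hx, smul_eq_mul]
  ring

lemma leafForm_polarDir (h : IsAxialOn f ξ H U) {x : R 3} (hx : x ∈ U) (hν : nuFun H f ξ x ≠ 0) :
    leafForm H f ξ x (polarDir H f ξ x) = 1 := by
  have hρ := (h.rhoFun_pos hx hν).ne'
  rw [polarDir, polarVec, axisVec, map_smul, ← map_smul (fderiv ℝ f x), h.leafForm_apply hx, map_smul,
    h.axisForm_self hx, slopeFun, smul_eq_mul, smul_eq_mul]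
  field_simp
  rw [nuFun]
  ring

lemma contDiffAt_axisForm (h : IsAxialOn f ξ H U) {x : R 3} (hx : x ∈ U) :
    ContDiffAt ℝ ∞ (axisForm f ξ) x := (h.contDiffAt_metric hx).clm_apply (h.contDiffAt_axisField hx)

/-- The covector is known on df(u) and on ξ, which span ℝ⁴. Differentiating these two values with
the Gauss and Weingarten formulas shows that its derivative annihilates both. -/
lemma hasFDerivAt_leafForm (h : IsAxialOn f ξ H U) (hν : ∀ x ∈ U, nuFun H f ξ x ≠ 0) {x : R 3}
    (hx : x ∈ U) : HasFDerivAt (leafForm H f ξ) (0 : R 3 →L[ℝ] R 4 →L[ℝ] ℝ) x := by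
  have dτ := (h.contDiffAt_axisForm hx).differentiableAt (by simp)
  have ds := h.hasFDerivAt_slopeFun hx (hν x hx)
  have da := (h.hasFDerivAt_expansion hx).sub (h.hasFDerivAt_axisFun hx)
  have dsplit := (h.contDiffAt_split hx).differentiableAt (by simp)
  have dL : DifferentiableAt ℝ (leafForm H f ξ) x := by
    unfold leafForm
    exact (ds.differentiableAt.fun_smul ((dτ.clm_comp (differentiableAt_const _)).fun_add
      (da.differentiableAt.fun_smul (differentiableAt_const _)))).clm_comp dsplit
  refine dL.hasFDerivAt.congr_apply fun v => ContinuousLinearMap.ext fun w => ?_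
  have df := ((h.contDiffAt_fderiv hx).differentiableAt (by simp)).hasFDerivAt
  have hU := h.isOpen.mem_nhds hx
  have e1 : ∀ u, fderiv ℝ (leafForm H f ξ) x v (fderiv ℝ f x u) = 0 := by
    intro u
    have h1 : HasFDerivAt (fun y => leafForm H f ξ y (fderiv ℝ f y u)) _ x :=
      dL.hasFDerivAt.clm_apply (df.clm_apply (hasFDerivAt_const u x))
    have h2 : HasFDerivAt (fun y => slopeFun H f ξ y * axisForm f ξ y u) _ x :=
      ds.mul (dτ.hasFDerivAt.clm_apply (hasFDerivAt_const u x))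
    have h3 := h2.congr_of_eventuallyEq (f₁ := fun y => leafForm H f ξ y (fderiv ℝ f y u))
      (Filter.eventuallyEq_of_mem hU fun y hy => h.leafForm_tangent hy u)
    have := DFunLike.congr_fun (h1.unique h3) v
    simp only [add_apply, smul_apply, coe_comp, Function.comp_apply, flip_apply, zero_apply,
      map_zero, zero_add, smul_eq_mul, h.gauss hx, h.leafForm_apply hx,
      h.hasFDerivAt_axisForm hx] at this
    linear_combination this
  have e2 : fderiv ℝ (leafForm H f ξ) x v (ξ x) = 0 := by
    have h1 : HasFDerivAt (fun y => leafForm H f ξ y (ξ y)) _ x :=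
      dL.hasFDerivAt.clm_apply (h.hasFDerivAt_normal hx)
    have h2 : HasFDerivAt (fun y => slopeFun H f ξ y * (expansion f ξ y - axisFun f ξ y)) _ x :=
      ds.mul da
    have h3 := h2.congr_of_eventuallyEq (f₁ := fun y => leafForm H f ξ y (ξ y))
      (Filter.eventuallyEq_of_mem hU fun y hy => h.leafForm_normal hy)
    have := DFunLike.congr_fun (h1.unique h3) v
    simp only [add_apply, sub_apply, smul_apply, neg_apply, coe_comp, Function.comp_apply,
      flip_apply, map_neg, map_smul, h.leafForm_tangent hx, smul_eq_mul, Pi.sub_apply] at this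
    linear_combination this
  rw [← h.frameMap_split hx w, map_add, map_smul, e1, e2]
  simp

/-- The centres of the leaves lie on a line. -/
lemma hasFDerivAt_center (h : IsAxialOn f ξ H U) {x : R 3} (hx : x ∈ U) (hν : nuFun H f ξ x ≠ 0)
    {l : R 4 →L[ℝ] ℝ} {e : R 4} (hl : leafForm H f ξ x = l) (he : polarDir H f ξ x = e) :
    HasFDerivAt (fun y => f y - (nuFun H f ξ y)⁻¹ • radialVec f ξ y - l (f y) • e)
      (0 : R 3 →L[ℝ] R 4) x := by
  have df := h.hasFDerivAt_immersion hx
  refine HasFDerivAt.congr_apply ((df.sub (((hasDerivAt_inv hν).comp_hasFDerivAt x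
    (h.hasFDerivAt_nuFun hx)).smul (h.hasFDerivAt_radialVec hx))).sub
    ((l.hasFDerivAt.comp x df).smul_const e)) fun u => ?_
  have hp : rhoFun H f ξ x • e = polarVec H f ξ x := by rw [h.polarVec_eq hx hν, he]
  -- Since ν ≠ 0, the polar and radial vectors span the same plane as T and ξ; this is T in that
  -- basis.
  have h1 : nuFun H f ξ x • axisVec f ξ x
      = (expansion f ξ x + axisFun f ξ x) • radialVec f ξ x - rhoFun H f ξ x • e := by
    rw [hp, nuFun, radialVec, polarVec]
    module
  have h2 : axisVec f ξ x = (nuFun H f ξ x)⁻¹ •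
      ((expansion f ξ x + axisFun f ξ x) • radialVec f ξ x - rhoFun H f ξ x • e) := by
    rw [← h1, smul_smul, inv_mul_cancel₀ hν, one_smul]
  have h3 : l (fderiv ℝ f x u) = rhoFun H f ξ x * (nuFun H f ξ x)⁻¹ * axisForm f ξ x u := by
    rw [← hl, h.leafForm_tangent hx, slopeFun]
  have hc : nuFun H f ξ x * (nuFun H f ξ x)⁻¹ = 1 := mul_inv_cancel₀ hν
  have hc' : (nuFun H f ξ x ^ 2)⁻¹ * nuFun H f ξ x = (nuFun H f ξ x)⁻¹ := by field_simp
  simp only [add_apply, sub_apply, smul_apply, smulRight_apply, zero_apply, smul_eq_mul,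
    Function.comp_apply, coe_comp, h3, smul_add, smul_smul, inv_mul_cancel₀ hν, one_smul,
    add_zero]
  rw [h2]
  match_scalars <;> field_simp <;> ring

end IsAxialOn

end

section

/-! ### Change of parameters -/

lemma fderiv_fderiv_comp {E F G : Type*} [NormedAddCommGroup E] [NormedSpace ℝ E]
    [NormedAddCommGroup F] [NormedSpace ℝ F] [NormedAddCommGroup G] [NormedSpace ℝ G] {f : F → G}
    {m : E → F} {x : E} (hf : ContDiffAt ℝ ∞ f (m x)) (hm : ContDiffAt ℝ ∞ m x) (u v : E) :
    fderiv ℝ (fderiv ℝ (f ∘ m)) x u v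
      = fderiv ℝ (fderiv ℝ f) (m x) (fderiv ℝ m x u) (fderiv ℝ m x v)
        + fderiv ℝ f (m x) (fderiv ℝ (fderiv ℝ m) x u v) := by
  have h1 : DifferentiableAt ℝ (fderiv ℝ f) (m x) :=
    (hf.fderiv_right (m := ∞) (by simp)).differentiableAt (by simp)
  have h2 : DifferentiableAt ℝ m x := hm.differentiableAt (by simp)
  have h3 : DifferentiableAt ℝ (fderiv ℝ m) x :=
    (hm.fderiv_right (m := ∞) (by simp)).differentiableAt (by simp)
  have h4 : ∀ᶠ y in 𝓝 x, fderiv ℝ (f ∘ m) y = (fderiv ℝ f (m y)).comp (fderiv ℝ m y) := by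
    have e1 : ∀ᶠ y in 𝓝 x, ContDiffAt ℝ 1 f (m y) :=
      hm.continuousAt.eventually ((hf.of_le (by simp)).eventually (by simp))
    have e2 : ∀ᶠ y in 𝓝 x, ContDiffAt ℝ 1 m y := (hm.of_le (by simp)).eventually (by simp)
    filter_upwards [e1, e2] with y hy1 hy2
    exact fderiv_comp y (hy1.differentiableAt (by simp)) (hy2.differentiableAt (by simp))
  rw [Filter.EventuallyEq.fderiv_eq h4]
  have e : HasFDerivAt (fun y => (fderiv ℝ f (m y)).comp (fderiv ℝ m y)) _ x :=
    (h1.hasFDerivAt.comp x h2.hasFDerivAt).clm_comp h3.hasFDerivAt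
  rw [e.fderiv]
  simp [add_comm]

/-- `f'` and `ξ'` are obtained from `f` and `ξ` by the change of parameters `φ` on `O`. -/
structure IsReparametrization (H : ℝ) (f ξ : R 3 → R 4) (U : Set (R 3)) (f' ξ' : R 3 → R 4)
    (φ : R 3 → R 3) (O : Set (R 3)) : Prop where
  base : IsAxialOn f ξ H U
  pulled : IsAxialOn f' ξ' H O
  smooth : ∀ x ∈ O, ContDiffAt ℝ ∞ φ x
  mapsTo : ∀ x ∈ O, φ x ∈ U
  eq_immersion : ∀ x ∈ O, f' x = f (φ x)
  eq_normal : ∀ x ∈ O, ξ' x = ξ (φ x)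

namespace IsReparametrization

variable {H : ℝ} {f ξ f' ξ' : R 3 → R 4} {U O : Set (R 3)} {φ : R 3 → R 3}

lemma fderiv_immersion (h : IsReparametrization H f ξ U f' ξ' φ O) {x : R 3} (hx : x ∈ O) :
    fderiv ℝ f' x = (fderiv ℝ f (φ x)).comp (fderiv ℝ φ x) := by
  rw [Filter.EventuallyEq.fderiv_eq (f₁ := f') (f := f ∘ φ)
    (Filter.eventuallyEq_of_mem (h.pulled.isOpen.mem_nhds hx) h.eq_immersion)]
  exact fderiv_comp x (h.base.hasFDerivAt_immersion (h.mapsTo x hx)).differentiableAt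
    ((h.smooth x hx).differentiableAt (by simp))

lemma fderiv_injective (h : IsReparametrization H f ξ U f' ξ' φ O) {x : R 3} (hx : x ∈ O) :
    Function.Injective (fderiv ℝ φ x) := by
  refine (injective_iff_map_eq_zero _).2 fun u hu => ?_
  have e : fderiv ℝ f' x u + (0 : ℝ) • ξ' x = fderiv ℝ f' x 0 + (0 : ℝ) • ξ' x := by
    simp [h.fderiv_immersion hx, hu]
  exact (h.pulled.eq_of_frame_eq hx e).1

lemma fderiv_surjective (h : IsReparametrization H f ξ U f' ξ' φ O) {x : R 3} (hx : x ∈ O) :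
    Function.Surjective (fderiv ℝ φ x) :=
  (LinearMap.injective_iff_surjective (f := (fderiv ℝ φ x).toLinearMap)).1 (h.fderiv_injective hx)

lemma second_fderiv (h : IsReparametrization H f ξ U f' ξ' φ O) {x : R 3} (hx : x ∈ O)
    (u v : R 3) : fderiv ℝ (fderiv ℝ f') x u v
      = fderiv ℝ (fderiv ℝ f) (φ x) (fderiv ℝ φ x u) (fderiv ℝ φ x v)
        + fderiv ℝ f (φ x) (fderiv ℝ (fderiv ℝ φ) x u v) := by
  have e : f' =ᶠ[𝓝 x] f ∘ φ :=
    Filter.eventuallyEq_of_mem (h.pulled.isOpen.mem_nhds hx) h.eq_immersion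
  rw [e.fderiv.fderiv_eq, fderiv_fderiv_comp (h.base.contDiffAt (h.mapsTo x hx)) (h.smooth x hx)]

/-- The Hessian of φ enters the second derivative of f∘φ only through df, so it changes the
connection coefficients but leaves h tensorial. -/
lemma metric_christoffel (h : IsReparametrization H f ξ U f' ξ' φ O) {x : R 3} (hx : x ∈ O)
    (u v : R 3) : fderiv ℝ φ x (christoffel f' ξ' x u v)
        = christoffel f ξ (φ x) (fderiv ℝ φ x u) (fderiv ℝ φ x v) + fderiv ℝ (fderiv ℝ φ) x u v ∧
      affineMetric f' ξ' x u v = affineMetric f ξ (φ x) (fderiv ℝ φ x u) (fderiv ℝ φ x v) := by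
  refine h.base.eq_of_frame_eq (h.mapsTo x hx) ?_
  have e := h.second_fderiv hx u v
  rw [h.pulled.gauss hx, h.base.gauss (h.mapsTo x hx), h.fderiv_immersion hx, h.eq_normal x hx] at e
  rw [map_add]
  rw [coe_comp, Function.comp_apply] at e
  rw [e]
  abel

lemma metric (h : IsReparametrization H f ξ U f' ξ' φ O) {x : R 3} (hx : x ∈ O) (u v : R 3) :
    affineMetric f' ξ' x u v = affineMetric f ξ (φ x) (fderiv ℝ φ x u) (fderiv ℝ φ x v) :=
  (h.metric_christoffel hx u v).2

lemma fderiv_metric (h : IsReparametrization H f ξ U f' ξ' φ O) {x : R 3} (hx : x ∈ O)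
    (u v w : R 3) : fderiv ℝ (affineMetric f' ξ') x u v w
      = fderiv ℝ (affineMetric f ξ) (φ x) (fderiv ℝ φ x u) (fderiv ℝ φ x v) (fderiv ℝ φ x w)
        + affineMetric f ξ (φ x) (fderiv ℝ (fderiv ℝ φ) x u v) (fderiv ℝ φ x w)
        + affineMetric f ξ (φ x) (fderiv ℝ φ x v) (fderiv ℝ (fderiv ℝ φ) x u w) := by
  have h1 := ((h.base.contDiffAt_metric (h.mapsTo x hx)).differentiableAt (by simp)).hasFDerivAt
  have h2 := ((h.smooth x hx).differentiableAt (by simp)).hasFDerivAt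
  have h3 : HasFDerivAt (fderiv ℝ φ) (fderiv ℝ (fderiv ℝ φ) x) x :=
    (((h.smooth x hx).fderiv_right (m := ∞) (by simp)).differentiableAt (by simp)).hasFDerivAt
  have h4 := ((h.pulled.contDiffAt_metric hx).differentiableAt (by simp)).hasFDerivAt
  have e1 : HasFDerivAt (fun y => affineMetric f' ξ' y v w) _ x :=
    (h4.clm_apply (hasFDerivAt_const v x)).clm_apply (hasFDerivAt_const w x)
  have e2 : HasFDerivAt (fun y => affineMetric f ξ (φ y) (fderiv ℝ φ y v) (fderiv ℝ φ y w)) _ x :=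
    ((h1.comp x h2).clm_apply (h3.clm_apply (hasFDerivAt_const v x))).clm_apply
      (h3.clm_apply (hasFDerivAt_const w x))
  have e3 := e2.congr_of_eventuallyEq (f₁ := fun y => affineMetric f' ξ' y v w)
    (Filter.eventuallyEq_of_mem (h.pulled.isOpen.mem_nhds hx) fun y hy => h.metric hy v w)
  have := DFunLike.congr_fun (e1.unique e3) u
  simp only [add_apply, coe_comp, Function.comp_apply, flip_apply, zero_apply, map_zero,
    zero_add] at this
  linear_combination this

/-- The Hessian of φ appears in the derivative of h and in the connection coefficients and cancels
in ∇h, hence in K. -/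
lemma differenceMap (h : IsReparametrization H f ξ U f' ξ' φ O) {x : R 3} (hx : x ∈ O) (u v : R 3) :
    fderiv ℝ φ x (differenceMap f' ξ' x u v)
      = AffineSphere.differenceMap f ξ (φ x) (fderiv ℝ φ x u) (fderiv ℝ φ x v) := by
  have hφ := h.mapsTo x hx
  refine h.base.metric_injective hφ fun w' => ?_
  obtain ⟨w, rfl⟩ := h.fderiv_surjective hx w'
  have e1 := h.pulled.fderiv_metric hx u v w
  have e2 := h.base.fderiv_metric hφ (fderiv ℝ φ x u) (fderiv ℝ φ x v) (fderiv ℝ φ x w)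
  rw [h.fderiv_metric hx, h.metric hx, h.metric hx, h.metric hx, (h.metric_christoffel hx u v).1,
    (h.metric_christoffel hx u w).1, map_add, map_add, add_apply] at e1
  linear_combination (e1 - e2) / 2

lemma isAxis (h : IsReparametrization H f ξ U f' ξ' φ O) {x : R 3} (hx : x ∈ O) :
    IsAxis (affineMetric f ξ (φ x)) (AffineSphere.differenceMap f ξ (φ x))
      (fderiv ℝ φ x (axisField f' ξ' x)) (axisFun f' ξ' x) := by
  have hax := h.pulled.isAxis hx
  refine ⟨by rw [← h.metric hx, hax.unit], hax.pos, ?_, fun u hu => ?_⟩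
  · rw [← h.differenceMap hx, hax.K_self, map_smul]
  · obtain ⟨w, rfl⟩ := h.fderiv_surjective hx u
    rw [← h.metric hx] at hu
    rw [← h.differenceMap hx, hax.K_perp w hu, map_smul]

/-- The pushed-forward vector is an axis for the base hypersurface, and the axis is unique. All
later invariants are built from it and so are independent of the chart. -/
lemma fderiv_axisField (h : IsReparametrization H f ξ U f' ξ' φ O) {x : R 3} (hx : x ∈ O) :
    fderiv ℝ φ x (axisField f' ξ' x) = axisField f ξ (φ x) :=
  (h.isAxis hx).eq_axis (h.base.apolar _ (h.mapsTo x hx))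

lemma axisFun (h : IsReparametrization H f ξ U f' ξ' φ O) {x : R 3} (hx : x ∈ O) :
    axisFun f' ξ' x = AffineSphere.axisFun f ξ (φ x) :=
  (h.isAxis hx).eq_axisValue (h.base.apolar _ (h.mapsTo x hx))

lemma axisForm (h : IsReparametrization H f ξ U f' ξ' φ O) {x : R 3} (hx : x ∈ O) (u : R 3) :
    axisForm f' ξ' x u = AffineSphere.axisForm f ξ (φ x) (fderiv ℝ φ x u) := by
  rw [AffineSphere.axisForm, h.metric hx, h.fderiv_axisField hx]
  rfl

lemma axisVec (h : IsReparametrization H f ξ U f' ξ' φ O) {x : R 3} (hx : x ∈ O) :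
    axisVec f' ξ' x = AffineSphere.axisVec f ξ (φ x) := by
  rw [AffineSphere.axisVec, h.fderiv_immersion hx, coe_comp, Function.comp_apply,
    h.fderiv_axisField hx]
  rfl

lemma expansion (h : IsReparametrization H f ξ U f' ξ' φ O) {x : R 3} (hx : x ∈ O) :
    expansion f' ξ' x = AffineSphere.expansion f ξ (φ x) := by
  have e : fderiv ℝ (AffineSphere.axisFun f' ξ') x
      = (fderiv ℝ (AffineSphere.axisFun f ξ) (φ x)).comp (fderiv ℝ φ x) := by
    rw [Filter.EventuallyEq.fderiv_eq (f₁ := AffineSphere.axisFun f' ξ')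
      (f := AffineSphere.axisFun f ξ ∘ φ)
      (Filter.eventuallyEq_of_mem (h.pulled.isOpen.mem_nhds hx) fun y hy => h.axisFun hy)]
    exact fderiv_comp x (h.base.hasFDerivAt_axisFun (h.mapsTo x hx)).differentiableAt
      ((h.smooth x hx).differentiableAt (by simp))
  rw [AffineSphere.expansion, e, coe_comp, Function.comp_apply, h.fderiv_axisField hx, h.axisFun hx]
  rfl

lemma nuFun (h : IsReparametrization H f ξ U f' ξ' φ O) {x : R 3} (hx : x ∈ O) :
    nuFun H f' ξ' x = AffineSphere.nuFun H f ξ (φ x) := by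
  rw [AffineSphere.nuFun, h.expansion hx, h.axisFun hx]
  rfl

lemma polarVec (h : IsReparametrization H f ξ U f' ξ' φ O) {x : R 3} (hx : x ∈ O) :
    polarVec H f' ξ' x = AffineSphere.polarVec H f ξ (φ x) := by
  rw [AffineSphere.polarVec, h.expansion hx, h.axisFun hx, h.axisVec hx, h.eq_normal x hx]
  rfl

lemma radialVec (h : IsReparametrization H f ξ U f' ξ' φ O) {x : R 3} (hx : x ∈ O) :
    radialVec f' ξ' x = AffineSphere.radialVec f ξ (φ x) := by
  rw [AffineSphere.radialVec, h.expansion hx, h.axisFun hx, h.axisVec hx, h.eq_normal x hx]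
  rfl

lemma rhoFun (h : IsReparametrization H f ξ U f' ξ' φ O) {x : R 3} (hx : x ∈ O) :
    rhoFun H f' ξ' x = AffineSphere.rhoFun H f ξ (φ x) := by
  rw [AffineSphere.rhoFun, h.polarVec hx]
  rfl

lemma polarDir (h : IsReparametrization H f ξ U f' ξ' φ O) {x : R 3} (hx : x ∈ O) :
    polarDir H f' ξ' x = AffineSphere.polarDir H f ξ (φ x) := by
  rw [AffineSphere.polarDir, h.rhoFun hx, h.polarVec hx]
  rfl

lemma slopeFun (h : IsReparametrization H f ξ U f' ξ' φ O) {x : R 3} (hx : x ∈ O) :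
    slopeFun H f' ξ' x = AffineSphere.slopeFun H f ξ (φ x) := by
  rw [AffineSphere.slopeFun, h.rhoFun hx, h.nuFun hx]
  rfl

lemma leafForm (h : IsReparametrization H f ξ U f' ξ' φ O) {x : R 3} (hx : x ∈ O) :
    leafForm H f' ξ' x = AffineSphere.leafForm H f ξ (φ x) := by
  ext w : 1
  rw [← h.pulled.frameMap_split hx w, h.pulled.leafForm_apply hx, h.fderiv_immersion hx, coe_comp,
    Function.comp_apply, h.eq_normal x hx, h.base.leafForm_apply (h.mapsTo x hx), h.axisForm hx,
    h.expansion hx, h.axisFun hx, h.slopeFun hx]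

end IsReparametrization

end

section

/-! ### Globalization -/

/-- It lets the sign ε = −sign ν be treated like the other invariants, as an intrinsic quantity with
zero derivative. -/
lemma _root_.hasFDerivAt_zero_sign {E : Type*} [NormedAddCommGroup E] [NormedSpace ℝ E] {g : E → ℝ}
    {x : E} (hg : ContinuousAt g x) (h0 : g x ≠ 0) :
    HasFDerivAt (fun y => -Real.sign (g y)) (0 : E →L[ℝ] ℝ) x := by
  refine (hasFDerivAt_const (-Real.sign (g x)) x).congr_of_eventuallyEq ?_
  rcases h0.lt_or_gt with h | h
  · filter_upwards [hg.eventually_lt continuousAt_const h] with y hy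
    rw [Real.sign_of_neg hy, Real.sign_of_neg h]
  · filter_upwards [continuousAt_const.eventually_lt hg h] with y hy
    rw [Real.sign_of_pos hy, Real.sign_of_pos h]

variable {M : Type*} [TopologicalSpace M] [ChartedSpace (R 3) M]

/-- `F` is an axial affine sphere with affine normal `ξ` in every chart. -/
def IsAxial (F ξ : M → R 4) (H : ℝ) : Prop :=
  ∀ e ∈ IsManifold.maximalAtlas (𝓡 3) ∞ M, IsAxialOn (F ∘ e.symm) (ξ ∘ e.symm) H e.target

theorem IsIndefiniteAffineHypersphere.isAxial {F ξ : M → R 4} {H : ℝ}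
    (hF : IsIndefiniteAffineHypersphere F ξ H) (hsym : HasPointwiseZ3OrSO2Symmetry F ξ) :
    IsAxial F ξ H := fun e he =>
  (hF.hypersphere e he).isAxialOn e.open_target (hF.lorentzian e he) (hsym e he)

/-- The quantity `𝒢` is invariant under changes of parameters. -/
def IsIntrinsic {E : Type*} (H : ℝ) (𝒢 : (R 3 → R 4) → (R 3 → R 4) → R 3 → E) : Prop :=
  ∀ ⦃f ξ : R 3 → R 4⦄ ⦃U : Set (R 3)⦄ ⦃f' ξ' : R 3 → R 4⦄ ⦃φ : R 3 → R 3⦄ ⦃O : Set (R 3)⦄,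
    IsReparametrization H f ξ U f' ξ' φ O → ∀ x ∈ O, 𝒢 f' ξ' x = 𝒢 f ξ (φ x)

/-- The function on `M` given by an intrinsic quantity. -/
def onManifold {E : Type*} (𝒢 : (R 3 → R 4) → (R 3 → R 4) → R 3 → E) (F ξ : M → R 4) (p : M) : E :=
  𝒢 (F ∘ (chartAt (R 3) p).symm) (ξ ∘ (chartAt (R 3) p).symm) (chartAt (R 3) p p)

section Manifold

variable {F ξ : M → R 4} {H : ℝ}

lemma IsAxial.isReparametrization (h : IsAxial F ξ H) {e e' : OpenPartialHomeomorph M (R 3)}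
    (he : e ∈ IsManifold.maximalAtlas (𝓡 3) ∞ M) (he' : e' ∈ IsManifold.maximalAtlas (𝓡 3) ∞ M) :
    IsReparametrization H (F ∘ e.symm) (ξ ∘ e.symm) e.target (F ∘ e'.symm) (ξ ∘ e'.symm)
      (e ∘ e'.symm) (e'.target ∩ e'.symm ⁻¹' e.source) where
  base := h e he
  pulled := (h e' he').mono (e'.symm.isOpen_inter_preimage e.open_source) Set.inter_subset_left
  smooth x hx := by
    have h1 := contMDiffAt_of_mem_maximalAtlas he hx.2
    have h2 := contMDiffAt_symm_of_mem_maximalAtlas he' hx.1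
    exact contMDiffAt_iff_contDiffAt.1 (h1.comp x h2)
  mapsTo x hx := e.map_source hx.2
  eq_immersion x hx := by simp [e.left_inv hx.2]
  eq_normal x hx := by simp [e.left_inv hx.2]

variable [IsManifold (𝓡 3) ∞ M]

lemma IsAxial.onManifold_symm (h : IsAxial F ξ H) {E : Type*}
    {𝒢 : (R 3 → R 4) → (R 3 → R 4) → R 3 → E} (h𝒢 : IsIntrinsic H 𝒢)
    {e : OpenPartialHomeomorph M (R 3)} (he : e ∈ IsManifold.maximalAtlas (𝓡 3) ∞ M) {y : R 3}
    (hy : y ∈ e.target) :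
    onManifold 𝒢 F ξ (e.symm y) = 𝒢 (F ∘ e.symm) (ξ ∘ e.symm) y := by
  set e' := chartAt (R 3) (e.symm y) with he'
  have hm : e' ∈ IsManifold.maximalAtlas (𝓡 3) ∞ M := IsManifold.chart_mem_maximalAtlas _
  have hs : e.symm y ∈ e'.source := mem_chart_source _ _
  have := h𝒢 (h.isReparametrization hm he) y ⟨hy, hs⟩
  rw [this]
  rfl

/-- An intrinsic quantity glues to one function on M. Zero derivative in every chart makes it
locally constant, and M is connected. -/
lemma IsAxial.exists_const [ConnectedSpace M] (h : IsAxial F ξ H) {E : Type*}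
    [NormedAddCommGroup E] [NormedSpace ℝ E] {𝒢 : (R 3 → R 4) → (R 3 → R 4) → R 3 → E}
    (h𝒢 : IsIntrinsic H 𝒢)
    (hd : ∀ e ∈ IsManifold.maximalAtlas (𝓡 3) ∞ M, ∀ y ∈ e.target,
      HasFDerivAt (𝒢 (F ∘ e.symm) (ξ ∘ e.symm)) (0 : R 3 →L[ℝ] E) y) :
    ∃ c, ∀ e ∈ IsManifold.maximalAtlas (𝓡 3) ∞ M, ∀ y ∈ e.target,
      𝒢 (F ∘ e.symm) (ξ ∘ e.symm) y = c := by
  have hl : IsLocallyConstant (onManifold 𝒢 F ξ) := by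
    refine (IsLocallyConstant.iff_eventually_eq _).2 fun p => ?_
    set e := chartAt (R 3) p
    have he : e ∈ IsManifold.maximalAtlas (𝓡 3) ∞ M := IsManifold.chart_mem_maximalAtlas _
    have hp : p ∈ e.source := mem_chart_source _ _
    obtain ⟨r, hr, hb⟩ := Metric.isOpen_iff.1 e.open_target (e p) (e.map_source hp)
    have hn : e.source ∩ e ⁻¹' Metric.ball (e p) r ∈ 𝓝 p :=
      Filter.inter_mem (e.open_source.mem_nhds hp)
        ((e.continuousAt hp).preimage_mem_nhds (Metric.ball_mem_nhds _ hr))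
    filter_upwards [hn] with q hq
    have key : ∀ z ∈ Metric.ball (e p) r, onManifold 𝒢 F ξ (e.symm z)
        = 𝒢 (F ∘ e.symm) (ξ ∘ e.symm) z := fun z hz => h.onManifold_symm h𝒢 he (hb hz)
    have e1 := key _ hq.2
    have e2 := key _ (Metric.mem_ball_self hr)
    rw [e.left_inv hq.1] at e1
    rw [e.left_inv hp] at e2
    rw [e1, e2]
    refine (convex_ball (e p) r).is_const_of_fderivWithin_eq_zero (𝕜 := ℝ)
      (fun z hz => (hd e he z (hb hz)).differentiableAt.differentiableWithinAt) (fun z hz => ?_) hq.2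
      (Metric.mem_ball_self hr)
    rw [fderivWithin_of_isOpen Metric.isOpen_ball hz, (hd e he z (hb hz)).fderiv]
  obtain ⟨p₀⟩ := (inferInstance : Nonempty M)
  refine ⟨onManifold 𝒢 F ξ p₀, fun e he y hy => ?_⟩
  rw [← h.onManifold_symm h𝒢 he hy]
  exact hl.apply_eq_of_isPreconnected isPreconnected_univ trivial trivial

/-- The global constants of an axial affine sphere with `ν ≠ 0`. -/
structure SplitData (F ξ : M → R 4) (H : ℝ) where
  k : ℝ
  ε : ℝ
  dir : R 4
  form : R 4 →L[ℝ] ℝ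
  center : R 4
  axial : IsAxial F ξ H
  k_ne_zero : k ≠ 0
  sign : ε = 1 ∨ ε = -1
  nu_ne_zero : ∀ e ∈ IsManifold.maximalAtlas (𝓡 3) ∞ M, ∀ y ∈ e.target,
    nuFun H (F ∘ e.symm) (ξ ∘ e.symm) y ≠ 0
  abs_nu : ∀ e ∈ IsManifold.maximalAtlas (𝓡 3) ∞ M, ∀ y ∈ e.target,
    |nuFun H (F ∘ e.symm) (ξ ∘ e.symm) y| = -(ε * nuFun H (F ∘ e.symm) (ξ ∘ e.symm) y)
  nu_sq : ∀ e ∈ IsManifold.maximalAtlas (𝓡 3) ∞ M, ∀ y ∈ e.target,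
    nuFun H (F ∘ e.symm) (ξ ∘ e.symm) y ^ 2 = k * axisFun (F ∘ e.symm) (ξ ∘ e.symm) y
  polarDir_eq : ∀ e ∈ IsManifold.maximalAtlas (𝓡 3) ∞ M, ∀ y ∈ e.target,
    polarDir H (F ∘ e.symm) (ξ ∘ e.symm) y = dir
  leafForm_eq : ∀ e ∈ IsManifold.maximalAtlas (𝓡 3) ∞ M, ∀ y ∈ e.target,
    leafForm H (F ∘ e.symm) (ξ ∘ e.symm) y = form
  position : ∀ e ∈ IsManifold.maximalAtlas (𝓡 3) ∞ M, ∀ y ∈ e.target,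
    F (e.symm y) = center + form (F (e.symm y)) • dir
      + (nuFun H (F ∘ e.symm) (ξ ∘ e.symm) y)⁻¹ • radialVec (F ∘ e.symm) (ξ ∘ e.symm) y

/-- The constancy of ν²/a comes first: it carries ν ≠ 0 from one point to all of M. The sign, the
direction, the covector and the base point of the line of centres are then constant for the same
reason. -/
theorem IsAxial.exists_splitData [ConnectedSpace M] (h : IsAxial F ξ H)
    (hν : ∃ e ∈ IsManifold.maximalAtlas (𝓡 3) ∞ M, ∃ y ∈ e.target,
      nuFun H (F ∘ e.symm) (ξ ∘ e.symm) y ≠ 0) : Nonempty (SplitData F ξ H) := by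
  obtain ⟨k, hk⟩ := h.exists_const (𝒢 := fun f ξ x => nuFun H f ξ x ^ 2 * (axisFun f ξ x)⁻¹)
    (fun f ξ U f' ξ' φ O hr x hx => by simp only [hr.nuFun hx, hr.axisFun hx])
    fun e he y hy => (h e he).hasFDerivAt_nuFun_sq_div hy
  have ha : ∀ e ∈ IsManifold.maximalAtlas (𝓡 3) ∞ M, ∀ y ∈ e.target,
      axisFun (F ∘ e.symm) (ξ ∘ e.symm) y ≠ 0 := fun e he y hy => ((h e he).isAxis hy).pos.ne'
  have hk0 : k ≠ 0 := by
    obtain ⟨e, he, y, hy, hn⟩ := hν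
    rw [← hk e he y hy]
    exact mul_ne_zero (pow_ne_zero 2 hn) (inv_ne_zero (ha e he y hy))
  have hν' : ∀ e ∈ IsManifold.maximalAtlas (𝓡 3) ∞ M, ∀ y ∈ e.target,
      nuFun H (F ∘ e.symm) (ξ ∘ e.symm) y ≠ 0 := by
    intro e he y hy h0
    have := hk e he y hy
    rw [h0] at this
    exact hk0 (by rw [← this]; simp)
  obtain ⟨ε, hε⟩ := h.exists_const (𝒢 := fun f ξ x => -Real.sign (nuFun H f ξ x))
    (fun f ξ U f' ξ' φ O hr x hx => by simp only [hr.nuFun hx])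
    fun e he y hy => hasFDerivAt_zero_sign ((h e he).hasFDerivAt_nuFun hy).continuousAt
      (hν' e he y hy)
  obtain ⟨d, hd⟩ := h.exists_const (𝒢 := polarDir H) (fun f ξ U f' ξ' φ O hr x hx => hr.polarDir hx)
    fun e he y hy => (h e he).hasFDerivAt_polarDir hy (hν' e he y hy)
  obtain ⟨l, hl⟩ := h.exists_const (𝒢 := leafForm H) (fun f ξ U f' ξ' φ O hr x hx => hr.leafForm hx)
    fun e he y hy => (h e he).hasFDerivAt_leafForm (hν' e he) hy
  obtain ⟨C, hC⟩ := h.exists_const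
    (𝒢 := fun f ξ y => f y - (nuFun H f ξ y)⁻¹ • radialVec f ξ y - l (f y) • d)
    (fun f ξ U f' ξ' φ O hr x hx => by
      simp only [hr.nuFun hx, hr.radialVec hx, hr.eq_immersion x hx])
    fun e he y hy => (h e he).hasFDerivAt_center hy (hν' e he y hy) (hl e he y hy) (hd e he y hy)
  refine ⟨⟨k, ε, d, l, C, h, hk0, ?_, hν', fun e he y hy => ?_, fun e he y hy => ?_, hd, hl,
    fun e he y hy => ?_⟩⟩
  · obtain ⟨e, he, y, hy, hn⟩ := hν
    rw [← hε e he y hy]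
    rcases hn.lt_or_gt with h1 | h1
    · left; rw [Real.sign_of_neg h1, neg_neg]
    · right; rw [Real.sign_of_pos h1]
  · rw [← hε e he y hy]
    rcases (hν' e he y hy).lt_or_gt with h1 | h1
    · rw [Real.sign_of_neg h1, abs_of_neg h1]; ring
    · rw [Real.sign_of_pos h1, abs_of_pos h1]; ring
  · rw [← hk e he y hy, mul_assoc, inv_mul_cancel₀ (ha e he y hy), mul_one]
  · rw [← hC e he y hy]
    simp only [Function.comp_apply]
    abel

end Manifold

/-! ### The function `Γ₂₂` -/

/-- Uniqueness of the axis identifies the given T with the canonical field and a₄ with a, so Γ₂₂ is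
the umbilic factor Γ whatever the frame. -/
lemma IsAdaptedFrameOn.gamma22_eq {f ξ : R 3 → R 4} {U : Set (R 3)} {H : ℝ} {T V W : R 3 → R 3}
    {a₄ a₆ : R 3 → ℝ} (h : IsAdaptedFrameOn f ξ U T V W a₄ a₆) (hf : IsAxialOn f ξ H U) {x : R 3}
    (hx : x ∈ U) : gamma22 f ξ T V x = expansion f ξ x ∧ a₄ x = axisFun f ξ x := by
  have hax : ∀ y ∈ U, IsAxis (affineMetric f ξ y) (differenceMap f ξ y) (T y) (a₄ y) := by
    intro y hy
    have ho := h.orthonormal y hy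
    have hs := hf.metric_symm hy
    refine ⟨ho.tt, h.a₄_pos y hy, ?_, fun u hu => ?_⟩
    · rw [← hf.differenceTensor_eq hy, h.K_TT y hy]
    · rw [ho.decomp hs u, hu, map_add, map_add, map_smul, map_smul, map_smul,
        ← hf.differenceTensor_eq hy (T y) (V y), ← hf.differenceTensor_eq hy (T y) (W y), h.K_TV y hy,
        h.K_TW y hy]
      module
  have hT : ∀ y ∈ U, T y = axisField f ξ y := fun y hy => (hax y hy).eq_axis (hf.apolar y hy)
  have ha : a₄ x = axisFun f ξ x := (hax x hx).eq_axisValue (hf.apolar x hx)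
  refine ⟨?_, ha⟩
  have hd : fderiv ℝ T x = fderiv ℝ (axisField f ξ) x :=
    Filter.EventuallyEq.fderiv_eq (Filter.eventuallyEq_of_mem (hf.isOpen.mem_nhds hx) hT)
  have ho := h.orthonormal x hx
  have e1 := hf.differenceTensor_eq hx (V x) (T x)
  rw [differenceTensor, hf.inducedConnection_const hx, hf.differenceMap_symm hx,
    (hax x hx).K_perp _ ho.tv] at e1
  have e2 := hf.fderiv_axisField hx (V x)
  rw [← hT x hx, ho.tv] at e2
  have e3 : leviCivita (affineMetric f ξ) V T x = fderiv ℝ (axisField f ξ) x (V x)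
      + leviCivita (affineMetric f ξ) (fun _ => V x) (fun _ => T x) x := by
    simp [leviCivita, hd]
  have e4 : leviCivita (affineMetric f ξ) (fun _ => V x) (fun _ => T x) x
      = christoffel f ξ x (V x) (T x) - a₄ x • V x := by
    rw [← e1]; abel
  rw [gamma22, e3, eq_sub_of_add_eq e2, e4]
  simp only [map_sub, map_add, map_smul, add_apply, sub_apply, smul_apply, ho.vv, ho.tv, smul_eq_mul,
    ha]
  ring

lemma NuNeZeroSomewhere.exists_nuFun_ne_zero {F ξ : M → R 4} {H : ℝ} (hν : NuNeZeroSomewhere F ξ H)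
    (h : IsAxial F ξ H) : ∃ e ∈ IsManifold.maximalAtlas (𝓡 3) ∞ M, ∃ y ∈ e.target,
      nuFun H (F ∘ e.symm) (ξ ∘ e.symm) y ≠ 0 := by
  obtain ⟨e, he, T, V, W, a₄, a₆, hfr, y, hy, hn⟩ := hν
  refine ⟨e, he, y, hy, fun h0 => hn ?_⟩
  obtain ⟨h1, h2⟩ := hfr.gamma22_eq (h e he) hy
  rw [h1, h2]
  rw [nuFun] at h0
  linarith

end

section

/-! ### Product boxes -/

/-- The inverse function theorem, with the image cut down to a ball. In the maximum norm of the
product this ball is an interval times a disc. -/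
lemma exists_box {Φ : R 3 → ℝ × R 2} {U : Set (R 3)} {x₀ : R 3} (hU : IsOpen U) (hx₀ : x₀ ∈ U)
    (hΦ : ∀ x ∈ U, ContDiffAt ℝ ∞ Φ x) (hinj : Function.Injective (fderiv ℝ Φ x₀)) :
    ∃ (Ψ : OpenPartialHomeomorph (R 3) (ℝ × R 2)) (J : Set ℝ) (N : Set (R 2)),
      x₀ ∈ Ψ.source ∧ Ψ.source ⊆ U ∧ (∀ x, Ψ x = Φ x) ∧ Ψ.target = J ×ˢ N ∧ IsOpen J ∧ IsOpen N ∧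
      Convex ℝ J ∧ Convex ℝ N ∧ (∀ x ∈ Ψ.source, Function.Injective (fderiv ℝ Φ x)) ∧
      ∀ z ∈ Ψ.target, ContDiffAt ℝ ∞ Ψ.symm z := by
  have hfr : Module.finrank ℝ (R 3) = Module.finrank ℝ (ℝ × R 2) := by simp
  have heq : ∀ x, Function.Injective (fderiv ℝ Φ x) → ∃ A : R 3 ≃L[ℝ] ℝ × R 2,
      (A : R 3 →L[ℝ] ℝ × R 2) = fderiv ℝ Φ x := fun x hx =>
    ⟨(LinearEquiv.ofInjectiveOfFinrankEq (fderiv ℝ Φ x).toLinearMap hx hfr).toContinuousLinearEquiv,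
      ContinuousLinearMap.ext fun _ => rfl⟩
  obtain ⟨A, hA⟩ := heq x₀ hinj
  have hd : ∀ x ∈ U, HasFDerivAt Φ (fderiv ℝ Φ x) x := fun x hx =>
    ((hΦ x hx).differentiableAt (by simp)).hasFDerivAt
  have hd0 : HasFDerivAt Φ (A : R 3 →L[ℝ] ℝ × R 2) x₀ := by rw [hA]; exact hd x₀ hx₀
  let Ψ₀ := (hΦ x₀ hx₀).toOpenPartialHomeomorph Φ hd0 (by simp)
  have hcoe : ∀ x, Ψ₀ x = Φ x := fun x => rfl
  have hxs : x₀ ∈ Ψ₀.source := (hΦ x₀ hx₀).mem_toOpenPartialHomeomorph_source hd0 (by simp)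
  have hev : ∀ᶠ x in 𝓝 x₀, x ∈ U ∧ Function.Injective (fderiv ℝ Φ x) := by
    refine Filter.Eventually.and (hU.mem_nhds hx₀) ?_
    exact ((hΦ x₀ hx₀).fderiv_right (m := ∞) (by simp)).continuousAt.preimage_mem_nhds
      (ContinuousLinearMap.isOpen_injective.mem_nhds hinj)
  obtain ⟨S, hSs, hS, hxS⟩ := mem_nhds_iff.1 hev
  let Ψ₁ := Ψ₀.restrOpen S hS
  have h1s : Ψ₁.source = Ψ₀.source ∩ S := Ψ₀.restrOpen_source S hS
  have hx1 : x₀ ∈ Ψ₁.source := by rw [h1s]; exact ⟨hxs, hxS⟩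
  obtain ⟨r, hr, hb⟩ := Metric.isOpen_iff.1 Ψ₁.open_target (Ψ₁ x₀) (Ψ₁.map_source hx1)
  set J := Metric.ball (Ψ₁ x₀).1 r
  set N := Metric.ball (Ψ₁ x₀).2 r
  have hJN : Metric.ball (Ψ₁ x₀) r = J ×ˢ N := (ball_prod_same _ _ _).symm
  have hop : IsOpen (J ×ˢ N) := Metric.isOpen_ball.prod Metric.isOpen_ball
  let Ψ := (Ψ₁.symm.restrOpen (J ×ˢ N) hop).symm
  have ht : Ψ.target = J ×ˢ N := by
    change (Ψ₁.symm.restrOpen (J ×ˢ N) hop).source = _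
    rw [Ψ₁.symm.restrOpen_source]
    exact Set.inter_eq_right.2 (hJN ▸ hb)
  have hsub : Ψ.source ⊆ Ψ₁.source := by
    change (Ψ₁.symm.restrOpen (J ×ˢ N) hop).target ⊆ _
    exact Set.inter_subset_left
  have hc : ∀ x, Ψ x = Φ x := fun x => rfl
  have hsS : ∀ x ∈ Ψ.source, x ∈ U ∧ Function.Injective (fderiv ℝ Φ x) := fun x hx => by
    have := hsub hx
    rw [h1s] at this
    exact hSs this.2
  refine ⟨Ψ, J, N, ?_, fun x hx => (hsS x hx).1, hc, ht, Metric.isOpen_ball, Metric.isOpen_ball,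
    convex_ball _ _, convex_ball _ _, fun x hx => (hsS x hx).2, fun z hz => ?_⟩
  · have : x₀ = Ψ.symm (Ψ₁ x₀) := (Ψ₁.left_inv hx1).symm
    rw [this]
    refine Ψ.map_target ?_
    rw [ht, ← hJN]
    exact Metric.mem_ball_self hr
  · obtain ⟨hU', hi⟩ := hsS _ (Ψ.map_target hz)
    obtain ⟨B, hB⟩ := heq _ hi
    refine Ψ.contDiffAt_symm hz (f₀' := B) ?_ (hΦ _ hU')
    rw [hB]
    exact hd _ hU'

/-! ### Adapted linear coordinates -/

/-- Coordinates of `ℝ⁴` in which `l` is the first coordinate, `d` the first basis vector, and the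
other coordinates are volume preserving. -/
lemma exists_coordinates {l : R 4 →L[ℝ] ℝ} {d : R 4} (hd : l d = 1) :
    ∃ (P : R 4 →L[ℝ] R 3) (S : R 3 →L[ℝ] R 4), P d = 0 ∧ (∀ b, P (S b) = b) ∧ (∀ b, l (S b) = 0) ∧
      (∀ w, w = l w • d + S (P w)) ∧
      ∀ b : Fin 3 → R 3, |volForm 4 (Matrix.vecCons d fun i => S (b i))| = |volForm 3 b| := by
  have hsurj : Function.Surjective l.toLinearMap := fun c => ⟨c • d, by simp [hd]⟩
  have hker : Module.finrank ℝ (LinearMap.ker l.toLinearMap) = 3 := by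
    have h1 := LinearMap.finrank_range_add_finrank_ker l.toLinearMap
    rw [LinearMap.range_eq_top.2 hsurj] at h1
    simp at h1
    omega
  obtain ⟨E⟩ : Nonempty (LinearMap.ker l.toLinearMap ≃ₗ[ℝ] R 3) :=
    ⟨LinearEquiv.ofFinrankEq _ _ (by rw [hker]; simp)⟩
  let S₀ : R 3 →ₗ[ℝ] R 4 := (LinearMap.ker l.toLinearMap).subtype ∘ₗ E.symm.toLinearMap
  let Q : R 4 →ₗ[ℝ] LinearMap.ker l.toLinearMap :=
    LinearMap.codRestrict _ (LinearMap.id - l.toLinearMap.smulRight d) fun w => by simp [hd]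
  let P₀ : R 4 →ₗ[ℝ] R 3 := E.toLinearMap ∘ₗ Q
  have hlS : ∀ b, l (S₀ b) = 0 := fun b => (E.symm b).2
  have hQ : ∀ w, (Q w : R 4) = w - l w • d := fun w => rfl
  have hQS : ∀ b, Q (S₀ b) = E.symm b := fun b => Subtype.ext (by rw [hQ, hlS, zero_smul, sub_zero]; rfl)
  have hPS : ∀ b, P₀ (S₀ b) = b := fun b => by simp [P₀, hQS b]
  have hPd : P₀ d = 0 := by
    have : Q d = 0 := Subtype.ext (by rw [hQ, hd, one_smul, sub_self]; rfl)
    simp [P₀, this]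
  have hSP : ∀ w, w = l w • d + S₀ (P₀ w) := fun w => by
    have : S₀ (P₀ w) = w - l w • d := by rw [← hQ]; simp [S₀, P₀]
    rw [this]; abel
  let B := (EuclideanSpace.basisFun (Fin 3) ℝ).toBasis
  let A := ((volForm 4).curryLeft d).compLinearMap S₀
  set c := A B with hc
  have hA : ∀ b : Fin 3 → R 3, volForm 4 (Matrix.vecCons d fun i => S₀ (b i)) = c * volForm 3 b := by
    intro b
    have : A = A B • B.det := A.eq_smul_basis_det B
    exact DFunLike.congr_fun this b
  have hc0 : c ≠ 0 := by
    intro h0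
    have hli : LinearIndependent ℝ (Matrix.vecCons d fun i => S₀ (B i)) := by
      rw [Fintype.linearIndependent_iff]
      intro g hg
      simp only [Fin.sum_univ_succ (n := 3), Matrix.cons_val_zero, Matrix.cons_val_succ] at hg
      have h1 := congrArg l hg
      simp only [map_add, map_smul, map_sum, hd, hlS, Finset.sum_const_zero, smul_eq_mul, mul_zero,
        mul_one, add_zero, map_zero] at h1
      have h2 := congrArg P₀ hg
      simp only [map_add, map_smul, map_sum, hPd, hPS, smul_zero, zero_add, map_zero] at h2
      have h3 := Fintype.linearIndependent_iff.1 B.linearIndependent _ h2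
      intro i
      refine Fin.cases h1 h3 i
    have hdet := (Module.Basis.isUnit_det (EuclideanSpace.basisFun (Fin 4) ℝ).toBasis
      (basisOfLinearIndependentOfCardEqFinrank hli (by simp))).ne_zero
    refine hdet ?_
    rw [coe_basisOfLinearIndependentOfCardEqFinrank]
    have := hA B
    rw [h0, zero_mul] at this
    exact this
  -- This is |c|^(−1/3), since the real logarithm sees only |c|; rescaling three vectors by t
  -- normalizes the volume.
  let t : ℝ := Real.exp (-Real.log c / 3)
  have ht : 0 < t := Real.exp_pos _
  have ht3 : t ^ 3 * |c| = 1 := by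
    rw [← Real.exp_nat_mul, ← Real.exp_log_eq_abs hc0, ← Real.exp_add]
    rw [Real.exp_eq_one_iff]
    push_cast
    ring
  refine ⟨t⁻¹ • P₀.toContinuousLinearMap, t • S₀.toContinuousLinearMap, by simp [hPd], fun b => ?_,
    fun b => by simp [hlS], fun w => ?_, fun b => ?_⟩
  · simp [hPS, smul_smul, ht.ne']
  · simp only [smul_apply, LinearMap.coe_toContinuousLinearMap', map_smul, smul_smul,
      inv_mul_cancel₀ ht.ne', one_smul]
    exact hSP w
  · have := hA fun i => t • b i
    simp only [map_smul] at this
    simp only [smul_apply, LinearMap.coe_toContinuousLinearMap']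
    rw [this, (volForm 3).map_smul_univ (fun _ => t) b]
    simp only [Finset.prod_const, Finset.card_univ, Fintype.card_fin, smul_eq_mul, abs_mul,
      abs_of_pos (pow_pos ht 3)]
    linear_combination |volForm 3 b| * ht3

/-! ### The scale function -/

variable {f ξ : R 3 → R 4} {U : Set (R 3)} {H : ℝ}

/-- The scaling factor of the leaves. -/
def scaleFun (H : ℝ) (f ξ : R 3 → R 4) (x : R 3) : ℝ :=
  Real.exp (-Real.log (rhoFun H f ξ x * nuFun H f ξ x) / 3)

/-- The position vector of the normalized leaves. -/
def leafVec (H : ℝ) (f ξ : R 3 → R 4) (x : R 3) : R 4 :=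
  (nuFun H f ξ x * scaleFun H f ξ x)⁻¹ • radialVec f ξ x

lemma scaleFun_pos (H : ℝ) (f ξ : R 3 → R 4) (x : R 3) : 0 < scaleFun H f ξ x := Real.exp_pos _

namespace IsAxialOn

/-- The real logarithm ignores the sign of ν, so the factor is (ρ|ν|)^(−1/3). This is the
normalization needed for the Blaschke volume condition of a leaf. -/
lemma scaleFun_pow (h : IsAxialOn f ξ H U) {x : R 3} (hx : x ∈ U) (hν : nuFun H f ξ x ≠ 0) :
    scaleFun H f ξ x ^ 3 * (rhoFun H f ξ x * |nuFun H f ξ x|) = 1 := by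
  have hρ := h.rhoFun_pos hx hν
  rw [scaleFun, ← Real.exp_nat_mul, ← abs_of_pos hρ, ← abs_mul, abs_of_pos hρ,
    ← Real.exp_log_eq_abs (mul_ne_zero hρ.ne' hν), ← Real.exp_add, Real.exp_eq_one_iff]
  push_cast
  ring

lemma hasFDerivAt_scaleFun (h : IsAxialOn f ξ H U) {x : R 3} (hx : x ∈ U)
    (hν : nuFun H f ξ x ≠ 0) : HasFDerivAt (scaleFun H f ξ)
      ((-((expansion f ξ x + axisFun f ξ x) * scaleFun H f ξ x)) • axisForm f ξ x) x := by
  have hρ := (h.rhoFun_pos hx hν).ne'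
  have h1 := (((h.hasFDerivAt_rhoFun hx hν).mul (h.hasFDerivAt_nuFun hx)).log
    (mul_ne_zero hρ hν)).neg.mul_const (3⁻¹ : ℝ)
  refine HasFDerivAt.congr_apply h1.exp fun u => ?_
  simp only [scaleFun, add_apply, smul_apply, neg_apply, smul_eq_mul, Pi.neg_apply, Pi.mul_apply,
    Pi.smul_apply, div_eq_mul_inv]
  field_simp
  ring

/-- The logarithmic rates Γ − a of the radial vector, −2Γ of 1/ν and Γ + a of the inverse scale add
up to zero. The derivative therefore annihilates T, and the vector is transported unchanged from
leaf to leaf. -/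
lemma hasFDerivAt_leafVec (h : IsAxialOn f ξ H U) {x : R 3} (hx : x ∈ U)
    (hν : nuFun H f ξ x ≠ 0) : HasFDerivAt (leafVec H f ξ) ((scaleFun H f ξ x)⁻¹ •
      (fderiv ℝ f x + (axisForm f ξ x).smulRight (axisVec f ξ x))) x := by
  have hy := (scaleFun_pos H f ξ x).ne'
  refine HasFDerivAt.congr_apply (((hasDerivAt_inv (mul_ne_zero hν hy)).comp_hasFDerivAt x
    ((h.hasFDerivAt_nuFun hx).mul (h.hasFDerivAt_scaleFun hx hν))).smul
    (h.hasFDerivAt_radialVec hx)) fun u => ?_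
  simp only [add_apply, smul_apply, smulRight_apply, smul_eq_mul, Function.comp_apply, smul_add,
    smul_smul, Pi.mul_apply]
  match_scalars <;> field_simp <;> ring

lemma contDiffAt_axisVec (h : IsAxialOn f ξ H U) {x : R 3} (hx : x ∈ U) :
    ContDiffAt ℝ ∞ (axisVec f ξ) x := (h.contDiffAt_fderiv hx).clm_apply (h.contDiffAt_axisField hx)

lemma contDiffAt_polarVec (h : IsAxialOn f ξ H U) {x : R 3} (hx : x ∈ U) :
    ContDiffAt ℝ ∞ (polarVec H f ξ) x := by
  have h1 := (contDiffAt_const (c := H)).smul (h.contDiffAt_axisVec hx)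
  have h2 := ((h.contDiffAt_expansion hx).add (h.contDiffAt_axisFun hx)).smul (h.contDiffAt_normal hx)
  exact h1.add h2

lemma contDiffAt_radialVec (h : IsAxialOn f ξ H U) {x : R 3} (hx : x ∈ U) :
    ContDiffAt ℝ ∞ (radialVec f ξ) x := by
  have h1 := ((h.contDiffAt_expansion hx).sub (h.contDiffAt_axisFun hx)).smul
    (h.contDiffAt_axisVec hx)
  exact h1.add (h.contDiffAt_normal hx)

lemma contDiffAt_nuFun (h : IsAxialOn f ξ H U) {x : R 3} (hx : x ∈ U) :
    ContDiffAt ℝ ∞ (nuFun H f ξ) x :=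
  (((h.contDiffAt_expansion hx).pow 2).sub ((h.contDiffAt_axisFun hx).pow 2)).sub contDiffAt_const

lemma contDiffAt_rhoFun (h : IsAxialOn f ξ H U) {x : R 3} (hx : x ∈ U) (hν : nuFun H f ξ x ≠ 0) :
    ContDiffAt ℝ ∞ (rhoFun H f ξ) x :=
  (h.contDiffAt_polarVec hx).norm ℝ (h.polarVec_ne_zero hx hν)

lemma contDiffAt_scaleFun (h : IsAxialOn f ξ H U) {x : R 3} (hx : x ∈ U)
    (hν : nuFun H f ξ x ≠ 0) : ContDiffAt ℝ ∞ (scaleFun H f ξ) x :=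
  ((((h.contDiffAt_rhoFun hx hν).mul (h.contDiffAt_nuFun hx)).log
    (mul_ne_zero (h.rhoFun_pos hx hν).ne' hν)).neg.div_const 3).exp

lemma contDiffAt_leafVec (h : IsAxialOn f ξ H U) {x : R 3} (hx : x ∈ U)
    (hν : nuFun H f ξ x ≠ 0) : ContDiffAt ℝ ∞ (leafVec H f ξ) x :=
  (((h.contDiffAt_nuFun hx).mul (h.contDiffAt_scaleFun hx hν)).inv
    (mul_ne_zero hν (scaleFun_pos H f ξ x).ne')).smul (h.contDiffAt_radialVec hx)

end IsAxialOn

end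

section

/-! ### Boxes adapted to the foliation by the level sets of `l ∘ f` -/

/-- On `U`, the invariants `ν`, `d` and `l` of an axial affine sphere are `≠ 0`, `d`, `l`. -/
structure IsSplitOn (f ξ : R 3 → R 4) (H : ℝ) (U : Set (R 3)) (l : R 4 →L[ℝ] ℝ) (d : R 4) : Prop
    extends IsAxialOn f ξ H U where
  nu_ne_zero : ∀ x ∈ U, nuFun H f ξ x ≠ 0
  polarDir_eq : ∀ x ∈ U, polarDir H f ξ x = d
  leafForm_eq : ∀ x ∈ U, leafForm H f ξ x = l

/-- `l` and `P` are coordinates of `ℝ⁴` such that `d` is the first basis vector. -/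
structure IsCoordinates (l : R 4 →L[ℝ] ℝ) (d : R 4) (P : R 4 →L[ℝ] R 3) (S : R 3 →L[ℝ] R 4) :
    Prop where
  l_d : l d = 1
  P_d : P d = 0
  P_S : ∀ b, P (S b) = b
  l_S : ∀ b, l (S b) = 0
  decomp : ∀ w, w = l w • d + S (P w)
  volume : ∀ b : Fin 3 → R 3, |volForm 4 (Matrix.vecCons d fun i => S (b i))| = |volForm 3 b|

/-- The coordinates `Ψ` on a product box have first coordinate `l ∘ f`, and the leaves differ by
homotheties. -/
structure IsLeafBox (f ξ : R 3 → R 4) (H : ℝ) (U : Set (R 3)) (l : R 4 →L[ℝ] ℝ)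
    (P : R 4 →L[ℝ] R 3) (Ψ : OpenPartialHomeomorph (R 3) (ℝ × R 2)) (J : Set ℝ) (N : Set (R 2)) :
    Prop where
  source_subset : Ψ.source ⊆ U
  target_eq : Ψ.target = J ×ˢ N
  isOpen_J : IsOpen J
  isOpen_N : IsOpen N
  convex_J : Convex ℝ J
  convex_N : Convex ℝ N
  contDiffAt : ∀ x ∈ Ψ.source, ContDiffAt ℝ ∞ Ψ x
  contDiffAt_symm : ∀ z ∈ Ψ.target, ContDiffAt ℝ ∞ Ψ.symm z
  fst_eq : ∀ x ∈ Ψ.source, (Ψ x).1 = l (f x)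
  leafVec_eq : ∀ t ∈ J, ∀ t' ∈ J, ∀ n ∈ N,
    P (leafVec H f ξ (Ψ.symm (t, n))) = P (leafVec H f ξ (Ψ.symm (t', n)))

variable {f ξ : R 3 → R 4} {H : ℝ} {U : Set (R 3)} {l : R 4 →L[ℝ] ℝ} {d : R 4}
  {P : R 4 →L[ℝ] R 3} {S : R 3 →L[ℝ] R 4}

namespace IsSplitOn

lemma slope_ne_zero (h : IsSplitOn f ξ H U l d) {x : R 3} (hx : x ∈ U) : slopeFun H f ξ x ≠ 0 :=
  mul_ne_zero (h.rhoFun_pos hx (h.nu_ne_zero x hx)).ne' (inv_ne_zero (h.nu_ne_zero x hx))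

lemma l_tangent (h : IsSplitOn f ξ H U l d) {x : R 3} (hx : x ∈ U) (u : R 3) :
    l (fderiv ℝ f x u) = slopeFun H f ξ x * axisForm f ξ x u := by
  rw [← h.leafForm_eq x hx, h.leafForm_tangent hx]

lemma l_radialVec (h : IsSplitOn f ξ H U l d) {x : R 3} (hx : x ∈ U) : l (radialVec f ξ x) = 0 := by
  rw [← h.leafForm_eq x hx, h.leafForm_radialVec hx]

lemma l_leafVec (h : IsSplitOn f ξ H U l d) {x : R 3} (hx : x ∈ U) : l (leafVec H f ξ x) = 0 := by
  rw [leafVec, map_smul, h.l_radialVec hx, smul_zero]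

lemma eq_zero (h : IsSplitOn f ξ H U l d) (hc : IsCoordinates l d P S) {x : R 3} (hx : x ∈ U)
    {u : R 3} (h1 : axisForm f ξ x u = 0) (h2 : P (fderiv ℝ f x u) = 0) : u = 0 := by
  have e := hc.decomp (fderiv ℝ f x u)
  rw [h2, h.l_tangent hx, h1, mul_zero, zero_smul, map_zero, add_zero] at e
  have e' : fderiv ℝ f x u + (0 : ℝ) • ξ x = fderiv ℝ f x 0 + (0 : ℝ) • ξ x := by simp [e]
  exact (h.eq_of_frame_eq hx e').1

lemma hasFDerivAt_P_leafVec (h : IsSplitOn f ξ H U l d) {x : R 3} (hx : x ∈ U) :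
    HasFDerivAt (fun y => P (leafVec H f ξ y)) ((scaleFun H f ξ x)⁻¹ •
      P.comp (fderiv ℝ f x + (axisForm f ξ x).smulRight (axisVec f ξ x))) x := by
  refine HasFDerivAt.congr_apply (P.hasFDerivAt.comp x
    (h.hasFDerivAt_leafVec hx (h.nu_ne_zero x hx))) fun u => ?_
  simp

/-- The coordinates are l∘f and two linear functions of P applied to `leafVec`. The latter are
constant along T, so the coordinate lines in the first variable are tangent to T and the normalized
leaf position does not depend on t. -/
lemma exists_leafBox (h : IsSplitOn f ξ H U l d) (hc : IsCoordinates l d P S) {x₀ : R 3}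
    (hx₀ : x₀ ∈ U) : ∃ Ψ J N, IsLeafBox f ξ H U l P Ψ J N ∧ x₀ ∈ Ψ.source := by
  set τ := axisForm f ξ x₀ with hτ
  let K := LinearMap.ker τ.toLinearMap
  have hker : Module.finrank ℝ K = 2 := by
    have hs : Function.Surjective τ.toLinearMap := fun c =>
      ⟨-c • axisField f ξ x₀, by simp [hτ, h.axisForm_self hx₀]⟩
    have h1 := LinearMap.finrank_range_add_finrank_ker τ.toLinearMap
    rw [LinearMap.range_eq_top.2 hs] at h1
    simp at h1
    change Module.finrank ℝ (LinearMap.ker τ.toLinearMap) = 2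
    omega
  obtain ⟨E⟩ : Nonempty (K ≃ₗ[ℝ] R 2) := ⟨LinearEquiv.ofFinrankEq _ _ (by rw [hker]; simp)⟩
  let g : K →ₗ[ℝ] R 3 := (P.comp (fderiv ℝ f x₀)).toLinearMap ∘ₗ K.subtype
  have hg : LinearMap.ker g = ⊥ := by
    refine LinearMap.ker_eq_bot'.2 fun u hu => Subtype.ext ?_
    exact h.eq_zero hc hx₀ u.2 hu
  obtain ⟨Q₀, hQ₀⟩ := g.exists_leftInverse_of_injective hg
  let Q : R 3 →L[ℝ] R 2 := (E.toLinearMap ∘ₗ Q₀).toContinuousLinearMap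
  have hQ : ∀ u : R 3, τ u = 0 → Q (P (fderiv ℝ f x₀ u)) = 0 → u = 0 := by
    intro u h1 h2
    have e : Q₀ (g ⟨u, h1⟩) = ⟨u, h1⟩ := LinearMap.congr_fun hQ₀ ⟨u, h1⟩
    have e2 : E (Q₀ (g ⟨u, h1⟩)) = 0 := h2
    rw [e, map_eq_zero_iff E E.injective] at e2
    exact congrArg Subtype.val e2
  let Φ : R 3 → ℝ × R 2 := fun x => (l (f x), Q (P (leafVec H f ξ x)))
  have hΦd : ∀ x ∈ U, ∀ u, fderiv ℝ Φ x u = (slopeFun H f ξ x * axisForm f ξ x u,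
      (scaleFun H f ξ x)⁻¹ • Q (P (fderiv ℝ f x (u + axisForm f ξ x u • axisField f ξ x)))) := by
    intro x hx u
    have h1 := (l.hasFDerivAt.comp x (h.hasFDerivAt_immersion hx)).prodMk
      (Q.hasFDerivAt.comp x (h.hasFDerivAt_P_leafVec (P := P) hx))
    change fderiv ℝ (fun y => _) x u = _
    refine (DFunLike.congr_fun h1.fderiv u).trans ?_
    simp [h.l_tangent hx, axisVec]
  have hΦ : ∀ x ∈ U, ContDiffAt ℝ ∞ Φ x := by
    intro x hx
    have h1 : ContDiffAt ℝ ∞ (fun y => l (f y)) x := l.contDiff.contDiffAt.comp x (h.contDiffAt hx)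
    have h2 : ContDiffAt ℝ ∞ (fun y => P (leafVec H f ξ y)) x :=
      P.contDiff.contDiffAt.comp x (h.contDiffAt_leafVec hx (h.nu_ne_zero x hx))
    exact h1.prodMk (Q.contDiff.contDiffAt.comp x h2)
  have hinj : Function.Injective (fderiv ℝ Φ x₀) := by
    refine (injective_iff_map_eq_zero _).2 fun u hu => ?_
    rw [hΦd x₀ hx₀, Prod.mk_eq_zero] at hu
    have h1 : τ u = 0 := (mul_eq_zero.1 hu.1).resolve_left (h.slope_ne_zero hx₀)
    have h2 := (smul_eq_zero.1 hu.2).resolve_left (inv_ne_zero (scaleFun_pos H f ξ x₀).ne')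
    rw [← hτ, h1, zero_smul, add_zero] at h2
    exact hQ u h1 h2
  obtain ⟨Ψ, J, N, hxs, hsU, hΨ, ht, hJ, hN, hJc, hNc, hi, hsm⟩ := exists_box h.isOpen hx₀ hΦ hinj
  have hΨ' : (Ψ : R 3 → ℝ × R 2) = Φ := funext hΨ
  refine ⟨Ψ, J, N, ⟨hsU, ht, hJ, hN, hJc, hNc, fun x hx => hΨ' ▸ hΦ x (hsU hx), hsm,
    fun x hx => by rw [hΨ], fun t htJ t' htJ' n hn => ?_⟩, hxs⟩
  have hd : ∀ t ∈ J, HasDerivAt (fun t => P (leafVec H f ξ (Ψ.symm (t, n)))) 0 t := by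
    intro t htJ
    have hz : (t, n) ∈ Ψ.target := by rw [ht]; exact ⟨htJ, hn⟩
    have hxs := Ψ.map_target hz
    have hx := hsU hxs
    have hsd := ((hsm _ hz).differentiableAt (by simp)).hasFDerivAt
    have h1 : HasDerivAt (fun t : ℝ => Ψ.symm (t, n)) (fderiv ℝ Ψ.symm (t, n) (1, 0)) t :=
      hsd.comp_hasDerivAt t ((hasDerivAt_id t).prodMk (hasDerivAt_const t n))
    set x := Ψ.symm (t, n)
    set u := fderiv ℝ Ψ.symm (t, n) (1, 0)
    have h2 : fderiv ℝ Φ x u = (1, 0) := by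
      have e1 := ((hΦ x hx).differentiableAt (by simp)).hasFDerivAt.comp_hasDerivAt t h1
      have e2 : HasDerivAt (Φ ∘ fun t : ℝ => Ψ.symm (t, n)) ((1 : ℝ), (0 : R 2)) t := by
        refine ((hasDerivAt_id t).prodMk (hasDerivAt_const t n)).congr_of_eventuallyEq ?_
        filter_upwards [hJ.mem_nhds htJ] with s hs
        have : (s, n) ∈ Ψ.target := by rw [ht]; exact ⟨hs, hn⟩
        simp only [Function.comp_apply, id]
        rw [← hΨ, Ψ.right_inv this]
      exact e1.unique e2
    -- This vector is the T^⊥-part of the coordinate vector u; both components of dΦ vanish on it,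
    -- so u is a multiple of T.
    have h3 : u + axisForm f ξ x u • axisField f ξ x = 0 := by
      apply hi x hxs
      rw [hΦd x hx] at h2
      rw [hΦd x hx]
      have h4 := congrArg Prod.snd h2
      have h6 : axisForm f ξ x (u + axisForm f ξ x u • axisField f ξ x) = 0 := by
        simp [h.axisForm_self hx]
      rw [h6, mul_zero, zero_smul, add_zero, map_zero]
      exact Prod.ext rfl h4
    refine ((h.hasFDerivAt_P_leafVec (P := P) hx).comp_hasDerivAt t h1).congr_deriv ?_
    have h5 : fderiv ℝ f x u + axisForm f ξ x u • axisVec f ξ x = 0 := by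
      rw [axisVec, ← map_smul, ← map_add, h3, map_zero]
    simp only [smul_apply, comp_apply, add_apply, smulRight_apply, h5, map_zero, smul_zero]
  refine hJc.is_const_of_fderivWithin_eq_zero (𝕜 := ℝ)
    (f := fun t => P (leafVec H f ξ (Ψ.symm (t, n))))
    (fun s hs => (hd s hs).differentiableAt.differentiableWithinAt) (fun s hs => ?_) htJ htJ'
  rw [fderivWithin_of_isOpen hJ hs, (hd s hs).hasFDerivAt.fderiv]
  ext; simp

end IsSplitOn

/-! ### Calculus in a leaf box: along the leaves and across them. -/

namespace IsLeafBox

variable {Ψ : OpenPartialHomeomorph (R 3) (ℝ × R 2)} {J : Set ℝ} {N : Set (R 2)}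

lemma mem_target (b : IsLeafBox f ξ H U l P Ψ J N) {t : ℝ} {n : R 2} (ht : t ∈ J) (hn : n ∈ N) :
    (t, n) ∈ Ψ.target := by rw [b.target_eq]; exact ⟨ht, hn⟩

lemma symm_mem (b : IsLeafBox f ξ H U l P Ψ J N) {t : ℝ} {n : R 2} (ht : t ∈ J) (hn : n ∈ N) :
    Ψ.symm (t, n) ∈ U := b.source_subset (Ψ.map_target (b.mem_target ht hn))

lemma l_symm (b : IsLeafBox f ξ H U l P Ψ J N) {t : ℝ} {n : R 2} (ht : t ∈ J) (hn : n ∈ N) :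
    l (f (Ψ.symm (t, n))) = t := by
  rw [← b.fst_eq _ (Ψ.map_target (b.mem_target ht hn)), Ψ.right_inv (b.mem_target ht hn)]

lemma hasFDerivAt_symm (b : IsLeafBox f ξ H U l P Ψ J N) {t : ℝ} {n : R 2} (ht : t ∈ J)
    (hn : n ∈ N) : HasFDerivAt Ψ.symm (fderiv ℝ Ψ.symm (t, n)) (t, n) :=
  ((b.contDiffAt_symm _ (b.mem_target ht hn)).differentiableAt (by simp)).hasFDerivAt

lemma fderiv_symm_injective (b : IsLeafBox f ξ H U l P Ψ J N) {t : ℝ} {n : R 2} (ht : t ∈ J)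
    (hn : n ∈ N) : Function.Injective (fderiv ℝ Ψ.symm (t, n)) := by
  have hz := b.mem_target ht hn
  have h1 := ((b.contDiffAt _ (Ψ.map_target hz)).differentiableAt (by simp)).hasFDerivAt.comp _
    (b.hasFDerivAt_symm ht hn)
  have h2 : HasFDerivAt (Ψ ∘ Ψ.symm) (ContinuousLinearMap.id ℝ (ℝ × R 2)) (t, n) :=
    (hasFDerivAt_id _).congr_of_eventuallyEq
      (Filter.eventuallyEq_of_mem (Ψ.open_target.mem_nhds hz) fun z hz => Ψ.right_inv hz)
  have h3 := h1.unique h2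
  exact Function.LeftInverse.injective (g := fderiv ℝ Ψ (Ψ.symm (t, n))) fun u =>
    DFunLike.congr_fun h3 u

lemma slope_axisForm (b : IsLeafBox f ξ H U l P Ψ J N) (h : IsSplitOn f ξ H U l d) {t : ℝ} {n : R 2}
    (ht : t ∈ J) (hn : n ∈ N) (u : ℝ × R 2) : slopeFun H f ξ (Ψ.symm (t, n))
      * axisForm f ξ (Ψ.symm (t, n)) (fderiv ℝ Ψ.symm (t, n) u) = u.1 := by
  have hz := b.mem_target ht hn
  have hx := b.symm_mem ht hn
  have h1 := l.hasFDerivAt.comp (t, n)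
    ((h.hasFDerivAt_immersion hx).comp (t, n) (b.hasFDerivAt_symm ht hn))
  have h2 : HasFDerivAt (l ∘ f ∘ Ψ.symm) (ContinuousLinearMap.fst ℝ ℝ (R 2)) (t, n) := by
    refine hasFDerivAt_fst.congr_of_eventuallyEq ?_
    refine Filter.eventuallyEq_of_mem (Ψ.open_target.mem_nhds hz) fun z hz => ?_
    rw [b.target_eq] at hz
    exact b.l_symm hz.1 hz.2
  have h3 := DFunLike.congr_fun (h1.unique h2) u
  rw [← h.l_tangent hx]
  exact h3

lemma axisForm_leaf (b : IsLeafBox f ξ H U l P Ψ J N) (h : IsSplitOn f ξ H U l d) {t : ℝ} {n : R 2}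
    (ht : t ∈ J) (hn : n ∈ N) (v : R 2) :
    axisForm f ξ (Ψ.symm (t, n)) (fderiv ℝ Ψ.symm (t, n) (0, v)) = 0 :=
  (mul_eq_zero.1 (b.slope_axisForm h ht hn (0, v))).resolve_left (h.slope_ne_zero (b.symm_mem ht hn))

/-- A function whose derivative is a multiple of the axis form is constant on the leaves. -/
lemma eq_of_hasFDerivAt (b : IsLeafBox f ξ H U l P Ψ J N) (h : IsSplitOn f ξ H U l d) {E : Type*}
    [NormedAddCommGroup E] [NormedSpace ℝ E] {g c : R 3 → E}
    (hg : ∀ x ∈ U, HasFDerivAt g ((axisForm f ξ x).smulRight (c x)) x) {t : ℝ} {n n' : R 2}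
    (ht : t ∈ J) (hn : n ∈ N) (hn' : n' ∈ N) : g (Ψ.symm (t, n)) = g (Ψ.symm (t, n')) := by
  have hd : ∀ m ∈ N, HasFDerivAt (fun m => g (Ψ.symm (t, m))) (0 : R 2 →L[ℝ] E) m := fun m hm =>
    HasFDerivAt.congr_apply ((hg _ (b.symm_mem ht hm)).comp m ((b.hasFDerivAt_symm ht hm).comp m
      ((hasFDerivAt_const t m).prodMk (hasFDerivAt_id m)))) fun u => by
        have := b.axisForm_leaf h ht hm u
        simp [this]
  refine b.convex_N.is_const_of_fderivWithin_eq_zero (𝕜 := ℝ) (f := fun m => g (Ψ.symm (t, m)))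
    (fun s hs => (hd s hs).differentiableAt.differentiableWithinAt) (fun s hs => ?_) hn hn'
  rw [fderivWithin_of_isOpen b.isOpen_N hs, (hd s hs).fderiv]

/-- The derivative along the first coordinate. -/
lemma hasDerivAt_of_hasFDerivAt (b : IsLeafBox f ξ H U l P Ψ J N) (h : IsSplitOn f ξ H U l d)
    {E : Type*} [NormedAddCommGroup E] [NormedSpace ℝ E] {g : R 3 → E} {c : E} {t : ℝ} {n : R 2}
    (ht : t ∈ J) (hn : n ∈ N)
    (hg : HasFDerivAt g ((slopeFun H f ξ (Ψ.symm (t, n)) • axisForm f ξ (Ψ.symm (t, n))).smulRight c)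
      (Ψ.symm (t, n))) : HasDerivAt (fun s => g (Ψ.symm (s, n))) c t := by
  have h1 : HasDerivAt (fun t : ℝ => Ψ.symm (t, n)) (fderiv ℝ Ψ.symm (t, n) (1, 0)) t :=
    (b.hasFDerivAt_symm ht hn).comp_hasDerivAt t ((hasDerivAt_id t).prodMk (hasDerivAt_const t n))
  refine (hg.comp_hasDerivAt t h1).congr_deriv ?_
  have := b.slope_axisForm h ht hn (1, 0)
  simp only [smulRight_apply, smul_apply, smul_eq_mul, this, one_smul]

end IsLeafBox

end

section

/-! ### Functions that satisfy an autonomous differential equation along another function -/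

section ODE

variable {E : Type*} [NormedAddCommGroup E] [NormedSpace ℝ E] {V : E → E}

/-- A C¹ field is locally Lipschitz, so solutions that meet agree nearby. The set of local agreement
is open and relatively closed in D. -/
lemma eqOn_of_integralCurves (hV : ContDiff ℝ 1 V) {c c' : ℝ → E} {D : Set ℝ} (hD : IsOpen D)
    (hDc : IsPreconnected D) (hc : ∀ t ∈ D, HasDerivAt c (V (c t)) t)
    (hc' : ∀ t ∈ D, HasDerivAt c' (V (c' t)) t) {t₀ : ℝ} (ht₀ : t₀ ∈ D) (h0 : c t₀ = c' t₀) :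
    Set.EqOn c c' D := by
  have hloc : ∀ t ∈ D, c t = c' t → c =ᶠ[𝓝 t] c' := by
    intro t ht he
    obtain ⟨K, s, hs, hK⟩ := (hV.contDiffAt (x := c t)).exists_lipschitzOnWith
    refine ODE_solution_unique_of_eventually (v := fun _ => V) (s := fun _ => s)
      (Filter.Eventually.of_forall fun _ => hK) ?_ ?_ he
    · filter_upwards [hD.mem_nhds ht, (hc t ht).continuousAt.preimage_mem_nhds hs] with u hu hus
      exact ⟨hc u hu, hus⟩
    · filter_upwards [hD.mem_nhds ht,
        (hc' t ht).continuousAt.preimage_mem_nhds (he ▸ hs)] with u hu hus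
      exact ⟨hc' u hu, hus⟩
  have hsub : D ⊆ {t | c =ᶠ[𝓝 t] c'} := by
    refine hDc.subset_of_closure_inter_subset ?_ ⟨t₀, ht₀, hloc t₀ ht₀ h0⟩ ?_
    · exact isOpen_iff_mem_nhds.2 fun t ht => Filter.Eventually.eventually_nhds ht
    · rintro t ⟨ht, htD⟩
      refine hloc t htD ?_
      by_contra hne
      have h1 : ∀ᶠ u in 𝓝 t, c u ≠ c' u :=
        (hc t htD).continuousAt.ne_iff_eventually_ne (hc' t htD).continuousAt |>.1 hne
      obtain ⟨u, hu, hu'⟩ := mem_closure_iff_nhds.1 ht _ h1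
      exact hu (Filter.EventuallyEq.eq_of_nhds hu')
  exact fun t ht => Filter.EventuallyEq.eq_of_nhds (hsub ht)

/-- If `Z` is locally a solution, with time `x`, of a differential equation, then `Z` is a function
of `x`. -/
theorem eq_of_locally_integralCurve {M : Type*} [TopologicalSpace M] [ConnectedSpace M]
    (hV : ContDiff ℝ 1 V) {x : M → ℝ} {Z : M → E}
    (h : ∀ p, ∃ B ∈ 𝓝 p, ∃ (J : Set ℝ) (c : ℝ → E), IsOpen J ∧ J.OrdConnected ∧
      (∀ t ∈ J, HasDerivAt c (V (c t)) t) ∧ ∀ q ∈ B, x q ∈ J ∧ Z q = c (x q))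
    {p q : M} (hpq : x p = x q) : Z p = Z q := by
  -- `S q` says that p and q lie over one common solution on an interval. Overlapping solutions
  -- agree and glue, so `S` is a locally constant proposition, true at p and hence on all of M.
  let S : M → Prop := fun q => ∃ (D : Set ℝ) (c : ℝ → E), IsOpen D ∧ D.OrdConnected ∧
    (∀ t ∈ D, HasDerivAt c (V (c t)) t) ∧ x p ∈ D ∧ x q ∈ D ∧ Z p = c (x p) ∧ Z q = c (x q)
  have hstep : ∀ r, ∃ B ∈ 𝓝 r, ∀ q₁ ∈ B, ∀ q₂ ∈ B, S q₁ → S q₂ := by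
    intro r
    obtain ⟨B, hB, J, c', hJ, hJc, hc', hBJ⟩ := h r
    refine ⟨B, hB, ?_⟩
    rintro q₁ hq₁ q₂ hq₂ ⟨D, c, hD, hDc, hc, hpD, hqD, hZp, hZq⟩
    have heq : Set.EqOn c c' (D ∩ J) := eqOn_of_integralCurves hV (hD.inter hJ)
      (hDc.inter hJc).isPreconnected (fun t ht => hc t ht.1) (fun t ht => hc' t ht.2)
      ⟨hqD, (hBJ q₁ hq₁).1⟩ (by rw [← hZq, (hBJ q₁ hq₁).2])
    classical
    have hgD : ∀ t ∈ D, D.piecewise c c' t = c t := fun t ht => Set.piecewise_eq_of_mem _ _ _ ht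
    have hgJ : ∀ t ∈ J, D.piecewise c c' t = c' t := fun t ht => by
      by_cases htD : t ∈ D
      · rw [hgD t htD, heq ⟨htD, ht⟩]
      · exact Set.piecewise_eq_of_notMem _ _ _ htD
    refine ⟨D ∪ J, D.piecewise c c', hD.union hJ, (IsPreconnected.union (x q₁) hqD (hBJ q₁ hq₁).1
      hDc.isPreconnected hJc.isPreconnected).ordConnected, ?_, Or.inl hpD, Or.inr (hBJ q₂ hq₂).1,
      by rw [hgD _ hpD, hZp], by rw [hgJ _ (hBJ q₂ hq₂).1, (hBJ q₂ hq₂).2]⟩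
    rintro t (ht | ht)
    · rw [hgD t ht]
      exact (hc t ht).congr_of_eventuallyEq (Filter.eventuallyEq_of_mem (hD.mem_nhds ht) hgD)
    · rw [hgJ t ht]
      exact (hc' t ht).congr_of_eventuallyEq (Filter.eventuallyEq_of_mem (hJ.mem_nhds ht) hgJ)
  have hl : IsLocallyConstant S := by
    refine (IsLocallyConstant.iff_eventually_eq _).2 fun r => ?_
    obtain ⟨B, hB, hS⟩ := hstep r
    filter_upwards [hB] with q hq
    exact propext ⟨hS q hq r (mem_of_mem_nhds hB), hS r (mem_of_mem_nhds hB) q hq⟩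
  have hp : S p := by
    obtain ⟨B, hB, J, c', hJ, hJc, hc', hBJ⟩ := h p
    have := hBJ p (mem_of_mem_nhds hB)
    exact ⟨J, c', hJ, hJc, hc', this.1, this.1, this.2, this.2⟩
  have hq : S q := hl.apply_eq_of_isPreconnected isPreconnected_univ trivial trivial ▸ hp
  obtain ⟨D, c, -, -, -, -, -, h1, h2⟩ := hq
  rw [h1, h2, hpq]

end ODE

/-! ### The invariants as functions of `l ∘ F` -/

/-- The vector field of the differential equation for `(Γ, ν, ν/ρ)`. -/
def invariantField (H k : ℝ) (z : ℝ × ℝ × ℝ) : ℝ × ℝ × ℝ :=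
  (z.2.2 * (z.1 ^ 2 + 3 * (k⁻¹ * z.2.1 ^ 2) ^ 2 - H), 2 * z.2.2 * z.1 * z.2.1,
    z.2.2 ^ 2 * (z.1 - 3 * (k⁻¹ * z.2.1 ^ 2)))

lemma contDiff_invariantField (H k : ℝ) : ContDiff ℝ 1 (invariantField H k) := by
  unfold invariantField
  fun_prop

/-- The triple `(Γ, ν, ν/ρ)`. -/
def invariants (H : ℝ) (f ξ : R 3 → R 4) (x : R 3) : ℝ × ℝ × ℝ :=
  (expansion f ξ x, nuFun H f ξ x, nuFun H f ξ x * (rhoFun H f ξ x)⁻¹)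

lemma isIntrinsic_invariants (H : ℝ) : IsIntrinsic H (invariants H) :=
  fun f ξ U f' ξ' φ O hr x hx => by
    simp only [invariants, hr.expansion hx, hr.nuFun hx, hr.rhoFun hx]

lemma isIntrinsic_scaleFun (H : ℝ) : IsIntrinsic H (scaleFun H) :=
  fun f ξ U f' ξ' φ O hr x hx => by simp only [scaleFun, hr.nuFun hx, hr.rhoFun hx]

lemma IsAxialOn.hasFDerivAt_invariants {f ξ : R 3 → R 4} {U : Set (R 3)} {H : ℝ}
    (h : IsAxialOn f ξ H U) {x : R 3} (hx : x ∈ U) (hν : nuFun H f ξ x ≠ 0) {k : ℝ} (hk : k ≠ 0)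
    (hka : nuFun H f ξ x ^ 2 = k * axisFun f ξ x) : HasFDerivAt (invariants H f ξ)
      ((slopeFun H f ξ x • axisForm f ξ x).smulRight (invariantField H k (invariants H f ξ x))) x := by
  have hρ := (h.rhoFun_pos hx hν).ne'
  have hm := (h.hasFDerivAt_nuFun hx).mul
    ((hasDerivAt_inv hρ).comp_hasFDerivAt x (h.hasFDerivAt_rhoFun hx hν))
  -- The constant k = ν²/a eliminates a, which makes the system for (Γ, ν, ν/ρ) closed. Passing from
  -- τ to dt = (ρ/ν)τ introduces the factor ν/ρ.
  have ha : k⁻¹ * nuFun H f ξ x ^ 2 = axisFun f ξ x := by rw [hka]; field_simp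
  refine HasFDerivAt.congr_apply ((h.hasFDerivAt_expansion hx).prodMk
    ((h.hasFDerivAt_nuFun hx).prodMk hm)) fun u => ?_
  simp only [invariantField, invariants, ha, slopeFun]
  refine Prod.ext ?_ (Prod.ext ?_ ?_) <;>
  · simp
    field_simp
    try ring

section Manifold

variable {M : Type*} [TopologicalSpace M] [ChartedSpace (R 3) M] {F ξ : M → R 4} {H : ℝ}
  {P : R 4 →L[ℝ] R 3} {S : R 3 →L[ℝ] R 4}

namespace SplitData

lemma isSplitOn (D : SplitData F ξ H) {e : OpenPartialHomeomorph M (R 3)}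
    (he : e ∈ IsManifold.maximalAtlas (𝓡 3) ∞ M) :
    IsSplitOn (F ∘ e.symm) (ξ ∘ e.symm) H e.target D.form D.dir where
  __ := D.axial e he
  nu_ne_zero := D.nu_ne_zero e he
  polarDir_eq := D.polarDir_eq e he
  leafForm_eq := D.leafForm_eq e he

variable [IsManifold (𝓡 3) ∞ M]

lemma form_dir [Nonempty M] (D : SplitData F ξ H) : D.form D.dir = 1 := by
  obtain ⟨p⟩ := (inferInstance : Nonempty M)
  have he : chartAt (R 3) p ∈ IsManifold.maximalAtlas (𝓡 3) ∞ M :=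
    IsManifold.chart_mem_maximalAtlas _
  have hp := (chartAt (R 3) p).map_source (mem_chart_source (R 3) p)
  rw [← D.leafForm_eq _ he _ hp, ← D.polarDir_eq _ he _ hp]
  exact (D.axial _ he).leafForm_polarDir hp (D.nu_ne_zero _ he _ hp)

/-- Points with the same value of l∘F need not lie on the same leaf, so constancy along leaves is
not enough. In a leaf box the invariants follow one solution of the differential equation in t, and
uniqueness does the rest. -/
lemma invariants_eq [ConnectedSpace M] (D : SplitData F ξ H)
    (hc : IsCoordinates D.form D.dir P S) {p q : M} (hpq : D.form (F p) = D.form (F q)) :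
    onManifold (invariants H) F ξ p = onManifold (invariants H) F ξ q := by
  refine eq_of_locally_integralCurve (contDiff_invariantField H D.k)
    (x := fun p => D.form (F p)) (fun p => ?_) hpq
  set e := chartAt (R 3) p
  have he : e ∈ IsManifold.maximalAtlas (𝓡 3) ∞ M := IsManifold.chart_mem_maximalAtlas _
  have hp : p ∈ e.source := mem_chart_source _ _
  have hs := D.isSplitOn he
  obtain ⟨Ψ, J, N, b, hpΨ⟩ := hs.exists_leafBox hc (e.map_source hp)
  have hmem : ∀ x ∈ Ψ.source, (Ψ x).1 ∈ J ∧ (Ψ x).2 ∈ N := fun x hx => by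
    have := Ψ.map_source hx
    rwa [b.target_eq] at this
  have hd : ∀ x ∈ e.target, HasFDerivAt (invariants H (F ∘ e.symm) (ξ ∘ e.symm))
      ((slopeFun H (F ∘ e.symm) (ξ ∘ e.symm) x • axisForm (F ∘ e.symm) (ξ ∘ e.symm) x).smulRight
        (invariantField H D.k (invariants H (F ∘ e.symm) (ξ ∘ e.symm) x))) x := fun x hx =>
    hs.hasFDerivAt_invariants hx (D.nu_ne_zero e he x hx) D.k_ne_zero (D.nu_sq e he x hx)
  set n₀ := (Ψ (e p)).2 with hn₀
  have hn₀N : n₀ ∈ N := (hmem _ hpΨ).2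
  refine ⟨e.source ∩ e ⁻¹' Ψ.source, Filter.inter_mem (e.open_source.mem_nhds hp)
    ((e.continuousAt hp).preimage_mem_nhds (Ψ.open_source.mem_nhds hpΨ)), J,
    fun t => invariants H (F ∘ e.symm) (ξ ∘ e.symm) (Ψ.symm (t, n₀)), b.isOpen_J,
    b.convex_J.ordConnected, fun t ht => ?_, fun q hq => ?_⟩
  · exact b.hasDerivAt_of_hasFDerivAt hs ht hn₀N (hd _ (b.symm_mem ht hn₀N))
  · have h1 : (Ψ (e q)).1 = D.form (F q) := by
      rw [b.fst_eq _ hq.2, Function.comp_apply, e.left_inv hq.1]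
    refine ⟨h1 ▸ (hmem _ hq.2).1, ?_⟩
    have h2 := D.axial.onManifold_symm (isIntrinsic_invariants H) he (e.map_source hq.1)
    rw [e.left_inv hq.1] at h2
    rw [h2, ← h1]
    have h3 := b.eq_of_hasFDerivAt hs (c := fun x => slopeFun H (F ∘ e.symm) (ξ ∘ e.symm) x •
      invariantField H D.k (invariants H (F ∘ e.symm) (ξ ∘ e.symm) x))
      (fun x hx => HasFDerivAt.congr_apply (hd x hx) fun u => by
        simp [mul_smul, smul_comm (axisForm (F ∘ e.symm) (ξ ∘ e.symm) x u)])
      (hmem _ hq.2).1 (hmem _ hq.2).2 hn₀N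
    beta_reduce
    rw [← h3, Prod.mk.eta, Ψ.left_inv hq.2]

lemma scaleFun_eq [ConnectedSpace M] (D : SplitData F ξ H)
    (hc : IsCoordinates D.form D.dir P S) {p q : M} (hpq : D.form (F p) = D.form (F q)) :
    onManifold (scaleFun H) F ξ p = onManifold (scaleFun H) F ξ q := by
  have h := D.invariants_eq hc hpq
  have hν : ∀ p : M, nuFun H (F ∘ (chartAt (R 3) p).symm) (ξ ∘ (chartAt (R 3) p).symm)
      (chartAt (R 3) p p) ≠ 0 := fun p => D.nu_ne_zero _ (IsManifold.chart_mem_maximalAtlas _) _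
    ((chartAt (R 3) p).map_source (mem_chart_source (R 3) p))
  simp only [onManifold, invariants, Prod.mk.injEq] at h
  obtain ⟨-, h1, h2⟩ := h
  have h3 := h2
  rw [h1] at h3
  have h4 := inv_injective (mul_left_cancel₀ (hν q) h3)
  simp only [onManifold, scaleFun, h1, h4]

end SplitData

end Manifold

end

section

/-! ### The leaves are affine spheres -/

/-- Used with the polar vector in the first slot and the radial vector in the last, where the 2×2
determinant becomes H − (Γ + a)(Γ − a) = −ν. -/
lemma volForm_four_smul (X ζ a b : R 4) (r s c α β γ : ℝ) :
    volForm 4 ![r • (α • X + β • ζ), s • a, s • b, c • (γ • X + ζ)]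
      = r * s ^ 2 * c * (α - β * γ) * volForm 4 ![X, a, b, ζ] := by
  simp only [volForm_apply]
  simp [Matrix.det_succ_row_zero, Fin.sum_univ_succ, Fin.succAbove]
  ring

/-- `m` parametrizes an integral surface of the kernel of the axis form. -/
structure IsLeaf (f ξ : R 3 → R 4) (H : ℝ) (U : Set (R 3)) (m : R 2 → R 3)
    (N : Set (R 2)) : Prop where
  isOpen : IsOpen N
  contDiffAt : ∀ n ∈ N, ContDiffAt ℝ ∞ m n
  mapsTo : ∀ n ∈ N, m n ∈ U
  injective : ∀ n ∈ N, Function.Injective (fderiv ℝ m n)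
  axisForm_eq_zero_iff : ∀ n ∈ N, ∀ u, axisForm f ξ (m n) u = 0 ↔ ∃ v, fderiv ℝ m n v = u
  scale_eq : ∀ n ∈ N, ∀ n' ∈ N, scaleFun H f ξ (m n) = scaleFun H f ξ (m n')

variable {f ξ : R 3 → R 4} {H : ℝ} {U : Set (R 3)} {l : R 4 →L[ℝ] ℝ} {d : R 4}
  {P : R 4 →L[ℝ] R 3} {S : R 3 →L[ℝ] R 4}

lemma IsLeafBox.isLeaf {Ψ : OpenPartialHomeomorph (R 3) (ℝ × R 2)} {J : Set ℝ} {N : Set (R 2)}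
    (b : IsLeafBox f ξ H U l P Ψ J N) (h : IsSplitOn f ξ H U l d) {t : ℝ} (ht : t ∈ J) :
    IsLeaf f ξ H U (fun n => Ψ.symm (t, n)) N := by
  have hd : ∀ n ∈ N, ∀ v, fderiv ℝ (fun n => Ψ.symm (t, n)) n v = fderiv ℝ Ψ.symm (t, n) (0, v) := by
    intro n hn v
    have h1 := (b.hasFDerivAt_symm ht hn).comp n ((hasFDerivAt_const t n).prodMk (hasFDerivAt_id n))
    exact DFunLike.congr_fun h1.fderiv v
  refine ⟨b.isOpen_N, fun n hn => ?_, fun n hn => b.symm_mem ht hn, fun n hn u v huv => ?_,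
    fun n hn u => ⟨fun hu => ?_, ?_⟩,
    fun n hn n' hn' => b.eq_of_hasFDerivAt h (c := fun x => -((expansion f ξ x + axisFun f ξ x)
      * scaleFun H f ξ x)) (fun x hx => ?_) ht hn hn'⟩
  · exact (b.contDiffAt_symm _ (b.mem_target ht hn)).comp n (contDiffAt_const.prodMk contDiffAt_id)
  · rw [hd n hn, hd n hn] at huv
    exact congrArg Prod.snd (b.fderiv_symm_injective ht hn huv)
  · have hs : Function.Surjective (fderiv ℝ Ψ.symm (t, n)) :=
      (LinearMap.injective_iff_surjective_of_finrank_eq_finrank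
        (f := (fderiv ℝ Ψ.symm (t, n)).toLinearMap) (by simp)).1 (b.fderiv_symm_injective ht hn)
    obtain ⟨⟨a, v⟩, hv⟩ := hs u
    have := b.slope_axisForm h ht hn (a, v)
    rw [hv, hu, mul_zero] at this
    refine ⟨v, ?_⟩
    rw [hd n hn, ← hv]
    simp only at this
    rw [← this]
  · rintro ⟨v, rfl⟩
    rw [hd n hn]
    exact b.axisForm_leaf h ht hn v
  · refine HasFDerivAt.congr_apply (h.hasFDerivAt_scaleFun hx (h.nu_ne_zero x hx)) fun u => ?_
    simp
    ring

/-- The position vector of the leaf `m`. -/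
def leafMap (H : ℝ) (f ξ : R 3 → R 4) (P : R 4 →L[ℝ] R 3) (m : R 2 → R 3) (n : R 2) : R 3 :=
  P (leafVec H f ξ (m n))

namespace IsLeaf

variable {m : R 2 → R 3} {N : Set (R 2)}

lemma axisForm_fderiv (L : IsLeaf f ξ H U m N) {n : R 2} (hn : n ∈ N) (v : R 2) :
    axisForm f ξ (m n) (fderiv ℝ m n v) = 0 := (L.axisForm_eq_zero_iff n hn _).2 ⟨v, rfl⟩

lemma hasFDerivAt (L : IsLeaf f ξ H U m N) {n : R 2} (hn : n ∈ N) :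
    HasFDerivAt m (fderiv ℝ m n) n :=
  ((L.contDiffAt n hn).differentiableAt (by simp)).hasFDerivAt

lemma fderiv_leafMap (L : IsLeaf f ξ H U m N) (h : IsSplitOn f ξ H U l d) {n : R 2} (hn : n ∈ N)
    (v : R 2) : fderiv ℝ (leafMap H f ξ P m) n v
      = (scaleFun H f ξ (m n))⁻¹ • P (fderiv ℝ f (m n) (fderiv ℝ m n v)) := by
  have h1 := (h.hasFDerivAt_P_leafVec (P := P) (L.mapsTo n hn)).comp n (L.hasFDerivAt hn)
  change fderiv ℝ ((fun y => P (leafVec H f ξ y)) ∘ m) n v = _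
  rw [h1.fderiv]
  simp [L.axisForm_fderiv hn v]

lemma contDiffAt_leafMap (L : IsLeaf f ξ H U m N) (h : IsSplitOn f ξ H U l d) {n : R 2}
    (hn : n ∈ N) : ContDiffAt ℝ ∞ (leafMap H f ξ P m) n := by
  have hx := L.mapsTo n hn
  exact P.contDiff.contDiffAt.comp n
    ((h.contDiffAt_leafVec hx (h.nu_ne_zero _ hx)).comp n (L.contDiffAt n hn))

/-- The Gauss formula of a leaf. -/
lemma gauss (L : IsLeaf f ξ H U m N) (h : IsSplitOn f ξ H U l d) {n : R 2} (hn : n ∈ N)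
    (u v : R 2) : ∃ w, (∃ c : ℝ, fderiv ℝ m n w = christoffel f ξ (m n) (fderiv ℝ m n u)
        (fderiv ℝ m n v) + fderiv ℝ (fderiv ℝ m) n u v + c • axisField f ξ (m n)) ∧
      fderiv ℝ (fderiv ℝ (leafMap H f ξ P m)) n u v
      = fderiv ℝ (leafMap H f ξ P m) n w
        + (nuFun H f ξ (m n) * affineMetric f ξ (m n) (fderiv ℝ m n u) (fderiv ℝ m n v))
          • leafMap H f ξ P m n := by
  have hx := L.mapsTo n hn
  have hy := (scaleFun_pos H f ξ (m n)).ne'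
  have hν := h.nu_ne_zero _ hx
  set G := affineMetric f ξ (m n) (fderiv ℝ m n u) (fderiv ℝ m n v) with hG
  have hfm : ∀ n' ∈ N, fderiv ℝ (f ∘ m) n' = (fderiv ℝ f (m n')).comp (fderiv ℝ m n') := fun n' hn' =>
    ((h.hasFDerivAt_immersion (L.mapsTo n' hn')).comp n' (L.hasFDerivAt hn')).fderiv
  have hcd : ContDiffAt ℝ ∞ (f ∘ m) n := (h.contDiffAt hx).comp n (L.contDiffAt n hn)
  have hd2 : HasFDerivAt (fderiv ℝ (f ∘ m)) (fderiv ℝ (fderiv ℝ (f ∘ m)) n) n :=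
    ((hcd.fderiv_right (m := ∞) (by simp)).differentiableAt (by simp)).hasFDerivAt
  have e1 : fderiv ℝ (fderiv ℝ (leafMap H f ξ P m)) n u v
      = (scaleFun H f ξ (m n))⁻¹ • P (fderiv ℝ (fderiv ℝ (f ∘ m)) n u v) := by
    have e : fderiv ℝ (leafMap H f ξ P m) =ᶠ[𝓝 n]
        fun n' => ((scaleFun H f ξ (m n))⁻¹ • compL ℝ (R 2) (R 4) (R 3) P) (fderiv ℝ (f ∘ m) n') := by
      refine Filter.eventuallyEq_of_mem (L.isOpen.mem_nhds hn) fun n' hn' => ?_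
      ext1 v'
      rw [L.fderiv_leafMap h hn', L.scale_eq n' hn' n hn]
      beta_reduce
      rw [hfm n' hn']
      simp
    rw [Filter.EventuallyEq.fderiv_eq e]
    have e' := ((scaleFun H f ξ (m n))⁻¹ • compL ℝ (R 2) (R 4) (R 3) P).hasFDerivAt.comp n hd2
    refine (DFunLike.congr_fun (DFunLike.congr_fun e'.fderiv u) v).trans ?_
    simp
  have e2 : fderiv ℝ (fderiv ℝ (f ∘ m)) n u v = fderiv ℝ f (m n)
      (christoffel f ξ (m n) (fderiv ℝ m n u) (fderiv ℝ m n v) + fderiv ℝ (fderiv ℝ m) n u v)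
      + G • ξ (m n) := by
    rw [fderiv_fderiv_comp (h.contDiffAt hx) (L.contDiffAt n hn), h.gauss hx, map_add, hG]
    abel
  set w := christoffel f ξ (m n) (fderiv ℝ m n u) (fderiv ℝ m n v) + fderiv ℝ (fderiv ℝ m) n u v
  -- The leaf lies in a hyperplane l = const, so its second derivatives lie in ker l. This fixes the
  -- T-component of the tangential part, which joins ξ to form a multiple of the radial vector.
  have e3 : l (fderiv ℝ (fderiv ℝ (f ∘ m)) n u v) = 0 := by
    have e : (fun n' => (compL ℝ (R 2) (R 4) ℝ l) (fderiv ℝ (f ∘ m) n')) =ᶠ[𝓝 n] fun _ => 0 := by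
      refine Filter.eventuallyEq_of_mem (L.isOpen.mem_nhds hn) fun n' hn' => ?_
      ext1 v'
      beta_reduce
      rw [hfm n' hn']
      simp [h.l_tangent (L.mapsTo n' hn'), L.axisForm_fderiv hn']
    have e' := (compL ℝ (R 2) (R 4) ℝ l).hasFDerivAt.comp n hd2
    have e'' := e'.unique ((hasFDerivAt_const (0 : R 2 →L[ℝ] ℝ) n).congr_of_eventuallyEq e)
    exact DFunLike.congr_fun (DFunLike.congr_fun e'' u) v
  have e4 : axisForm f ξ (m n) w = -((expansion f ξ (m n) - axisFun f ξ (m n)) * G) := by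
    rw [e2, ← h.leafForm_eq _ hx, h.leafForm_apply hx] at e3
    have := (mul_eq_zero.1 e3).resolve_left (h.slope_ne_zero hx)
    linarith
  obtain ⟨w', hw'⟩ := (L.axisForm_eq_zero_iff n hn
    (w + axisForm f ξ (m n) w • axisField f ξ (m n))).1 (by simp [h.axisForm_self hx])
  refine ⟨w', ⟨_, hw'⟩, ?_⟩
  rw [e1, e2, L.fderiv_leafMap h hn, hw', leafMap, leafVec, radialVec, axisVec, e4]
  simp only [map_add, map_smul]
  match_scalars <;> field_simp <;> ring

lemma isTransversalOn (L : IsLeaf f ξ H U m N) (h : IsSplitOn f ξ H U l d)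
    (hc : IsCoordinates l d P S) {ε : ℝ} (hε : ε = 1 ∨ ε = -1) :
    IsTransversalOn (leafMap H f ξ P m) (fun n => -(ε • leafMap H f ξ P m n)) N := by
  have hε0 : ε ≠ 0 := by rcases hε with rfl | rfl <;> norm_num
  have hsm : ∀ n ∈ N, ContDiffAt ℝ ∞ (fun n => ε • leafMap H f ξ P m n) n := fun n hn =>
    (L.contDiffAt_leafMap h hn).const_smul ε
  refine ⟨L.isOpen, fun n hn => (L.contDiffAt_leafMap h hn).contDiffWithinAt, fun n hn =>
    (hsm n hn).neg.contDiffWithinAt, fun n hn => ?_⟩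
  have hx := L.mapsTo n hn
  have hy := (scaleFun_pos H f ξ (m n)).ne'
  have hν := h.nu_ne_zero _ hx
  have hinj : Function.Injective (frameMap (leafMap H f ξ P m)
      (fun n => -(ε • leafMap H f ξ P m n)) n) := by
    refine (injective_iff_map_eq_zero _).2 ?_
    rintro ⟨u, c⟩ huc
    rw [frameMap_apply, L.fderiv_leafMap h hn] at huc
    set z := (scaleFun H f ξ (m n))⁻¹ • fderiv ℝ f (m n) (fderiv ℝ m n u)
      + (-(c * ε)) • leafVec H f ξ (m n) with hz
    have hPz : P z = 0 := by
      rw [← huc, hz, leafMap]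
      simp only [map_add, map_smul]
      module
    have hlz : l z = 0 := by
      rw [hz]
      simp [h.l_tangent hx, h.l_leafVec hx, L.axisForm_fderiv hn]
    have hz0 : z = 0 := by
      rw [hc.decomp z, hPz, hlz]; simp
    have e : fderiv ℝ f (m n) ((scaleFun H f ξ (m n))⁻¹ • fderiv ℝ m n u
        + (-(c * ε) * (nuFun H f ξ (m n) * scaleFun H f ξ (m n))⁻¹
          * (expansion f ξ (m n) - axisFun f ξ (m n))) • axisField f ξ (m n))
        + (-(c * ε) * (nuFun H f ξ (m n) * scaleFun H f ξ (m n))⁻¹) • ξ (m n)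
        = fderiv ℝ f (m n) 0 + (0 : ℝ) • ξ (m n) := by
      rw [map_zero, zero_smul, add_zero, ← hz0, hz, leafVec, radialVec, axisVec]
      simp only [map_add, map_smul]
      module
    obtain ⟨e1, e2⟩ := h.eq_of_frame_eq hx e
    have hc0 : c = 0 := by
      have := (mul_eq_zero.1 e2).resolve_right (inv_ne_zero (mul_ne_zero hν hy))
      exact (mul_eq_zero.1 (neg_eq_zero.1 this)).resolve_right hε0
    rw [hc0] at e1
    simp only [zero_mul, neg_zero, zero_smul, add_zero] at e1
    have e3 := (smul_eq_zero.1 e1).resolve_left (inv_ne_zero hy)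
    rw [(map_eq_zero_iff _ (L.injective n hn)).1 e3, hc0]
    rfl
  exact ⟨hinj, (LinearMap.injective_iff_surjective_of_finrank_eq_finrank (f := (frameMap
    (leafMap H f ξ P m) (fun n => -(ε • leafMap H f ξ P m n)) n).toLinearMap) (by simp)).1 hinj⟩

lemma gauss_leafMap (L : IsLeaf f ξ H U m N) (h : IsSplitOn f ξ H U l d)
    (hc : IsCoordinates l d P S) {ε : ℝ} (hε : ε = 1 ∨ ε = -1)
    (hεν : ∀ x ∈ U, |nuFun H f ξ x| = -(ε * nuFun H f ξ x)) {n : R 2} (hn : n ∈ N) (u v : R 2) :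
    (∃ c : ℝ, fderiv ℝ m n
        (christoffel (leafMap H f ξ P m) (fun n => -(ε • leafMap H f ξ P m n)) n u v)
      = christoffel f ξ (m n) (fderiv ℝ m n u) (fderiv ℝ m n v) + fderiv ℝ (fderiv ℝ m) n u v
        + c • axisField f ξ (m n)) ∧
    affineMetric (leafMap H f ξ P m) (fun n => -(ε • leafMap H f ξ P m n)) n u v
      = |nuFun H f ξ (m n)| * affineMetric f ξ (m n) (fderiv ℝ m n u) (fderiv ℝ m n v) := by
  have ht := L.isTransversalOn h hc hε
  obtain ⟨w, hw', hw⟩ := L.gauss (P := P) h hn u v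
  have hε2 : ε * ε = 1 := by rcases hε with rfl | rfl <;> norm_num
  have e : fderiv ℝ (fderiv ℝ (leafMap H f ξ P m)) n u v = fderiv ℝ (leafMap H f ξ P m) n w
      + (|nuFun H f ξ (m n)| * affineMetric f ξ (m n) (fderiv ℝ m n u) (fderiv ℝ m n v))
        • (fun n => -(ε • leafMap H f ξ P m n)) n := by
    rw [hw, hεν _ (L.mapsTo n hn)]
    match_scalars
    · ring
    · linear_combination (-(nuFun H f ξ (m n) * affineMetric f ξ (m n) (fderiv ℝ m n u)
        (fderiv ℝ m n v))) * hε2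
  rw [ht.gauss hn] at e
  obtain ⟨e1, e2⟩ := ht.eq_of_frame_eq hn e
  exact ⟨e1 ▸ hw', e2⟩

lemma affineMetric_leafMap (L : IsLeaf f ξ H U m N) (h : IsSplitOn f ξ H U l d)
    (hc : IsCoordinates l d P S) {ε : ℝ} (hε : ε = 1 ∨ ε = -1)
    (hεν : ∀ x ∈ U, |nuFun H f ξ x| = -(ε * nuFun H f ξ x)) {n : R 2} (hn : n ∈ N) (u v : R 2) :
    affineMetric (leafMap H f ξ P m) (fun n => -(ε • leafMap H f ξ P m n)) n u v
      = |nuFun H f ξ (m n)| * affineMetric f ξ (m n) (fderiv ℝ m n u) (fderiv ℝ m n v) :=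
  (L.gauss_leafMap h hc hε hεν hn u v).2

lemma hasFDerivAt_neg_smul_leafMap (L : IsLeaf f ξ H U m N) (h : IsSplitOn f ξ H U l d) (ε : ℝ)
    {n : R 2} (hn : n ∈ N) : HasFDerivAt (fun n => -(ε • leafMap H f ξ P m n))
      (-(ε • fderiv ℝ (leafMap H f ξ P m) n)) n :=
  (((L.contDiffAt_leafMap (P := P) h hn).differentiableAt (by simp)).hasFDerivAt.const_smul ε).neg

/-- For the normal −εφ the Weingarten condition is automatic; the volume condition is where the
scale enters. The sign ε = −sign ν turns the induced metric into |ν| h, positive because leaves are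
orthogonal to T. -/
theorem isPosDefProperAffineSphereOn (L : IsLeaf f ξ H U m N) (h : IsSplitOn f ξ H U l d)
    (hc : IsCoordinates l d P S) {ε : ℝ} (hε : ε = 1 ∨ ε = -1)
    (hεν : ∀ x ∈ U, |nuFun H f ξ x| = -(ε * nuFun H f ξ x)) :
    IsPosDefProperAffineSphereOn (leafMap H f ξ P m) ε N := by
  have ht := L.isTransversalOn h hc hε
  have hnormal : ∀ n ∈ N, ∀ u, fderiv ℝ (fun n => -(ε • leafMap H f ξ P m n)) n u
      = fderiv ℝ (leafMap H f ξ P m) n (-(ε • u))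
        + (0 : ℝ) • (fun n => -(ε • leafMap H f ξ P m n)) n := by
    intro n hn u
    refine (DFunLike.congr_fun (L.hasFDerivAt_neg_smul_leafMap h ε hn).fderiv u).trans ?_
    simp
  refine ⟨hε, ⟨⟨ht.smooth, ht.smooth_normal, ht.transversal, fun n hn u => ?_, fun n hn => ?_⟩,
    fun n hn u => ?_⟩, fun n hn u hu => ?_⟩
  · rw [hnormal n hn, ht.split_frameMap hn]
  · have hx := L.mapsTo n hn
    have hy := scaleFun_pos H f ξ (m n)
    have hν := h.nu_ne_zero _ hx
    have hρ := h.rhoFun_pos hx hν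
    have hpow := h.scaleFun_pow hx hν
    set a := fderiv ℝ f (m n) (fderiv ℝ m n (EuclideanSpace.single 0 1)) with ha
    set b := fderiv ℝ f (m n) (fderiv ℝ m n (EuclideanSpace.single 1 1)) with hb
    have hSP : ∀ w, l w = 0 → S (P w) = w := fun w hw => by
      conv_rhs => rw [hc.decomp w, hw, zero_smul, zero_add]
    have hl : ∀ u, l (fderiv ℝ f (m n) (fderiv ℝ m n u)) = 0 := fun u => by
      rw [h.l_tangent hx, L.axisForm_fderiv hn, mul_zero]
    -- Adjoin d as a fourth vector. By the choice of coordinates this preserves the absolute volume,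
    -- and the result can be compared with the volume of (T, a, b, ξ) given by the Blaschke
    -- condition upstairs.
    have e1 : |inducedVolume (leafMap H f ξ P m) (fun n => -(ε • leafMap H f ξ P m n)) n|
        = |volForm 4 ![(rhoFun H f ξ (m n))⁻¹ • (H • axisVec f ξ (m n)
            + (expansion f ξ (m n) + axisFun f ξ (m n)) • ξ (m n)),
          (scaleFun H f ξ (m n))⁻¹ • a, (scaleFun H f ξ (m n))⁻¹ • b,
          (-(ε * (nuFun H f ξ (m n) * scaleFun H f ξ (m n))⁻¹)) •
            ((expansion f ξ (m n) - axisFun f ξ (m n)) • axisVec f ξ (m n) + ξ (m n))]| := by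
      rw [inducedVolume_eq, ← hc.volume]
      congr 2
      ext1 i
      refine Fin.cases ?_ (fun i => ?_) i
      · have e := h.polarVec_eq hx hν
        rw [h.polarDir_eq _ hx, polarVec] at e
        simp only [Matrix.cons_val_zero, e, smul_smul, inv_mul_cancel₀ hρ.ne', one_smul]
      · fin_cases i
        · change S (fderiv ℝ (leafMap H f ξ P m) n (EuclideanSpace.single 0 1)) = _
          rw [L.fderiv_leafMap h hn, map_smul, hSP _ (hl _)]
          rfl
        · change S (fderiv ℝ (leafMap H f ξ P m) n (EuclideanSpace.single 1 1)) = _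
          rw [L.fderiv_leafMap h hn, map_smul, hSP _ (hl _)]
          rfl
        · change S (-(ε • leafMap H f ξ P m n)) = _
          rw [map_neg, map_smul, leafMap, hSP _ (h.l_leafVec hx), leafVec, radialVec]
          change _ = (-(ε * (nuFun H f ξ (m n) * scaleFun H f ξ (m n))⁻¹)) •
            ((expansion f ξ (m n) - axisFun f ξ (m n)) • axisVec f ξ (m n) + ξ (m n))
          module
    have e2 := h.blaschke.volume_frame hx ![axisField f ξ (m n),
      fderiv ℝ m n (EuclideanSpace.single 0 1), fderiv ℝ m n (EuclideanSpace.single 1 1)]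
    have e3 : inducedFrame f ξ ![axisField f ξ (m n), fderiv ℝ m n (EuclideanSpace.single 0 1),
        fderiv ℝ m n (EuclideanSpace.single 1 1)] (m n) = ![axisVec f ξ (m n), a, b, ξ (m n)] := by
      ext1 i
      fin_cases i <;> rfl
    have hT : affineMetric f ξ (m n) (axisField f ξ (m n)) (axisField f ξ (m n)) = -1 :=
      (h.isAxis hx).unit
    have hTj : ∀ u, affineMetric f ξ (m n) (axisField f ξ (m n)) (fderiv ℝ m n u) = 0 := fun u =>
      L.axisForm_fderiv hn u
    have hjT : ∀ u, affineMetric f ξ (m n) (fderiv ℝ m n u) (axisField f ξ (m n)) = 0 := fun u => by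
      rw [h.metric_symm hx, hTj]
    set g : Fin 2 → Fin 2 → ℝ := fun i j => affineMetric f ξ (m n)
      (fderiv ℝ m n (EuclideanSpace.single i 1)) (fderiv ℝ m n (EuclideanSpace.single j 1)) with hg
    have e4 : |Matrix.det (Matrix.of fun i j : Fin 3 => affineMetric f ξ (m n)
        (![axisField f ξ (m n), fderiv ℝ m n (EuclideanSpace.single 0 1),
          fderiv ℝ m n (EuclideanSpace.single 1 1)] i)
        (![axisField f ξ (m n), fderiv ℝ m n (EuclideanSpace.single 0 1),
          fderiv ℝ m n (EuclideanSpace.single 1 1)] j))| = |g 0 0 * g 1 1 - g 0 1 * g 1 0| := by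
      rw [Matrix.det_fin_three, ← abs_neg]
      simp [hT, hTj, hjT, hg]
      congr 1
      ring
    have e5 : metricDet (leafMap H f ξ P m) (fun n => -(ε • leafMap H f ξ P m n)) n
        = |nuFun H f ξ (m n)| ^ 2 * (g 0 0 * g 1 1 - g 0 1 * g 1 0) := by
      rw [metricDet, Matrix.det_fin_two]
      simp only [Matrix.of_apply, L.affineMetric_leafMap h hc hε hεν hn, hg]
      ring
    rw [e3, e4] at e2
    have hεa : |ε| = 1 := by rcases hε with rfl | rfl <;> norm_num
    rw [e1, volForm_four_smul, abs_mul, e2, e5, abs_mul (|nuFun H f ξ (m n)| ^ 2), Real.sqrt_mul (abs_nonneg _), abs_pow,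
      abs_abs, Real.sqrt_sq (abs_nonneg _)]
    congr 1
    have e6 : H - (expansion f ξ (m n) + axisFun f ξ (m n))
        * (expansion f ξ (m n) - axisFun f ξ (m n)) = -nuFun H f ξ (m n) := by
      rw [nuFun]; ring
    rw [e6]
    simp only [abs_mul, abs_neg, abs_inv, abs_pow, hεa, abs_of_pos hρ, abs_of_pos hy]
    have hν' : |nuFun H f ξ (m n)| ≠ 0 := abs_ne_zero.2 hν
    field_simp
    linear_combination -hpow
  · rw [shapeOperator, hnormal n hn, ht.split_frameMap hn]
    simp
  · rw [L.affineMetric_leafMap h hc hε hεν hn]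
    have hx := L.mapsTo n hn
    refine mul_pos (abs_pos.2 (h.nu_ne_zero _ hx)) ?_
    -- The tangent plane of the leaf is spanned by the spacelike vectors V and W.
    obtain ⟨O, V, W, hO, hxO, -, -, -, ho⟩ := h.exists_frame hx
    have ho := ho _ hxO
    set z := fderiv ℝ m n u with hz
    have hz0 : z ≠ 0 := fun e => hu ((map_eq_zero_iff _ (L.injective n hn)).1 e)
    have hzd := ho.decomp (h.metric_symm hx) z
    have hTz : affineMetric f ξ (m n) (axisField f ξ (m n)) z = 0 := L.axisForm_fderiv hn u
    rw [hTz, neg_zero] at hzd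
    have e := ho.apply (h.metric_symm hx) 0 (affineMetric f ξ (m n) (V (m n)) z)
      (affineMetric f ξ (m n) (W (m n)) z) 0 (affineMetric f ξ (m n) (V (m n)) z)
      (affineMetric f ξ (m n) (W (m n)) z)
    rw [← hzd] at e
    rw [e]
    by_contra hneg
    have h1 : affineMetric f ξ (m n) (V (m n)) z = 0 := by nlinarith
    have h2 : affineMetric f ξ (m n) (W (m n)) z = 0 := by nlinarith
    rw [h1, h2] at hzd
    exact hz0 (by rw [hzd]; simp)

end IsLeaf

end

section

/-! ### Affine spheres with parallel affine metric are quadrics -/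

namespace IsTransversalOn

variable {n : ℕ} {f ξ : R n → R (n + 1)} {U : Set (R n)} {lam : ℝ}

/-- Differentiate a = df(p) + cξ for constant a, with p and c its components: the Gauss and
Weingarten formulas give dp(u) = λcu − Γ(u, p) and dc(u) = −h(u, p). -/
lemma hasFDerivAt_split (h : IsTransversalOn f ξ U) {x : R n} (hx : x ∈ U)
    (hw : ∀ u, fderiv ℝ ξ x u = -(lam • fderiv ℝ f x u)) (a : R (n + 1)) :
    HasFDerivAt (fun y => split f ξ y a) (((lam * (split f ξ x a).2) • ContinuousLinearMap.id ℝ (R n)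
      - christoffel f ξ x (split f ξ x a).1).prod (-(affineMetric f ξ x (split f ξ x a).1))) x := by
  have h1 : HasFDerivAt (split f ξ) (fderiv ℝ (split f ξ) x) x :=
    ((h.contDiffAt_split hx).differentiableAt (by simp)).hasFDerivAt
  have h2 : HasFDerivAt (fun y => split f ξ y a) ((fderiv ℝ (split f ξ) x).flip a) x :=
    HasFDerivAt.congr_apply (h1.clm_apply (hasFDerivAt_const a x)) fun u => by simp
  refine HasFDerivAt.congr_apply h2 fun u => ?_
  have h3 : HasFDerivAt (fderiv ℝ f) (fderiv ℝ (fderiv ℝ f) x) x :=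
    ((h.contDiffAt_fderiv hx).differentiableAt (by simp)).hasFDerivAt
  have h4 : HasFDerivAt ξ (fderiv ℝ ξ x) x :=
    ((h.contDiffAt_normal hx).differentiableAt (by simp)).hasFDerivAt
  have h5 := (h3.clm_apply h2.fst).add (h2.snd.smul h4)
  have h6 := h5.unique ((hasFDerivAt_const a x).congr_of_eventuallyEq
    (Filter.eventuallyEq_of_mem (h.isOpen.mem_nhds hx) fun y hy => h.frameMap_split hy a))
  have h7 := DFunLike.congr_fun h6 u
  set p := (split f ξ x a).1 with hp
  set c := (split f ξ x a).2 with hc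
  set q := (fderiv ℝ (split f ξ) x).flip a u with hq
  simp only [add_apply, smul_apply, comp_apply, flip_apply, smulRight_apply, coe_fst', coe_snd',
    zero_apply, h.gauss hx, hw] at h7
  simp only [← flip_apply (fderiv ℝ (split f ξ) x), ← hq, ← hp, ← hc] at h7
  have h8 : fderiv ℝ f x (christoffel f ξ x p u + q.1 - (lam * c) • u)
      + (affineMetric f ξ x p u + q.2) • ξ x = fderiv ℝ f x 0 + (0 : ℝ) • ξ x := by
    rw [h.christoffel_symm hx p, h.metric_symm hx p]
    simp only [map_add, map_sub, map_smul, map_zero, zero_smul, add_zero]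
    rw [← h7]
    module
  obtain ⟨h9, h10⟩ := h.eq_of_frame_eq hx h8
  refine Prod.ext ?_ ?_
  · change q.1 = (lam * c) • u - christoffel f ξ x p u
    rw [← sub_eq_zero, ← h9]
    abel
  · change q.2 = -(affineMetric f ξ x p u)
    linarith

/-- If `∇h = 0` and `S = λ Id`, then the quadratic form which extends the affine metric and takes the
value `λ` at the affine normal is constant. -/
lemma hasFDerivAt_quadric (h : IsTransversalOn f ξ U) {x : R n} (hx : x ∈ U)
    (hw : ∀ u, fderiv ℝ ξ x u = -(lam • fderiv ℝ f x u))
    (hK : ∀ u v w, nablaMetric f ξ x u v w = 0) (a : R (n + 1)) :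
    HasFDerivAt (fun y => affineMetric f ξ y (split f ξ y a).1 (split f ξ y a).1
      + lam * (split f ξ y a).2 ^ 2) (0 : R n →L[ℝ] ℝ) x := by
  have h1 := h.hasFDerivAt_split hx hw a
  have hG : HasFDerivAt (affineMetric f ξ) (fderiv ℝ (affineMetric f ξ) x) x :=
    ((h.contDiffAt_metric hx).differentiableAt (by simp)).hasFDerivAt
  refine HasFDerivAt.congr_apply (((hG.clm_apply h1.fst).clm_apply h1.fst).add
    ((h1.snd.pow 2).const_mul lam)) fun u => ?_
  set p := (split f ξ x a).1
  set c := (split f ξ x a).2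
  have e := hK u p p
  rw [nablaMetric_apply, h.metric_symm hx p, h.christoffel_symm hx u p] at e
  simp only [add_apply, smul_apply, comp_apply, flip_apply, coe_fst', coe_snd', prod_apply, sub_apply,
    coe_id', id, neg_apply, zero_apply, smul_eq_mul, map_sub, map_smul]
  rw [h.metric_symm hx u p, h.metric_symm hx p (christoffel f ξ x p u)]
  simp
  linear_combination e

end IsTransversalOn

/-- A positive definite form in two variables as a sum of squares. -/
lemma exists_sq_add_sq (g : R 2 →L[ℝ] R 2 →L[ℝ] ℝ) (hs : ∀ u v, g u v = g v u)
    (hp : ∀ u, u ≠ 0 → 0 < g u u) :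
    ∃ X Y : R 2 →L[ℝ] ℝ, ∀ u, g u u = X u ^ 2 + Y u ^ 2 := by
  obtain ⟨a, ha⟩ := exists_ne (0 : R 2)
  have hA := hp a ha
  set A := g a a with hAd
  set X : R 2 →L[ℝ] ℝ := (Real.sqrt A)⁻¹ • g a
  have hsA : Real.sqrt A ^ 2 = A := Real.sq_sqrt hA.le
  have hsA0 : Real.sqrt A ≠ 0 := (Real.sqrt_pos.2 hA).ne'
  let Z : R 2 →L[ℝ] R 2 := ContinuousLinearMap.id ℝ (R 2) - A⁻¹ • (g a).smulRight a
  have hZ : ∀ u, Z u = u - (A⁻¹ * g a u) • a := fun u => by simp [Z, smul_smul]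
  have hgZ : ∀ u, g u u = X u ^ 2 + g (Z u) (Z u) := by
    intro u
    rw [hZ]
    simp only [X, map_sub, map_smul, sub_apply, smul_apply, smul_eq_mul, hs u a, ← hAd]
    rw [mul_pow, inv_pow, hsA]
    field_simp
    ring
  have hga : ∀ u, g a (Z u) = 0 := fun u => by
    rw [hZ]
    simp only [map_sub, map_smul, smul_eq_mul, ← hAd]
    field_simp
    ring
  by_cases hZ0 : ∀ u, Z u = 0
  · refine ⟨X, 0, fun u => ?_⟩
    rw [hgZ, hZ0]
    simp
  · push Not at hZ0
    obtain ⟨b, hb⟩ := hZ0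
    have hB := hp _ hb
    set B := g (Z b) (Z b)
    have hsB : Real.sqrt B ^ 2 = B := Real.sq_sqrt hB.le
    have hli : LinearIndependent ℝ ![a, Z b] := by
      refine LinearIndependent.pair_iff.2 fun s t hst => ?_
      have h1 := congrArg (g a) hst
      have h2 := congrArg (g (Z b)) hst
      simp only [map_add, map_smul, smul_eq_mul, hga, map_zero, mul_zero, add_zero, ← hAd,
        hs (Z b) a, zero_add] at h1 h2
      exact ⟨(mul_eq_zero.1 h1).resolve_right hA.ne', (mul_eq_zero.1 h2).resolve_right hB.ne'⟩
    have hspan : ∀ u, ∃ s t : ℝ, u = s • a + t • Z b := by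
      intro u
      have h1 := (basisOfLinearIndependentOfCardEqFinrank hli (by simp)).sum_repr u
      simp only [coe_basisOfLinearIndependentOfCardEqFinrank, Fin.sum_univ_two] at h1
      exact ⟨_, _, h1.symm⟩
    refine ⟨X, (Real.sqrt B)⁻¹ • g (Z b), fun u => ?_⟩
    rw [hgZ]
    congr 1
    obtain ⟨s, t, hst⟩ := hspan (Z u)
    have hs0 : s = 0 := by
      have := hga u
      rw [hst, map_add, map_smul, map_smul, hga, smul_zero, add_zero] at this
      exact (mul_eq_zero.1 this).resolve_right hA.ne'
    rw [hs0, zero_smul, zero_add] at hst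
    have h3 : g (Z b) u = t * B := by
      have h4 : u = (A⁻¹ * g a u) • a + t • Z b := by rw [← hst, hZ]; abel
      rw [h4]
      simp only [map_add, map_smul, smul_eq_mul, hs (Z b) a, hga, mul_zero, zero_add]
      rfl
    rw [hst]
    simp only [smul_apply, smul_eq_mul, map_smul, h3]
    change t * (t * B) = _
    rw [mul_pow, inv_pow, hsB]
    field_simp

variable {f ξ : R 3 → R 4} {H : ℝ} {U : Set (R 3)} {l : R 4 →L[ℝ] ℝ} {d : R 4}
  {P : R 4 →L[ℝ] R 3} {S : R 3 →L[ℝ] R 4} {m : R 2 → R 3} {N : Set (R 2)}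

namespace IsLeaf

/-- The leaf metric is |ν| h with ν constant on the leaf, and its connection is the ambient one up
to multiples of T, which are orthogonal to the leaf. What remains of ∇h is the cubic form on T^⊥,
zero because K(u, v) is parallel to T. -/
lemma nablaMetric_leafMap (L : IsLeaf f ξ H U m N) (h : IsSplitOn f ξ H U l d)
    (hc : IsCoordinates l d P S) {ε : ℝ} (hε : ε = 1 ∨ ε = -1)
    (hεν : ∀ x ∈ U, |nuFun H f ξ x| = -(ε * nuFun H f ξ x)) {n : R 2} (hn : n ∈ N)
    (hso : ∀ u v, axisForm f ξ (m n) u = 0 → axisForm f ξ (m n) v = 0 →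
      ∃ c : ℝ, differenceMap f ξ (m n) u v = c • axisField f ξ (m n)) (w u v : R 2) :
    nablaMetric (leafMap H f ξ P m) (fun n => -(ε • leafMap H f ξ P m n)) n w u v = 0 := by
  have ht := L.isTransversalOn h hc hε
  have hx := L.mapsTo n hn
  have hGφ : HasFDerivAt (affineMetric (leafMap H f ξ P m) (fun n => -(ε • leafMap H f ξ P m n)))
      (fderiv ℝ (affineMetric (leafMap H f ξ P m) (fun n => -(ε • leafMap H f ξ P m n))) n) n :=
    ((ht.contDiffAt_metric hn).differentiableAt (by simp)).hasFDerivAt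
  have hG : HasFDerivAt (affineMetric f ξ) (fderiv ℝ (affineMetric f ξ) (m n)) (m n) :=
    ((h.contDiffAt_metric hx).differentiableAt (by simp)).hasFDerivAt
  have hm := L.hasFDerivAt hn
  have hm2 : HasFDerivAt (fderiv ℝ m) (fderiv ℝ (fderiv ℝ m) n) n :=
    (((L.contDiffAt n hn).fderiv_right (m := ∞) (by simp)).differentiableAt (by simp)).hasFDerivAt
  have hj : ∀ u : R 2, HasFDerivAt (fun y => fderiv ℝ m y u) ((fderiv ℝ (fderiv ℝ m) n).flip u) n :=
    fun u => HasFDerivAt.congr_apply (hm2.clm_apply (hasFDerivAt_const u n)) fun v => by simp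
  have e1 := (hGφ.clm_apply (hasFDerivAt_const u n)).clm_apply (hasFDerivAt_const v n)
  have e2 := (((h.hasFDerivAt_nuFun hx).comp n hm).const_mul (-ε)).mul
    (((hG.comp n hm).clm_apply (hj u)).clm_apply (hj v))
  have e3 := e1.unique (e2.congr_of_eventuallyEq (Filter.eventuallyEq_of_mem
    (L.isOpen.mem_nhds hn) fun y hy => by
      rw [L.affineMetric_leafMap h hc hε hεν hy, hεν _ (L.mapsTo y hy)]
      simp))
  have e4 := DFunLike.congr_fun e3 w
  simp only [add_apply, smul_apply, comp_apply, flip_apply, zero_apply, smul_eq_mul, map_zero,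
    add_zero, zero_add, Function.comp_apply, L.axisForm_fderiv hn, mul_zero] at e4
  obtain ⟨⟨c₁, h1⟩, -⟩ := L.gauss_leafMap h hc hε hεν hn w u
  obtain ⟨⟨c₂, h2⟩, -⟩ := L.gauss_leafMap h hc hε hεν hn w v
  have hT : ∀ u, affineMetric f ξ (m n) (axisField f ξ (m n)) (fderiv ℝ m n u) = 0 := fun u =>
    L.axisForm_fderiv hn u
  obtain ⟨c, hc'⟩ := hso (fderiv ℝ m n w) (fderiv ℝ m n u) (L.axisForm_fderiv hn w)
    (L.axisForm_fderiv hn u)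
  have hM := h.fderiv_metric hx (fderiv ℝ m n w) (fderiv ℝ m n u) (fderiv ℝ m n v)
  rw [hc', map_smul, smul_apply, hT, smul_zero, mul_zero, sub_zero] at hM
  rw [nablaMetric_apply, L.affineMetric_leafMap h hc hε hεν hn,
    L.affineMetric_leafMap h hc hε hεν hn, h1, h2, hεν _ hx]
  rw [hM] at e4
  simp only [map_add, map_smul, add_apply, smul_apply, hT, smul_zero, add_zero,
    h.metric_symm hx _ (axisField f ξ (m n))]
  rw [e4]
  ring

/-- If the affine metric is parallel, the leaves are quadrics. -/
theorem exists_quadric (L : IsLeaf f ξ H U m N) (h : IsSplitOn f ξ H U l d)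
    (hc : IsCoordinates l d P S) {ε : ℝ} (hε : ε = 1 ∨ ε = -1)
    (hεν : ∀ x ∈ U, |nuFun H f ξ x| = -(ε * nuFun H f ξ x)) (hN : Convex ℝ N) (hN0 : N.Nonempty)
    (hso : ∀ x ∈ U, ∀ u v, axisForm f ξ x u = 0 → axisForm f ξ x v = 0 →
      ∃ c : ℝ, differenceMap f ξ x u v = c • axisField f ξ x) :
    ∃ Q : Set (R 3), (IsEllipsoid Q ∨ IsTwoSheetedHyperboloid Q) ∧ leafMap H f ξ P m '' N ⊆ Q := by
  have ht := L.isTransversalOn h hc hε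
  have hps := L.isPosDefProperAffineSphereOn h hc hε hεν
  have hε2 : ε * ε = 1 := by rcases hε with rfl | rfl <;> norm_num
  obtain ⟨n₀, hn₀⟩ := hN0
  set φ := leafMap H f ξ P m
  set ζ : R 2 → R 3 := fun n => -(ε • φ n)
  have hconst : ∀ n ∈ N, ∀ a, affineMetric φ ζ n (split φ ζ n a).1 (split φ ζ n a).1
      + ε * (split φ ζ n a).2 ^ 2 = affineMetric φ ζ n₀ (split φ ζ n₀ a).1 (split φ ζ n₀ a).1
      + ε * (split φ ζ n₀ a).2 ^ 2 := by
    intro n hn a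
    have hd : ∀ y ∈ N, HasFDerivAt (fun y => affineMetric φ ζ y (split φ ζ y a).1 (split φ ζ y a).1
      + ε * (split φ ζ y a).2 ^ 2) (0 : R 2 →L[ℝ] ℝ) y := fun y hy =>
      ht.hasFDerivAt_quadric hy (fun u => by
        rw [(L.hasFDerivAt_neg_smul_leafMap h ε hy).fderiv]; rfl)
        (L.nablaMetric_leafMap h hc hε hεν hy (hso _ (L.mapsTo y hy))) a
    refine hN.is_const_of_fderivWithin_eq_zero (𝕜 := ℝ)
      (f := fun y => affineMetric φ ζ y (split φ ζ y a).1 (split φ ζ y a).1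
        + ε * (split φ ζ y a).2 ^ 2)
      (fun s hs => (hd s hs).differentiableAt.differentiableWithinAt) (fun s hs => ?_) hn hn₀
    rw [fderivWithin_of_isOpen L.isOpen hs, (hd s hs).fderiv]
  -- Diagonalizing the constant quadratic form at the one point n₀ gives linear coordinates of ℝ³ in
  -- which it reads x₀² + x₁² + εx₂².
  obtain ⟨X, Y, hXY⟩ := exists_sq_add_sq (affineMetric φ ζ n₀) (ht.metric_symm hn₀)
    (hps.posDef n₀ hn₀)
  let E₀ : R 3 →ₗ[ℝ] R 3 := (WithLp.linearEquiv 2 ℝ (Fin 3 → ℝ)).symm.toLinearMap ∘ₗ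
    LinearMap.pi ![(X.comp ((fst ℝ (R 2) ℝ).comp (split φ ζ n₀))).toLinearMap,
      (Y.comp ((fst ℝ (R 2) ℝ).comp (split φ ζ n₀))).toLinearMap,
      ((snd ℝ (R 2) ℝ).comp (split φ ζ n₀)).toLinearMap]
  have hE0 : ∀ a, E₀ a 0 = X (split φ ζ n₀ a).1 := fun a => rfl
  have hE1 : ∀ a, E₀ a 1 = Y (split φ ζ n₀ a).1 := fun a => rfl
  have hE2 : ∀ a, E₀ a 2 = (split φ ζ n₀ a).2 := fun a => rfl
  have hinj : Function.Injective E₀ := by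
    refine (injective_iff_map_eq_zero _).2 fun a ha => ?_
    have h0 := hE0 a; have h1 := hE1 a; have h2 := hE2 a
    rw [ha] at h0 h1 h2
    have h3 : (split φ ζ n₀ a).1 = 0 := by
      by_contra hne
      have := hps.posDef n₀ hn₀ _ hne
      rw [hXY, ← h0, ← h1] at this
      simp at this
    have := ht.frameMap_split hn₀ a
    rw [h3, ← h2] at this
    rw [← this]
    simp
  let E := LinearEquiv.ofInjectiveEndo E₀ hinj
  have hE : ∀ a, E a = E₀ a := fun a => rfl
  have hval : ∀ n ∈ N, E (φ n) 0 ^ 2 + E (φ n) 1 ^ 2 + ε * E (φ n) 2 ^ 2 = ε := by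
    intro n hn
    rw [hE, hE0, hE1, hE2, ← hXY, ← hconst n hn]
    -- The position vector is −ε times the normal, so the quadratic form takes the value ε·ε² = ε on
    -- it.
    have : split φ ζ n (φ n) = (0, -ε) := by
      rw [← ht.split_frameMap hn 0 (-ε)]
      congr 1
      change φ n = fderiv ℝ φ n 0 + (-ε) • (-(ε • φ n))
      rw [map_zero, zero_add, smul_neg, neg_smul, neg_neg, smul_smul, hε2, one_smul]
    rw [this]
    simp only [map_zero, zero_add]
    linear_combination ε * hε2
  refine ⟨E.symm.toAffineEquiv '' {x | x 0 ^ 2 + x 1 ^ 2 + ε * x 2 ^ 2 = ε}, ?_, ?_⟩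
  · rcases hε with rfl | rfl
    · exact Or.inl ⟨E.symm.toAffineEquiv, by simp only [one_mul]⟩
    · exact Or.inr ⟨E.symm.toAffineEquiv, by simp only [neg_one_mul, ← sub_eq_add_neg]⟩
  · rintro _ ⟨n, hn, rfl⟩
    exact ⟨E (φ n), hval n hn, E.symm_apply_apply _⟩

end IsLeaf

end

section

/-! ### The product structure -/

/-- The linear coordinates `(l, P)` on `ℝ⁴`. -/
def IsCoordinates.linearEquiv {l : R 4 →L[ℝ] ℝ} {d : R 4} {P : R 4 →L[ℝ] R 3} {S : R 3 →L[ℝ] R 4}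
    (hc : IsCoordinates l d P S) : R 4 ≃ₗ[ℝ] ℝ × R 3 where
  toFun w := (l w, P w)
  invFun z := z.1 • d + S z.2
  map_add' u v := by simp
  map_smul' c u := by simp
  left_inv w := (hc.decomp w).symm
  right_inv z := by simp [hc.l_d, hc.l_S, hc.P_d, hc.P_S]

lemma IsAxialOn.differenceMap_eq_smul_of_SO2 {f ξ : R 3 → R 4} {H : ℝ} {U : Set (R 3)}
    (h : IsAxialOn f ξ H U) {x : R 3} (hx : x ∈ U) (hs : HasSymmetryAt SO2 f ξ x) {u v : R 3}
    (hu : axisForm f ξ x u = 0) (hv : axisForm f ξ x v = 0) :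
    ∃ c : ℝ, differenceMap f ξ x u v = c • axisField f ξ x := by
  obtain ⟨T, a, hax, hK⟩ := exists_isAxis_of_SO2 (h.apolar x hx)
    ((h.toIsSphereOn.hasSymmetryAt_iff hx SO2).1 hs)
  have hT : T = axisField f ξ x := hax.eq_axis (h.apolar x hx)
  subst hT
  exact ⟨_, hK u v hu hv⟩

variable {M : Type*} [TopologicalSpace M] [ChartedSpace (R 3) M] {F ξ : M → R 4} {H : ℝ}
  {P : R 4 →L[ℝ] R 3} {S : R 3 →L[ℝ] R 4}

lemma IsLeafBox.isProductParametrization [IsManifold (𝓡 3) ∞ M] {f ξ : R 3 → R 4}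
    {l : R 4 →L[ℝ] ℝ} {Ψ : OpenPartialHomeomorph (R 3) (ℝ × R 2)}
    {J : Set ℝ} {N : Set (R 2)} {e : OpenPartialHomeomorph M (R 3)}
    (he : e ∈ IsManifold.maximalAtlas (𝓡 3) ∞ M) (b : IsLeafBox f ξ H e.target l P Ψ J N)
    (hN : N.Nonempty) : IsProductParametrization (e.trans Ψ).symm J N where
  isOpen_J := b.isOpen_J
  interval_J := b.convex_J.ordConnected
  isOpen_N := b.isOpen_N
  connected_N := ⟨hN, b.convex_N.isPreconnected⟩
  source_eq := by
    rw [← b.target_eq]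
    change (e.trans Ψ).target = _
    rw [OpenPartialHomeomorph.trans_target]
    exact Set.inter_eq_left.2 fun z hz => b.source_subset (Ψ.map_target hz)
  smooth := by
    have hs : (e.trans Ψ).symm.source = Ψ.target ∩ Ψ.symm ⁻¹' e.target :=
      OpenPartialHomeomorph.trans_target e Ψ
    rw [hs]
    refine (contMDiffOn_symm_of_mem_maximalAtlas he).comp (t := e.target)
      (ContDiffOn.contMDiffOn fun z hz => (b.contDiffAt_symm z ?_).contDiffWithinAt) ?_
    · exact hz.1
    · exact fun z hz => hz.2
  smooth_symm := by
    have hs : (e.trans Ψ).symm.target = e.source ∩ e ⁻¹' Ψ.source :=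
      OpenPartialHomeomorph.trans_source e Ψ
    rw [hs]
    have h1 : ContMDiffOn 𝓘(ℝ, R 3) 𝓘(ℝ, ℝ × R 2) ∞ Ψ Ψ.source :=
      ContDiffOn.contMDiffOn fun x hx => (b.contDiffAt x hx).contDiffWithinAt
    exact h1.comp ((contMDiffOn_of_mem_maximalAtlas he).mono Set.inter_subset_left) fun q hq => hq.2

namespace SplitData

lemma exists_isCoordinates [IsManifold (𝓡 3) ∞ M] [Nonempty M] (D : SplitData F ξ H) :
    ∃ P S, IsCoordinates D.form D.dir P S := by
  obtain ⟨P, S, h1, h2, h3, h4, h5⟩ := exists_coordinates D.form_dir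
  exact ⟨P, S, ⟨D.form_dir, h1, h2, h3, h4, h5⟩⟩

lemma exists_leafBox [IsManifold (𝓡 3) ∞ M] (D : SplitData F ξ H)
    (hc : IsCoordinates D.form D.dir P S) (p : M) :
    ∃ e ∈ IsManifold.maximalAtlas (𝓡 3) ∞ M, ∃ Ψ J N, ∃ t₀ ∈ J, ∃ n₀ ∈ N,
      IsLeafBox (F ∘ e.symm) (ξ ∘ e.symm) H e.target D.form P Ψ J N ∧ p ∈ e.source ∧
      e p ∈ Ψ.source ∧ t₀ = D.form (F p) := by
  have he : chartAt (R 3) p ∈ IsManifold.maximalAtlas (𝓡 3) ∞ M :=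
    IsManifold.chart_mem_maximalAtlas _
  have hp := mem_chart_source (R 3) p
  obtain ⟨Ψ, J, N, b, hpΨ⟩ := (D.isSplitOn he).exists_leafBox hc ((chartAt (R 3) p).map_source hp)
  have hmem := Ψ.map_source hpΨ
  rw [b.target_eq] at hmem
  refine ⟨_, he, Ψ, J, N, _, hmem.1, _, hmem.2, b, hp, hpΨ, ?_⟩
  rw [b.fst_eq _ hpΨ, Function.comp_apply, (chartAt (R 3) p).left_inv hp]

lemma continuous_form [IsManifold (𝓡 3) ∞ M] (D : SplitData F ξ H) :
    Continuous fun p => D.form (F p) := by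
  refine D.form.continuous.comp (continuous_iff_continuousAt.2 fun p => ?_)
  set e := chartAt (R 3) p
  have hp : p ∈ e.source := mem_chart_source _ _
  have h1 : ContinuousAt (F ∘ e.symm) (e p) :=
    ((D.axial e (IsManifold.chart_mem_maximalAtlas _)).contDiffAt (e.map_source hp)).continuousAt
  refine (ContinuousAt.comp h1 (e.continuousAt hp)).congr
    (Filter.eventuallyEq_of_mem (e.open_source.mem_nhds hp) fun q hq => ?_)
  simp [e.left_inv hq]

/-- The scaling factor of the leaves as a function of the first coordinate. -/
def profile [Nonempty M] (D : SplitData F ξ H) (t : ℝ) : ℝ :=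
  onManifold (scaleFun H) F ξ (Function.invFun (fun p => D.form (F p)) t)

lemma range_subset (D : SplitData F ξ H) {e : OpenPartialHomeomorph M (R 3)}
    {Ψ : OpenPartialHomeomorph (R 3) (ℝ × R 2)} {J : Set ℝ} {N : Set (R 2)}
    (b : IsLeafBox (F ∘ e.symm) (ξ ∘ e.symm) H e.target D.form P Ψ J N) (hN : N.Nonempty) :
    J ⊆ Set.range fun p => D.form (F p) := fun t ht =>
  ⟨e.symm (Ψ.symm (t, hN.some)), b.l_symm ht hN.some_mem⟩

lemma isOpen_range [IsManifold (𝓡 3) ∞ M] (D : SplitData F ξ H) (hc : IsCoordinates D.form D.dir P S) :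
    IsOpen (Set.range fun p => D.form (F p)) := by
  refine isOpen_iff_mem_nhds.2 ?_
  rintro _ ⟨p, rfl⟩
  obtain ⟨e, he, Ψ, J, N, t₀, ht₀, n₀, hn₀, b, hp, hpΨ, rfl⟩ := D.exists_leafBox hc p
  exact Filter.mem_of_superset (b.isOpen_J.mem_nhds ht₀) (D.range_subset b ⟨n₀, hn₀⟩)

variable [IsManifold (𝓡 3) ∞ M] [ConnectedSpace M]

/-- The point chosen over t in the definition of the profile is immaterial, because the scale
depends only on l∘F. -/
lemma profile_eq (D : SplitData F ξ H) (hc : IsCoordinates D.form D.dir P S)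
    {e : OpenPartialHomeomorph M (R 3)} (he : e ∈ IsManifold.maximalAtlas (𝓡 3) ∞ M) {x : R 3}
    (hx : x ∈ e.target) :
    D.profile (D.form (F (e.symm x))) = scaleFun H (F ∘ e.symm) (ξ ∘ e.symm) x := by
  rw [← D.axial.onManifold_symm (isIntrinsic_scaleFun H) he hx]
  exact D.scaleFun_eq hc (Function.invFun_eq (f := fun p => D.form (F p)) ⟨e.symm x, rfl⟩)

/-- Near t₀ the profile is the scale function along the curve s ↦ (s, n₀) of a leaf box, hence
smooth. -/
lemma contDiffOn_profile (D : SplitData F ξ H) (hc : IsCoordinates D.form D.dir P S) :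
    ContDiffOn ℝ ∞ D.profile (Set.range fun p => D.form (F p)) := by
  rintro _ ⟨p, rfl⟩
  obtain ⟨e, he, Ψ, J, N, t₀, ht₀, n₀, hn₀, b, hp, hpΨ, rfl⟩ := D.exists_leafBox hc p
  have hx := b.symm_mem ht₀ hn₀
  have h1 : ContDiffAt ℝ ∞ (fun s : ℝ => Ψ.symm (s, n₀)) (D.form (F p)) :=
    (b.contDiffAt_symm _ (b.mem_target ht₀ hn₀)).comp (D.form (F p))
      (contDiffAt_id.prodMk contDiffAt_const)
  have h2 : ContDiffAt ℝ ∞ (fun s : ℝ => scaleFun H (F ∘ e.symm) (ξ ∘ e.symm) (Ψ.symm (s, n₀)))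
      (D.form (F p)) :=
    ContDiffAt.comp (g := scaleFun H (F ∘ e.symm) (ξ ∘ e.symm)) (D.form (F p))
      ((D.axial e he).contDiffAt_scaleFun hx (D.nu_ne_zero e he _ hx)) h1
  refine (h2.congr_of_eventuallyEq (Filter.eventuallyEq_of_mem (b.isOpen_J.mem_nhds ht₀)
    fun s hs => ?_)).contDiffWithinAt
  rw [← D.profile_eq hc he (b.symm_mem hs hn₀)]
  exact congrArg D.profile (b.l_symm hs hn₀).symm

/-- Applying P to the formula with base point, multiple of d and radial vector kills d, since P d =
0. Only the radial part, rescaled by y, is left. -/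
lemma position_eq (D : SplitData F ξ H) (hc : IsCoordinates D.form D.dir P S)
    {e : OpenPartialHomeomorph M (R 3)} (he : e ∈ IsManifold.maximalAtlas (𝓡 3) ∞ M) {x : R 3}
    (hx : x ∈ e.target) : P (F (e.symm x)) - P D.center
      = D.profile (D.form (F (e.symm x))) • P (leafVec H (F ∘ e.symm) (ξ ∘ e.symm) x) := by
  have hν := D.nu_ne_zero e he x hx
  have hy := (scaleFun_pos H (F ∘ e.symm) (ξ ∘ e.symm) x).ne'
  rw [D.profile_eq hc he hx, leafVec]
  conv_lhs => rw [D.position e he x hx]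
  simp only [map_add, map_smul, hc.P_d]
  match_scalars <;> field_simp <;> ring

end SplitData

end

end AffineSphere

end

/-! ### Assembly of the product parametrization. -/

theorem theorem7 {M : Type*} [TopologicalSpace M] [ChartedSpace (R 3) M]
    [IsManifold (𝓡 3) ∞ M] [T2Space M] [SecondCountableTopology M] [ConnectedSpace M]
    (F ξ : M → R 4) (H : ℝ)
    (hF : IsIndefiniteAffineHypersphere F ξ H)
    (hsym : HasPointwiseZ3OrSO2Symmetry F ξ)
    (hν : NuNeZeroSomewhere F ξ H) :
    ∃ (A : R 4 ≃ᵃ[ℝ] ℝ × R 3) (I : Set ℝ) (γ₁ γ₂ : ℝ → ℝ) (ε : ℝ),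
      IsOpen I ∧ I.OrdConnected ∧ ContDiffOn ℝ ∞ γ₁ I ∧ ContDiffOn ℝ ∞ γ₂ I ∧
      ∀ p : M, ∃ (ψ : OpenPartialHomeomorph (ℝ × R 2) M) (J : Set ℝ) (N : Set (R 2))
        (φ : R 2 → R 3),
        IsProductParametrization ψ J N ∧ J ⊆ I ∧ p ∈ ψ.target ∧
        IsPosDefProperAffineSphereOn φ ε N ∧
        (∀ t ∈ J, ∀ y ∈ N, A (F (ψ (t, y))) = (γ₁ t, γ₂ t • φ y)) ∧
        (HasPointwiseSO2Symmetry F ξ →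
          ∃ Q : Set (R 3), (IsEllipsoid Q ∨ IsTwoSheetedHyperboloid Q) ∧ φ '' N ⊆ Q) := by
  have hax := hF.isAxial hsym
  obtain ⟨D⟩ := hax.exists_splitData (hν.exists_nuFun_ne_zero hax)
  obtain ⟨P, S, hc⟩ := D.exists_isCoordinates
  -- The affine map is (l, P), translated so that the line of centres becomes the axis ℝ × 0. As l∘F
  -- is itself the parameter t, the first component of the curve is the identity and the second is
  -- the profile.
  refine ⟨hc.linearEquiv.toAffineEquiv.trans
      (AffineEquiv.constVAdd ℝ (ℝ × R 3) ((0 : ℝ), -P D.center)),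
    Set.range fun p => D.form (F p), id, D.profile, D.ε, D.isOpen_range hc,
    (isPreconnected_range D.continuous_form).ordConnected, contDiffOn_id, D.contDiffOn_profile hc,
    fun p => ?_⟩
  obtain ⟨e, he, Ψ, J, N, t₀, ht₀, n₀, hn₀, b, hp, hpΨ, -⟩ := D.exists_leafBox hc p
  have hs := D.isSplitOn he
  have L := b.isLeaf hs ht₀
  -- The model surface φ is the normalized leaf through p, at t₀.
  refine ⟨(e.trans Ψ).symm, J, N, leafMap H (F ∘ e.symm) (ξ ∘ e.symm) P fun n => Ψ.symm (t₀, n),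
    b.isProductParametrization he ⟨n₀, hn₀⟩, D.range_subset b ⟨n₀, hn₀⟩, ?_,
    L.isPosDefProperAffineSphereOn hs hc D.sign (D.abs_nu e he), fun t ht y hy => ?_, fun hso =>
    L.exists_quadric hs hc D.sign (D.abs_nu e he) b.convex_N ⟨n₀, hn₀⟩ fun x hx u v hu hv =>
      hs.differenceMap_eq_smul_of_SO2 hx (hso e he x hx) hu hv⟩
  · have : p ∈ (e.trans Ψ).source := by
      rw [OpenPartialHomeomorph.trans_source]
      exact ⟨hp, hpΨ⟩
    exact this
  · have hl : D.form (F (e.symm (Ψ.symm (t, y)))) = t := b.l_symm ht hy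
    have h1 := D.position_eq hc he (b.symm_mem ht hy)
    -- Independence of the normalized leaf from t replaces the leaf at t by the one at t₀.
    rw [hl, b.leafVec_eq t ht t₀ ht₀ y hy] at h1
    change ((0 : ℝ), -P D.center) +ᵥ (D.form (F (e.symm (Ψ.symm (t, y)))),
      P (F (e.symm (Ψ.symm (t, y))))) = _
    rw [vadd_eq_add, Prod.mk_add_mk, zero_add, hl, neg_add_eq_sub, h1]
    rfl
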